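/- Let $n>2$, let $(N,h)$ be a smooth $n$-dimensional Riemannian manifold, let $\rho\in C^\infty(N)$, put $\widetilde h=e^{2\rho}h$ and $\alpha=d\rho$. For a smooth map $\phi:(M,g)\to(N',h')$ of Riemannian manifolds let $\tau(\phi)=\operatorname{trace}_g\nabla d\phi$ be its tension field. The map $\phi$ is called biharmonic if, for every compact $K\subseteq M$, it is a critical point of the bienergy $E_2(\phi)=\frac12\int_K|\tau(\phi)|^2\,v_g$, that is, $\frac{d}{dt}\big|_{t=0}E_2(\phi_t)=0$ for every smooth variation $(\phi_t)_{|t|<\varepsilon}$ of $\phi=\phi_0$ with $\phi_t=\phi$ outside $K$. If the identity map $\mathbf 1:(N,h)\to(N,\widetilde h)$ is biharmonic, then the following identity of 2-forms holds on $N$: $$(4-n)\,d|\alpha|^2\wedge\alpha+2\,(\operatorname{Ricci}\alpha^\sharp)^\flat\wedge\alpha+d\big((\operatorname{Ricci}\alpha^\sharp)^\flat\big)=0.$$ Here $|\cdot|$, the Ricci operator $\operatorname{Ricci}:TN\to TN$ and the musical isomorphisms $\sharp:T^*N\to TN$, $\flat:TN\to T^*N$ are those of $h$, with the sign convention $h(\operatorname{Ricci}Y,Z)=\operatorname{tr}\big(X\mapsto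 R(X,Y)Z\big)$, $R(X,Y)=[\nabla_X,\nabla_Y]-\nabla_{[X,Y]}$. -/

import Mathlib

open scoped Manifold ContDiff Bundle

namespace ConformalBiharmonic

/-- `ℝⁿ`, the model space of an `n`-dimensional manifold. -/
abbrev Euc (n : ℕ) : Type := EuclideanSpace ℝ (Fin n)

/-- A smooth Riemannian metric on a smooth `n`-manifold. -/
abbrev RMetric (n : ℕ) (M : Type*) [TopologicalSpace M] [ChartedSpace (Euc n) M]
    [IsManifold (𝓡 n) ∞ M] : Type _ :=
  Bundle.ContMDiffRiemannianMetric (𝓡 n) ∞ (Euc n) (fun x : M => TangentSpace (𝓡 n) x)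

/-- The partial derivative `∂f/∂uⁱ` of a function on `ℝⁿ`. -/
noncomputable def pd {n : ℕ} (i : Fin n) (f : Euc n → ℝ) (u : Euc n) : ℝ :=
  fderiv ℝ f u (EuclideanSpace.single i 1)

section Local

variable {n : ℕ} {M : Type*} [TopologicalSpace M] [ChartedSpace (Euc n) M]

/-- The coordinate vector `∂ᵢ` of the chart at `x₀`, at the point with coordinates `u`. -/
noncomputable def coordVec (x₀ : M) (u : Euc n) (i : Fin n) :
    TangentSpace (𝓡 n) ((extChartAt (𝓡 n) x₀).symm u) :=
  mfderiv 𝓘(ℝ, Euc n) (𝓡 n) (extChartAt (𝓡 n) x₀).symm u (EuclideanSpace.single i (1 : ℝ))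

/-- The tangent vector at `x` whose components in the chart at `x` are `c`. (The tangent space
at `x` is the model space, identified through the chart at `x`.) -/
noncomputable def ofComponents (x : M) (c : Fin n → ℝ) : TangentSpace (𝓡 n) x :=
  (WithLp.toLp 2 c : Euc n)

/-- The components of a tangent vector at `x` in the chart at `x`. -/
noncomputable def components (x : M) (v : TangentSpace (𝓡 n) x) : Fin n → ℝ :=
  WithLp.ofLp (p := 2) (V := Fin n → ℝ) v

variable [IsManifold (𝓡 n) ∞ M]

/-- The matrix `gᵢⱼ` of the metric in the chart at `x₀`. -/
noncomputable def gram (g : RMetric n M) (x₀ : M) (u : Euc n) : Matrix (Fin n) (Fin n) ℝ :=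
  Matrix.of fun i j =>
    g.inner ((extChartAt (𝓡 n) x₀).symm u) (coordVec x₀ u i) (coordVec x₀ u j)

/-- The Christoffel symbol `Γᵏᵢⱼ` of the Levi-Civita connection in the chart at `x₀`:
`½ gᵏˡ (∂ᵢ gⱼₗ + ∂ⱼ gᵢₗ - ∂ₗ gᵢⱼ)`. -/
noncomputable def christoffel (g : RMetric n M) (x₀ : M) (k i j : Fin n) (u : Euc n) : ℝ :=
  (1 / 2) * ∑ l, (gram g x₀ u)⁻¹ k l *
    (pd i (fun w => gram g x₀ w j l) u + pd j (fun w => gram g x₀ w i l) u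
      - pd l (fun w => gram g x₀ w i j) u)

/-- The curvature component `Rˡᵢⱼₖ`, where `R(∂ᵢ, ∂ⱼ)∂ₖ = Rˡᵢⱼₖ ∂ₗ` and
`R(X, Y) = [∇_X, ∇_Y] - ∇_[X, Y]`, in the chart at `x₀`. -/
noncomputable def riemann (g : RMetric n M) (x₀ : M) (l i j k : Fin n) (u : Euc n) : ℝ :=
  pd i (christoffel g x₀ l j k) u - pd j (christoffel g x₀ l i k) u
    + ∑ m, (christoffel g x₀ m j k u * christoffel g x₀ l i m u
      - christoffel g x₀ m i k u * christoffel g x₀ l j m u)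

/-- The Ricci tensor `Ric(∂ⱼ, ∂ₖ) = tr (X ↦ R(X, ∂ⱼ)∂ₖ)` in the chart at `x₀`. -/
noncomputable def ricciTensor (g : RMetric n M) (x₀ : M) (j k : Fin n) (u : Euc n) : ℝ :=
  ∑ i, riemann g x₀ i i j k u

/-- The Ricci operator `Ricci : T_xM → T_xM`, i.e. `g(Ricci v, w) = Ric(v, w)`. -/
noncomputable def ricciOp (g : RMetric n M) (x : M) (v : TangentSpace (𝓡 n) x) :
    TangentSpace (𝓡 n) x :=
  ofComponents x fun l => ∑ j, ∑ k, (gram g x (extChartAt (𝓡 n) x x))⁻¹ l k *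
    ricciTensor g x j k (extChartAt (𝓡 n) x x) * components x v j

/-- The musical isomorphism `♭`. -/
noncomputable def flat (g : RMetric n M) (x : M) (v : TangentSpace (𝓡 n) x) :
    TangentSpace (𝓡 n) x →L[ℝ] ℝ :=
  g.inner x v

/-- The musical isomorphism `♯`: the vector with components `gⁱʲ ηⱼ`. -/
noncomputable def sharp (g : RMetric n M) (x : M) (η : TangentSpace (𝓡 n) x →L[ℝ] ℝ) :
    TangentSpace (𝓡 n) x :=
  ofComponents x fun i => ∑ j, (gram g x (extChartAt (𝓡 n) x x))⁻¹ i j *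
    η (ofComponents x (Pi.single j 1))

/-- The squared norm `|η|²` of a covector. -/
noncomputable def normSq (g : RMetric n M) (x : M) (η : TangentSpace (𝓡 n) x →L[ℝ] ℝ) : ℝ :=
  g.inner x (sharp g x η) (sharp g x η)

end Local

section Forms

variable {n : ℕ} {M : Type*} [TopologicalSpace M] [ChartedSpace (Euc n) M]

/-- The exterior derivative `df` of a function. -/
noncomputable def extDeriv₀ (f : M → ℝ) (x : M) : TangentSpace (𝓡 n) x →L[ℝ] ℝ :=
  mfderiv (𝓡 n) 𝓘(ℝ, ℝ) f x

/-- The pull-back of a 1-form by the inverse of the chart at `x₀`: a 1-form on `ℝⁿ`. -/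
noncomputable def chartForm (η : (x : M) → TangentSpace (𝓡 n) x →L[ℝ] ℝ) (x₀ : M) (u : Euc n) :
    Euc n →L[ℝ] ℝ :=
  (η ((extChartAt (𝓡 n) x₀).symm u)).comp
    (mfderiv 𝓘(ℝ, Euc n) (𝓡 n) (extChartAt (𝓡 n) x₀).symm u)

/-- The exterior derivative of a 1-form, computed in the chart at `x`:
`dη(X, Y) = X(η(Y)) - Y(η(X))` for constant vector fields `X`, `Y` in the chart. -/
noncomputable def extDeriv₁ (η : (x : M) → TangentSpace (𝓡 n) x →L[ℝ] ℝ) (x : M)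
    (X Y : TangentSpace (𝓡 n) x) : ℝ :=
  fderiv ℝ (chartForm η x) (extChartAt (𝓡 n) x x) X Y
    - fderiv ℝ (chartForm η x) (extChartAt (𝓡 n) x x) Y X

/-- The wedge product of two covectors. -/
noncomputable def wedge {x : M} (β γ : TangentSpace (𝓡 n) x →L[ℝ] ℝ) (X Y : TangentSpace (𝓡 n) x) : ℝ :=
  β X * γ Y - β Y * γ X

end Forms

section Maps

variable {m n : ℕ} {M N : Type*} [TopologicalSpace M] [ChartedSpace (Euc m) M]
  [IsManifold (𝓡 m) ∞ M] [TopologicalSpace N] [ChartedSpace (Euc n) N] [IsManifold (𝓡 n) ∞ N]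

/-- The component `(∇dφ)^c(∂ᵢ, ∂ⱼ)` at `x` of the second fundamental form of `φ : (M, g) → (N, h)`,
in the charts at `x` and at `φ x`:
`∂ᵢ∂ⱼφ^c - Γᵏᵢⱼ ∂ₖφ^c + Γ̃^c_ab(φ) ∂ᵢφ^a ∂ⱼφ^b`. -/
noncomputable def secondFundamentalForm (g : RMetric m M) (h : RMetric n N) (φ : M → N) (x : M)
    (c : Fin n) (i j : Fin m) : ℝ :=
  let u : Euc m := extChartAt (𝓡 m) x x
  let F : Fin n → Euc m → ℝ := fun a w => writtenInExtChartAt (𝓡 m) (𝓡 n) x φ w a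
  pd i (pd j (F c)) u - ∑ k, christoffel g x k i j u * pd k (F c) u
    + ∑ a, ∑ b, christoffel h (φ x) c a b (extChartAt (𝓡 n) (φ x) (φ x)) *
        pd i (F a) u * pd j (F b) u

/-- The tension field `τ(φ) = trace_g ∇dφ`, a section of `φ⁻¹TN`. -/
noncomputable def tension (g : RMetric m M) (h : RMetric n N) (φ : M → N) (x : M) :
    TangentSpace (𝓡 n) (φ x) :=
  ofComponents (φ x) fun c => ∑ i, ∑ j, (gram g x (extChartAt (𝓡 m) x x))⁻¹ i j *
    secondFundamentalForm g h φ x c i j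

/-- The Riemannian measure of the domain of the chart at `x₀`: `√(det gᵢⱼ) du¹ ⋯ duᵐ`, transported
to the manifold and extended by zero. -/
noncomputable def chartVolume [MeasurableSpace M] (g : RMetric m M) (x₀ : M) :
    MeasureTheory.Measure M :=
  ((MeasureTheory.volume.restrict (extChartAt (𝓡 m) x₀).target).withDensity
    fun u => ENNReal.ofReal (Real.sqrt (gram g x₀ u).det)).map (extChartAt (𝓡 m) x₀).symm

/-- The Riemannian measure `v_g`. The measures `chartVolume g x₀` agree on the overlaps of the chart
domains, so that their supremum restricts to `chartVolume g x₀` on the domain of the chart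
at `x₀`. -/
noncomputable def riemannianVolume [MeasurableSpace M] (g : RMetric m M) :
    MeasureTheory.Measure M :=
  ⨆ x₀ : M, chartVolume g x₀

/-- The bienergy `E₂(φ) = ½ ∫_K |τ(φ)|² v_g` over `K`. -/
noncomputable def bienergy [MeasurableSpace M] (g : RMetric m M) (h : RMetric n N) (K : Set M)
    (φ : M → N) : ℝ :=
  (1 / 2) * ∫ x in K, h.inner (φ x) (tension g h φ x) (tension g h φ x) ∂(riemannianVolume g)

/-- `φ : (M, g) → (N, h)` is biharmonic: it is smooth, and for every compact `K ⊆ M` it is a critical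
point of the bienergy over `K` among all smooth variations `φ_t`, `t ∈ (-ε, ε)`, of `φ = φ₀` which
are fixed outside `K`. -/
def IsBiharmonic [MeasurableSpace M] (g : RMetric m M) (h : RMetric n N) (φ : M → N) : Prop :=
  ContMDiff (𝓡 m) (𝓡 n) ∞ φ ∧
  ∀ (K : Set M), IsCompact K → ∀ (ε : ℝ), 0 < ε → ∀ (Φ : ℝ → M → N),
    ContMDiffOn (𝓘(ℝ, ℝ).prod (𝓡 m)) (𝓡 n) ∞ (fun p : ℝ × M => Φ p.1 p.2)
      (Set.Ioo (-ε) ε ×ˢ Set.univ) →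
    Φ 0 = φ →
    (∀ t ∈ Set.Ioo (-ε) ε, ∀ x ∉ K, Φ t x = φ x) →
    HasDerivAt (fun t => bienergy g h K (Φ t)) 0 0

end Maps

section Conformal

variable {n : ℕ} {N : Type*} [TopologicalSpace N] [ChartedSpace (Euc n) N]
  [IsManifold (𝓡 n) ∞ N]

set_option synthInstance.maxHeartbeats 400000 in
/-- The conformal metric `e^{2ρ} h`. -/
noncomputable def conformal (h : RMetric n N) (ρ : N → ℝ) (hρ : ContMDiff (𝓡 n) 𝓘(ℝ, ℝ) ∞ ρ) :
    RMetric n N where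
  inner x := Real.exp (2 * ρ x) • h.inner x
  symm x v w := by simp [h.symm x v w]
  pos x v hv := by
    have := h.pos x v hv
    simp only [smul_apply, smul_eq_mul]
    positivity
  isVonNBounded x := by
    have hb := (h.isVonNBounded x).image
      (Real.exp (-ρ x) • ContinuousLinearMap.id ℝ (TangentSpace (𝓡 n) x))
    refine hb.subset ?_
    intro v hv
    refine ⟨Real.exp (ρ x) • v, ?_, ?_⟩
    · simp only [Set.mem_ofPred_eq, smul_apply, smul_eq_mul, map_smul] at hv ⊢
      rw [two_mul, Real.exp_add] at hv
      linarith
    · simp [smul_smul, ← Real.exp_add]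
  contMDiff := by
    have hs : ContMDiff (𝓡 n) 𝓘(ℝ, ℝ) ∞ (fun x => Real.exp (2 * ρ x)) :=
      (Real.contDiff_exp.comp (contDiff_const.mul contDiff_id)).contMDiff.comp hρ
    exact hs.smul_section h.contMDiff

end Conformal

end ConformalBiharmonic

/-! Write α = dρ, F = e^{2ρ}, q = |α|² and P = div(Fα), with all operators those of h. The identity
into (N, F h) has tension field trace_h(Γ̃ − Γ) = (2 − n) grad ρ, where Γ̃ and Γ are the two
Levi-Civita connections. Testing the bienergy against u ↦ u + tη(u)Z in a chart, with Z a constant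
vector and η smooth of compact support, and cancelling the nonzero factor 2 − n, gives dP + 2F ω +
(6 − n)F q α + (1 − n/2)F dq − 4P α = 0, where ω = (Ricci α♯)♭. The Ricci term appears when the
derivative in the direction Z is commuted with the divergence.

Solving for ω yields ω = −½(F⁻¹ dP + ((6 − n)q − 4F⁻¹P)α + (1 − n/2) dq). Since dα = 0 and dF⁻¹ =
−2F⁻¹α, it follows that dω = F⁻¹ dP∧α − ½(6 − n) dq∧α and 2ω∧α = −F⁻¹ dP∧α − (1 − n/2) dq∧α. The
only third-order term, dP∧α, cancels in the sum, which leaves (n − 4) dq∧α. This is the claim.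

The analysis takes place on open subsets of ℝⁿ. `LocalMetric.koszul` characterises the connection,
`LocalMetric.fderiv_trc` lets derivatives pass through metric traces, and `LocalMetric.integral_dvg`
is the divergence theorem. `ConformalPair.hasDerivAt_integral_varyEnergy` is the first variation and
`ConformalPair.euler_eq` evaluates it invariantly. Since the tension field and the measure are
defined pointwise in varying charts, `inner_tension` and `integral_riemannianVolume` bring them into
one fixed chart, using the transformation laws of `CoordChange`. The equation for ω is `ricForm_eq`,
its exterior derivative is `fderiv_ricForm`, and `ricForm_identity` combines the two. -/

namespace ConformalBiharmonic

/-! ### Traces with respect to an inner product on `ℝⁿ` -/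

section Trace

variable {n : ℕ}

/-- Bilinear forms on `ℝⁿ`. -/
abbrev Bil (n : ℕ) : Type := Euc n →L[ℝ] Euc n →L[ℝ] ℝ

/-- The standard basis of `ℝⁿ`. -/
noncomputable def bas (i : Fin n) : Euc n := EuclideanSpace.single i (1 : ℝ)

lemma bas_apply (i j : Fin n) : bas i j = if j = i then (1 : ℝ) else 0 := by
  simp [bas, PiLp.single_apply]

lemma sum_bas (X : Euc n) : ∑ i, X i • bas i = X := by
  ext j
  simp [bas_apply]

lemma map_eq_sum_bas {W : Type*} [AddCommGroup W] [Module ℝ W] (γ : Euc n →ₗ[ℝ] W) (X : Euc n) :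
    γ X = ∑ i, X i • γ (bas i) := by
  conv_lhs => rw [← sum_bas X, map_sum]
  simp

/-- Positive definite symmetric bilinear forms. -/
structure IsInner (A : Bil n) : Prop where
  symm : ∀ X Y, A X Y = A Y X
  pos : ∀ X, X ≠ 0 → 0 < A X X

/-- The matrix of a bilinear form. -/
noncomputable def mat (A : Bil n) : Matrix (Fin n) (Fin n) ℝ :=
  Matrix.of fun i j => A (bas i) (bas j)

lemma mat_apply (A : Bil n) (i j : Fin n) : mat A i j = A (bas i) (bas j) := rfl

lemma bil_eq_sum (A : Bil n) (X Y : Euc n) : A X Y = ∑ i, ∑ j, X i * Y j * mat A i j := by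
  have h1 : A X Y = ∑ i, X i • A (bas i) Y := by
    have := map_eq_sum_bas ((A.flip Y : Euc n →L[ℝ] ℝ) : Euc n →ₗ[ℝ] ℝ) X
    simpa using this
  rw [h1]
  refine Finset.sum_congr rfl fun i _ => ?_
  have := map_eq_sum_bas ((A (bas i) : Euc n →L[ℝ] ℝ) : Euc n →ₗ[ℝ] ℝ) Y
  simp only [ContinuousLinearMap.coe_coe, smul_eq_mul] at this
  rw [this, smul_eq_mul, Finset.mul_sum]
  refine Finset.sum_congr rfl fun j _ => ?_
  rw [mat_apply]; ring

lemma IsInner.posDef {A : Bil n} (hA : IsInner A) : (mat A).PosDef := by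
  refine Matrix.PosDef.of_dotProduct_mulVec_pos ?_ ?_
  · exact Matrix.IsHermitian.ext fun i j => hA.symm _ _
  · intro x hx
    have hne : (WithLp.toLp 2 x : Euc n) ≠ 0 := by
      intro h0
      exact hx (by simpa using h0)
    have := hA.pos _ hne
    rw [bil_eq_sum] at this
    refine this.trans_eq ?_
    simp only [dotProduct, Matrix.mulVec, Pi.star_apply, star_trivial, Finset.mul_sum]
    refine Finset.sum_congr rfl fun i _ => Finset.sum_congr rfl fun j _ => ?_
    ring

lemma IsInner.det_pos {A : Bil n} (hA : IsInner A) : 0 < (mat A).det := hA.posDef.det_pos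

lemma IsInner.isUnit_det {A : Bil n} (hA : IsInner A) : IsUnit (mat A).det :=
  hA.det_pos.ne'.isUnit

lemma IsInner.inv_symm {A : Bil n} (hA : IsInner A) (i j : Fin n) :
    (mat A)⁻¹ i j = (mat A)⁻¹ j i := by
  have h := hA.posDef.isHermitian.inv
  have := congrFun (congrFun h i) j
  simpa using this.symm

/-- The trace `Aⁱʲ B(eᵢ, eⱼ)`. -/
noncomputable def trc {W : Type*} [AddCommGroup W] [Module ℝ W] (A : Bil n)
    (B : Euc n → Euc n → W) : W :=
  ∑ i, ∑ j, (mat A)⁻¹ i j • B (bas i) (bas j)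

section

variable {W : Type*} [AddCommGroup W] [Module ℝ W] {A : Bil n}

lemma trc_add (A : Bil n) (B C : Euc n → Euc n → W) :
    trc A (fun X Y => B X Y + C X Y) = trc A B + trc A C := by
  simp [trc, smul_add, Finset.sum_add_distrib]

lemma trc_sub (A : Bil n) (B C : Euc n → Euc n → W) :
    trc A (fun X Y => B X Y - C X Y) = trc A B - trc A C := by
  simp [trc, smul_sub, Finset.sum_sub_distrib]

lemma trc_smul (A : Bil n) (c : ℝ) (B : Euc n → Euc n → W) :
    trc A (fun X Y => c • B X Y) = c • trc A B := by
  simp only [trc, Finset.smul_sum]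
  refine Finset.sum_congr rfl fun i _ => Finset.sum_congr rfl fun j _ => ?_
  rw [smul_comm]

lemma trc_mul (A : Bil n) (c : ℝ) (B : Euc n → Euc n → ℝ) :
    trc A (fun X Y => c * B X Y) = c * trc A B :=
  trc_smul A c B

lemma trc_map {W' : Type*} [AddCommGroup W'] [Module ℝ W'] (A : Bil n) (γ : W →ₗ[ℝ] W')
    (B : Euc n → Euc n → W) : trc A (fun X Y => γ (B X Y)) = γ (trc A B) := by
  simp [trc, map_sum]

lemma IsInner.trc_swap (hA : IsInner A) (B : Euc n → Euc n → W) :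
    trc A (fun X Y => B Y X) = trc A B := by
  rw [trc, trc, Finset.sum_comm]
  refine Finset.sum_congr rfl fun i _ => Finset.sum_congr rfl fun j _ => ?_
  rw [hA.inv_symm]

/-- Lowering an index and raising it again is the identity, because the inverse Gram matrix cancels
the Gram matrix. Most contractions below reduce to this one. -/
lemma IsInner.trc_pair (hA : IsInner A) (Z : Euc n) (γ : Euc n →ₗ[ℝ] W) :
    trc A (fun X Y => A X Z • γ Y) = γ Z := by
  have h1 : ∀ j, ∑ i, (mat A)⁻¹ i j * A (bas i) Z = Z j := by
    intro j
    have h2 : ∀ i, A (bas i) Z = ∑ k, mat A i k * Z k := by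
      intro i
      have := map_eq_sum_bas ((A (bas i) : Euc n →L[ℝ] ℝ) : Euc n →ₗ[ℝ] ℝ) Z
      simp only [ContinuousLinearMap.coe_coe, smul_eq_mul] at this
      rw [this]
      exact Finset.sum_congr rfl fun k _ => mul_comm _ _
    have h3 : (mat A)⁻¹ * mat A = 1 := Matrix.nonsing_inv_mul _ hA.isUnit_det
    calc ∑ i, (mat A)⁻¹ i j * A (bas i) Z
        = ∑ k, (∑ i, (mat A)⁻¹ j i * mat A i k) * Z k := by
          simp only [h2, Finset.mul_sum, Finset.sum_mul]
          rw [Finset.sum_comm]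
          refine Finset.sum_congr rfl fun k _ => Finset.sum_congr rfl fun i _ => ?_
          rw [hA.inv_symm i j]; ring
      _ = ∑ k, (1 : Matrix (Fin n) (Fin n) ℝ) j k * Z k := by
          rw [← h3]; simp [Matrix.mul_apply]
      _ = Z j := by simp [Matrix.one_apply]
  rw [map_eq_sum_bas γ Z, trc, Finset.sum_comm]
  refine Finset.sum_congr rfl fun j _ => ?_
  simp only [smul_smul]
  rw [← Finset.sum_smul, h1]

lemma IsInner.trc_pair' (hA : IsInner A) (Z : Euc n) (γ : Euc n →ₗ[ℝ] W) :
    trc A (fun X Y => A Y Z • γ X) = γ Z := by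
  rw [hA.trc_swap (fun X Y => A X Z • γ Y), hA.trc_pair]

lemma IsInner.trc_self (hA : IsInner A) : trc A (fun X Y => A X Y) = (n : ℝ) := by
  have h3 : (mat A)⁻¹ * mat A = 1 := Matrix.nonsing_inv_mul _ hA.isUnit_det
  have h4 := congrArg Matrix.trace h3
  simp only [Matrix.trace, Matrix.diag, Matrix.mul_apply, Matrix.one_apply, if_true,
    Finset.sum_const, Finset.card_univ, Fintype.card_fin, nsmul_eq_mul, mul_one] at h4
  rw [← h4, trc]
  refine Finset.sum_congr rfl fun i _ => Finset.sum_congr rfl fun j _ => ?_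
  rw [smul_eq_mul, mat_apply, hA.symm]

lemma IsInner.eq_of_forall (hA : IsInner A) {X Y : Euc n} (h : ∀ Z, A X Z = A Y Z) : X = Y := by
  by_contra hne
  have h1 := hA.pos _ (sub_ne_zero.2 hne)
  simp only [map_sub, sub_apply] at h1
  have h2 := h X
  have h3 := h Y
  linarith

/-- The vector dual to a covector. -/
noncomputable def dualVec (A : Bil n) (η : Euc n →L[ℝ] ℝ) : Euc n :=
  trc A fun X Y => η Y • X

lemma IsInner.apply_dualVec (hA : IsInner A) (η : Euc n →L[ℝ] ℝ) (Z : Euc n) :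
    A (dualVec A η) Z = η Z := by
  have h1 := trc_map A ((A.flip Z : Euc n →L[ℝ] ℝ) : Euc n →ₗ[ℝ] ℝ) (fun X Y => η Y • X)
  have h2 := hA.trc_pair Z (η : Euc n →ₗ[ℝ] ℝ)
  simp only [ContinuousLinearMap.coe_coe, ContinuousLinearMap.flip_apply, map_smul,
    smul_eq_mul] at h1 h2
  rw [dualVec, ← h1, ← h2]
  congr 1
  funext X Y
  ring

lemma IsInner.trc_dual (hA : IsInner A) (η : Euc n →L[ℝ] ℝ) (γ : Euc n →ₗ[ℝ] W) :
    trc A (fun X Y => η X • γ Y) = γ (dualVec A η) := by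
  rw [← hA.trc_pair (dualVec A η) γ]
  congr 1
  funext X Y
  rw [hA.symm, hA.apply_dualVec]

/-- The pull-back of a bilinear form. -/
noncomputable def pullBil (A : Bil n) (J : Euc n →L[ℝ] Euc n) : Bil n := A.bilinearComp J J

lemma pullBil_apply (A : Bil n) (J : Euc n →L[ℝ] Euc n) (X Y : Euc n) :
    pullBil A J X Y = A (J X) (J Y) := rfl

/-- The matrix of an endomorphism. -/
noncomputable def jac (J : Euc n →L[ℝ] Euc n) : Matrix (Fin n) (Fin n) ℝ :=
  Matrix.of fun i j => J (bas j) i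

lemma jac_det (J : Euc n →L[ℝ] Euc n) : (jac J).det = J.det := by
  have h : jac J = LinearMap.toMatrix (EuclideanSpace.basisFun (Fin n) ℝ).toBasis
      (EuclideanSpace.basisFun (Fin n) ℝ).toBasis (J : Euc n →ₗ[ℝ] Euc n) := by
    ext i j
    simp [jac, LinearMap.toMatrix_apply, bas]
  rw [h, LinearMap.det_toMatrix]

lemma mat_pullBil (A : Bil n) (J : Euc n →L[ℝ] Euc n) :
    mat (pullBil A J) = (jac J).transpose * mat A * jac J := by
  ext i j
  rw [mat_apply, pullBil_apply, bil_eq_sum, Matrix.mul_apply, Finset.sum_comm]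
  refine Finset.sum_congr rfl fun l _ => ?_
  rw [Matrix.mul_apply, Finset.sum_mul]
  refine Finset.sum_congr rfl fun k _ => ?_
  simp only [jac, Matrix.transpose_apply, Matrix.of_apply]
  ring

lemma det_mat_pullBil (A : Bil n) (J : Euc n →L[ℝ] Euc n) :
    (mat (pullBil A J)).det = J.det ^ 2 * (mat A).det := by
  rw [mat_pullBil, Matrix.det_mul, Matrix.det_mul, Matrix.det_transpose, jac_det]
  ring

/-- The inverse Gram matrix transforms contravariantly, so its two Jacobian factors cancel those of
the arguments: the trace does not depend on coordinates. -/
lemma trc_pullBil (A : Bil n) {J : Euc n →L[ℝ] Euc n} (hJ : J.det ≠ 0)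
    (B : Euc n →ₗ[ℝ] Euc n →ₗ[ℝ] W) :
    trc (pullBil A J) (fun X Y => B (J X) (J Y)) = trc A (fun X Y => B X Y) := by
  have hu : IsUnit (jac J).det := by rw [jac_det]; exact hJ.isUnit
  have h1 : jac J * (mat (pullBil A J))⁻¹ * (jac J).transpose = (mat A)⁻¹ := by
    rw [mat_pullBil, Matrix.mul_inv_rev, Matrix.mul_inv_rev, ← Matrix.mul_assoc,
      Matrix.mul_nonsing_inv _ hu, Matrix.one_mul, Matrix.mul_assoc, Matrix.nonsing_inv_mul,
      Matrix.mul_one]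
    rwa [Matrix.det_transpose]
  have h2 : ∀ i j, B (J (bas i)) (J (bas j))
      = ∑ k, ∑ l, (jac J k i * jac J l j) • B (bas k) (bas l) := by
    intro i j
    have e1 := map_eq_sum_bas (B.flip (J (bas j))) (J (bas i))
    simp only [LinearMap.flip_apply] at e1
    rw [e1]
    refine Finset.sum_congr rfl fun k _ => ?_
    rw [map_eq_sum_bas (B (bas k)) (J (bas j)), Finset.smul_sum]
    refine Finset.sum_congr rfl fun l _ => ?_
    rw [smul_smul]; rfl
  simp only [trc, h2, Finset.smul_sum, smul_smul]
  have h3 : ∀ k l, (mat A)⁻¹ k l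
      = ∑ i, ∑ j, (mat (pullBil A J))⁻¹ i j * (jac J k i * jac J l j) := by
    intro k l
    rw [← h1, Matrix.mul_apply, Finset.sum_comm]
    refine Finset.sum_congr rfl fun j _ => ?_
    rw [Matrix.mul_apply, Finset.sum_mul]
    refine Finset.sum_congr rfl fun i _ => ?_
    rw [Matrix.transpose_apply]; ring
  simp only [h3, Finset.sum_smul]
  calc _ = ∑ i, ∑ k, ∑ l, ∑ j, ((mat (pullBil A J))⁻¹ i j * (jac J k i * jac J l j)) •
        B (bas k) (bas l) := by
        refine Finset.sum_congr rfl fun i _ => ?_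
        rw [Finset.sum_comm]
        refine Finset.sum_congr rfl fun k _ => ?_
        rw [Finset.sum_comm]
    _ = _ := by
        rw [Finset.sum_comm]
        refine Finset.sum_congr rfl fun k _ => ?_
        rw [Finset.sum_comm]

end

end Trace

end ConformalBiharmonic

namespace ConformalBiharmonic

/-! ### Riemannian metrics on open subsets of `ℝⁿ` -/

section LocalMetric

set_option synthInstance.maxHeartbeats 200000

variable {n : ℕ}

/-- Reduces an identity linear in a vector to basis vectors, where the index formulas apply. -/
lemma bas_induction {P : Euc n → Prop} (h0 : P 0) (hb : ∀ i, P (bas i))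
    (hadd : ∀ X Y, P X → P Y → P (X + Y)) (hsmul : ∀ (c : ℝ) X, P X → P (c • X)) (X : Euc n) :
    P X := by
  rw [← sum_bas X]
  exact Finset.sum_induction _ P hadd h0 fun i _ => hsmul _ _ (hb i)

namespace Shortcuts

variable {W : Type*} [NormedAddCommGroup W] [NormedSpace ℝ W]

noncomputable scoped instance : NormedAddCommGroup (Euc n) := inferInstance
noncomputable scoped instance : NormedSpace ℝ (Euc n) := inferInstance
noncomputable scoped instance : AddCommGroup (Euc n) := inferInstance
noncomputable scoped instance : AddCommMonoid (Euc n) := inferInstance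
noncomputable scoped instance : Module ℝ (Euc n) := inferInstance
noncomputable scoped instance : NormedAddCommGroup (Euc n →L[ℝ] W) := inferInstance
noncomputable scoped instance : NormedSpace ℝ (Euc n →L[ℝ] W) := inferInstance
noncomputable scoped instance : AddCommGroup (Euc n →L[ℝ] W) := inferInstance
noncomputable scoped instance : AddCommMonoid (Euc n →L[ℝ] W) := inferInstance
noncomputable scoped instance : Module ℝ (Euc n →L[ℝ] W) := inferInstance
noncomputable scoped instance : NormedAddCommGroup (Euc n →L[ℝ] Euc n →L[ℝ] W) := inferInstance
noncomputable scoped instance : NormedSpace ℝ (Euc n →L[ℝ] Euc n →L[ℝ] W) := inferInstance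
noncomputable scoped instance : AddCommGroup (Euc n →L[ℝ] Euc n →L[ℝ] W) := inferInstance
noncomputable scoped instance : AddCommMonoid (Euc n →L[ℝ] Euc n →L[ℝ] W) := inferInstance
noncomputable scoped instance : Module ℝ (Euc n →L[ℝ] Euc n →L[ℝ] W) := inferInstance
scoped instance : ChartedSpace (Euc n) (Euc n) := chartedSpaceSelf _

end Shortcuts

open scoped Shortcuts

variable {F G W : Type*} [NormedAddCommGroup F] [NormedSpace ℝ F]
  [NormedAddCommGroup G] [NormedSpace ℝ G] [NormedAddCommGroup W] [NormedSpace ℝ W]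

lemma fderiv_clm_apply_const {A : Euc n → F →L[ℝ] W} {u : Euc n} (hA : DifferentiableAt ℝ A u)
    (Y : F) (X : Euc n) : fderiv ℝ (fun w => A w Y) u X = fderiv ℝ A u X Y := by
  rw [fderiv_clm_apply hA (differentiableAt_const Y)]
  simp

lemma fderiv_bil_apply_const {A : Euc n → F →L[ℝ] G →L[ℝ] W} {u : Euc n}
    (hA : DifferentiableAt ℝ A u) (Y : F) (Z : G) (X : Euc n) :
    fderiv ℝ (fun w => A w Y Z) u X = fderiv ℝ A u X Y Z := by
  rw [fderiv_clm_apply_const (hA.clm_apply (differentiableAt_const Y)), fderiv_clm_apply_const hA]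

lemma fderiv_bil_apply {A : Euc n → F →L[ℝ] G →L[ℝ] W} {b : Euc n → F} {c : Euc n → G} {u : Euc n}
    (hA : DifferentiableAt ℝ A u) (hb : DifferentiableAt ℝ b u) (hc : DifferentiableAt ℝ c u)
    (X : Euc n) :
    fderiv ℝ (fun w => A w (b w) (c w)) u X
      = fderiv ℝ A u X (b u) (c u) + A u (fderiv ℝ b u X) (c u) + A u (b u) (fderiv ℝ c u X) := by
  rw [fderiv_clm_apply (hA.clm_apply hb) hc, fderiv_clm_apply hA hb]
  simp
  abel

/-- A smooth Riemannian metric on an open subset of `ℝⁿ`. -/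
structure LocalMetric (U : Set (Euc n)) (h : Euc n → Bil n) : Prop where
  isOpen : IsOpen U
  smooth : ContDiffOn ℝ ∞ h U
  inner : ∀ u ∈ U, IsInner (h u)

/-- The Christoffel symbols of a metric on `ℝⁿ`. -/
noncomputable def chr (h : Euc n → Bil n) (k i j : Fin n) (u : Euc n) : ℝ :=
  (1 / 2) * ∑ l, (mat (h u))⁻¹ k l *
    (pd i (fun w => mat (h w) j l) u + pd j (fun w => mat (h w) i l) u
      - pd l (fun w => mat (h w) i j) u)

/-- The bilinear map `(X, Y) ↦ Xⁱ Yʲ eₖ`. -/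
noncomputable def unitBil (k i j : Fin n) : Euc n →L[ℝ] Euc n →L[ℝ] Euc n :=
  (EuclideanSpace.proj i : Euc n →L[ℝ] ℝ).smulRight
    ((EuclideanSpace.proj j : Euc n →L[ℝ] ℝ).smulRight (bas k))

/-- The Christoffel symbols as a bilinear map. -/
noncomputable def gam (h : Euc n → Bil n) (u : Euc n) : Euc n →L[ℝ] Euc n →L[ℝ] Euc n :=
  ∑ k, ∑ i, ∑ j, chr h k i j u • unitBil k i j

lemma gam_bas (h : Euc n → Bil n) (u : Euc n) (i j : Fin n) :
    gam h u (bas i) (bas j) = ∑ k, chr h k i j u • bas k := by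
  simp [gam, unitBil, bas_apply]

lemma gam_bas_apply (h : Euc n → Bil n) (u : Euc n) (k i j : Fin n) :
    gam h u (bas i) (bas j) k = chr h k i j u := by
  rw [gam_bas]
  simp [bas_apply]

namespace LocalMetric

variable {U : Set (Euc n)} {h : Euc n → Bil n} {u : Euc n}

lemma contDiffAt (hh : LocalMetric U h) (hu : u ∈ U) : ContDiffAt ℝ ∞ h u :=
  hh.smooth.contDiffAt (hh.isOpen.mem_nhds hu)

lemma differentiableAt (hh : LocalMetric U h) (hu : u ∈ U) : DifferentiableAt ℝ h u :=
  (hh.contDiffAt hu).differentiableAt (by simp)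

lemma contDiffOn_mat (hh : LocalMetric U h) (i j : Fin n) :
    ContDiffOn ℝ ∞ (fun u => mat (h u) i j) U :=
  (hh.smooth.clm_apply contDiffOn_const).clm_apply contDiffOn_const

lemma contDiffOn_det {m : ℕ} {f : Euc n → Matrix (Fin m) (Fin m) ℝ}
    (hf : ∀ i j, ContDiffOn ℝ ∞ (fun u => f u i j) U) :
    ContDiffOn ℝ ∞ (fun u => (f u).det) U := by
  simp only [Matrix.det_apply]
  refine ContDiffOn.sum fun σ _ => ?_
  refine ContDiffOn.const_smul _ ?_
  exact contDiffOn_prod fun i _ => hf _ _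

lemma contDiffOn_detMat (hh : LocalMetric U h) : ContDiffOn ℝ ∞ (fun u => (mat (h u)).det) U :=
  contDiffOn_det hh.contDiffOn_mat

lemma contDiffOn_inv (hh : LocalMetric U h) (i j : Fin n) :
    ContDiffOn ℝ ∞ (fun u => (mat (h u))⁻¹ i j) U := by
  -- Cramer's rule: the entry is a quotient of determinants, hence smooth where the metric is
  -- nondegenerate.
  have h1 : ∀ u, (mat (h u))⁻¹ i j
      = ((mat (h u)).det)⁻¹ * ((mat (h u)).updateRow j (Pi.single i 1)).det := by
    intro u
    rw [Matrix.inv_def, Matrix.smul_apply, Matrix.adjugate_apply, Ring.inverse_eq_inv', smul_eq_mul]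
  simp only [h1]
  refine (hh.contDiffOn_detMat.inv fun u hu => (hh.inner u hu).det_pos.ne').mul ?_
  refine contDiffOn_det fun k l => ?_
  by_cases hk : k = j
  · subst hk
    simp only [Matrix.updateRow_self]
    exact contDiffOn_const
  · simp only [Matrix.updateRow_ne hk]
    exact hh.contDiffOn_mat k l

lemma contDiffOn_pd (hh : LocalMetric U h) {f : Euc n → ℝ} (hf : ContDiffOn ℝ ∞ f U) (i : Fin n) :
    ContDiffOn ℝ ∞ (pd i f) U :=
  (hf.fderiv_of_isOpen hh.isOpen (by simp)).clm_apply contDiffOn_const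

lemma contDiffOn_chr (hh : LocalMetric U h) (k i j : Fin n) : ContDiffOn ℝ ∞ (chr h k i j) U := by
  unfold chr
  refine contDiffOn_const.mul (ContDiffOn.sum fun l _ => (hh.contDiffOn_inv k l).mul ?_)
  exact ((hh.contDiffOn_pd (hh.contDiffOn_mat _ _) _).add
    (hh.contDiffOn_pd (hh.contDiffOn_mat _ _) _)).sub (hh.contDiffOn_pd (hh.contDiffOn_mat _ _) _)

lemma contDiffOn_gam (hh : LocalMetric U h) : ContDiffOn ℝ ∞ (gam h) U := by
  unfold gam
  exact ContDiffOn.sum fun k _ => ContDiffOn.sum fun i _ => ContDiffOn.sum fun j _ =>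
    (hh.contDiffOn_chr k i j).smul contDiffOn_const

lemma differentiableAt_gam (hh : LocalMetric U h) (hu : u ∈ U) : DifferentiableAt ℝ (gam h) u :=
  (hh.contDiffOn_gam.contDiffAt (hh.isOpen.mem_nhds hu)).differentiableAt (by simp)

lemma fderiv_symm (hh : LocalMetric U h) (hu : u ∈ U) (X Y Z : Euc n) :
    fderiv ℝ h u X Y Z = fderiv ℝ h u X Z Y := by
  rw [← fderiv_bil_apply_const (hh.differentiableAt hu),
    ← fderiv_bil_apply_const (hh.differentiableAt hu)]
  congr 1
  refine Filter.EventuallyEq.fderiv_eq ?_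
  filter_upwards [hh.isOpen.mem_nhds hu] with w hw
  exact (hh.inner w hw).symm _ _

/-- The Koszul formula. -/
lemma koszul (hh : LocalMetric U h) (hu : u ∈ U) (X Y Z : Euc n) :
    2 * h u (gam h u X Y) Z
      = fderiv ℝ h u X Y Z + fderiv ℝ h u Y X Z - fderiv ℝ h u Z X Y := by
  have hd := hh.differentiableAt hu
  induction X using bas_induction with
  | h0 => simp
  | hadd X X' h1 h2 => simp only [map_add, add_apply] at *; linarith
  | hsmul c X h1 => simp only [map_smul, smul_apply, smul_eq_mul] at *; linear_combination c * h1
  | hb i =>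
  induction Y using bas_induction with
  | h0 => simp
  | hadd X X' h1 h2 => simp only [map_add, add_apply] at *; linarith
  | hsmul c X h1 => simp only [map_smul, smul_apply, smul_eq_mul] at *; linear_combination c * h1
  | hb j =>
  induction Z using bas_induction with
  | h0 => simp
  | hadd X X' h1 h2 => simp only [map_add, add_apply] at *; linarith
  | hsmul c X h1 => simp only [map_smul, smul_apply, smul_eq_mul] at *; linear_combination c * h1
  | hb l =>
  have hpd : ∀ a b c : Fin n, pd a (fun w => mat (h w) b c) u
      = fderiv ℝ h u (bas a) (bas b) (bas c) := fun a b c => fderiv_bil_apply_const hd _ _ _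
  have h3 : (mat (h u))⁻¹ * mat (h u) = 1 := Matrix.nonsing_inv_mul _ (hh.inner u hu).isUnit_det
  rw [gam_bas]
  simp only [map_sum, map_smul, sum_apply, smul_apply, smul_eq_mul, chr,
    ← hpd, ← mat_apply]
  -- `K m` is twice the Christoffel symbol with its upper index lowered to m. Contracting `chr` with
  -- the metric cancels the inverse matrix and recovers it.
  set K : Fin n → ℝ := fun m => pd i (fun w => mat (h w) j m) u + pd j (fun w => mat (h w) i m) u
      - pd m (fun w => mat (h w) i j) u with hK
  change 2 * ∑ k, (1 / 2 * ∑ m, (mat (h u))⁻¹ k m * K m) * mat (h u) k l = K l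
  calc 2 * ∑ k, (1 / 2 * ∑ m, (mat (h u))⁻¹ k m * K m) * mat (h u) k l
      = ∑ m, (∑ k, (mat (h u))⁻¹ m k * mat (h u) k l) * K m := by
        simp only [Finset.mul_sum, Finset.sum_mul]
        rw [Finset.sum_comm]
        refine Finset.sum_congr rfl fun k _ => Finset.sum_congr rfl fun m _ => ?_
        rw [(hh.inner u hu).inv_symm]; ring
    _ = ∑ m, (1 : Matrix (Fin n) (Fin n) ℝ) m l * K m := by
        rw [← h3]; simp [Matrix.mul_apply]
    _ = K l := by simp [Matrix.one_apply]

/-- Nondegeneracy turns the Koszul formula into a characterisation of the connection. The symmetry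
of Γ and the conformal change of Γ are both proved through it. -/
lemma eq_gam (hh : LocalMetric U h) (hu : u ∈ U) {X Y V : Euc n}
    (hV : ∀ Z, 2 * h u V Z = fderiv ℝ h u X Y Z + fderiv ℝ h u Y X Z - fderiv ℝ h u Z X Y) :
    V = gam h u X Y :=
  (hh.inner u hu).eq_of_forall fun Z => by linarith [hV Z, hh.koszul hu X Y Z]

lemma gam_symm (hh : LocalMetric U h) (hu : u ∈ U) (X Y : Euc n) :
    gam h u X Y = gam h u Y X :=
  hh.eq_gam hu fun Z => by rw [hh.koszul hu, hh.fderiv_symm hu Z X Y]; ring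

/-- This is ∇h = 0. Adding the Koszul formulas for (X, Y, Z) and (X, Z, Y) leaves only the
derivative in the direction X. -/
lemma compat (hh : LocalMetric U h) (hu : u ∈ U) (X Y Z : Euc n) :
    fderiv ℝ h u X Y Z = h u (gam h u X Y) Z + h u Y (gam h u X Z) := by
  have h1 := hh.koszul hu X Y Z
  have h2 := hh.koszul hu X Z Y
  have h3 := hh.fderiv_symm hu X Y Z
  have h4 := hh.fderiv_symm hu Y X Z
  have h5 := hh.fderiv_symm hu Z X Y
  rw [(hh.inner u hu).symm Y]
  linarith

lemma fderiv_gam_symm (hh : LocalMetric U h) (hu : u ∈ U) (X Y Z : Euc n) :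
    fderiv ℝ (gam h) u X Y Z = fderiv ℝ (gam h) u X Z Y := by
  rw [← fderiv_bil_apply_const (hh.differentiableAt_gam hu),
    ← fderiv_bil_apply_const (hh.differentiableAt_gam hu)]
  congr 1
  refine Filter.EventuallyEq.fderiv_eq ?_
  filter_upwards [hh.isOpen.mem_nhds hu] with w hw
  exact hh.gam_symm hw _ _

end LocalMetric

/-! ### Curvature of a metric on an open subset of ℝⁿ and its symmetries. -/

/-- The Riemann curvature tensor of a metric on `ℝⁿ`. -/
noncomputable def riem (h : Euc n → Bil n) (u X Y Z : Euc n) : Euc n :=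
  fderiv ℝ (gam h) u X Y Z - fderiv ℝ (gam h) u Y X Z
    + gam h u X (gam h u Y Z) - gam h u Y (gam h u X Z)

/-- The Ricci tensor of a metric on `ℝⁿ`. -/
noncomputable def ric (h : Euc n → Bil n) (u Y Z : Euc n) : ℝ :=
  ∑ i, riem h u (bas i) Y Z i

namespace LocalMetric

variable {U : Set (Euc n)} {h : Euc n → Bil n} {u : Euc n}

/-- Uses only that Γ and its derivative are symmetric in the last two arguments: the terms of the
cyclic sum then cancel in pairs. -/
lemma bianchi (hh : LocalMetric U h) (hu : u ∈ U) (X Y Z : Euc n) :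
    riem h u X Y Z + riem h u Y Z X + riem h u Z X Y = 0 := by
  simp only [riem]
  rw [hh.fderiv_gam_symm hu X Y Z, hh.fderiv_gam_symm hu Y X Z, hh.fderiv_gam_symm hu Z Y X,
    hh.gam_symm hu Y Z, hh.gam_symm hu X Z, hh.gam_symm hu Y X]
  abel

lemma riem_swap (X Y Z : Euc n) : riem h u X Y Z = - riem h u Y X Z := by
  simp only [riem]; abel

/-- Second derivatives of the metric commute. Expanding them by applying `compat` twice and
antisymmetrising in X, Y removes the mixed terms h(Γ_Y Z, Γ_X V) and leaves exactly the two
curvature terms. -/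
lemma riem_skew (hh : LocalMetric U h) (hu : u ∈ U) (X Y Z V : Euc n) :
    h u (riem h u X Y Z) V = - h u (riem h u X Y V) Z := by
  have hd := hh.differentiableAt hu
  have hg := hh.differentiableAt_gam hu
  have hd2 : DifferentiableAt ℝ (fderiv ℝ h) u :=
    ((hh.smooth.fderiv_of_isOpen hh.isOpen (m := ∞) (by simp)).contDiffAt
      (hh.isOpen.mem_nhds hu)).differentiableAt (by simp)
  have hsymm : ∀ X Y, fderiv ℝ (fderiv ℝ h) u X Y = fderiv ℝ (fderiv ℝ h) u Y X := fun X Y =>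
    ((hh.contDiffAt hu).isSymmSndFDerivAt
      (by rw [minSmoothness_of_isRCLikeNormedField]; exact WithTop.coe_le_coe.2 le_top)).eq X Y
  have key : ∀ X Y, fderiv ℝ (fderiv ℝ h) u X Y Z V
      = h u (gam h u X (gam h u Y Z)) V + h u (gam h u Y Z) (gam h u X V)
        + h u (fderiv ℝ (gam h) u X Y Z) V
        + (h u (gam h u X Z) (gam h u Y V) + h u Z (gam h u X (gam h u Y V))
        + h u Z (fderiv ℝ (gam h) u X Y V)) := by
    intro X Y
    rw [← fderiv_clm_apply_const hd2, ← fderiv_bil_apply_const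
      (hd2.clm_apply (differentiableAt_const Y))]
    have e1 : (fun w => fderiv ℝ h w Y Z V) =ᶠ[nhds u]
        fun w => h w (gam h w Y Z) V + h w Z (gam h w Y V) := by
      filter_upwards [hh.isOpen.mem_nhds hu] with w hw
      exact hh.compat hw _ _ _
    have hgc : ∀ A B : Euc n, DifferentiableAt ℝ (fun w => gam h w A B) u := fun A B =>
      (hg.clm_apply (differentiableAt_const A)).clm_apply (differentiableAt_const B)
    rw [e1.fderiv_eq, fderiv_fun_add, add_apply, fderiv_bil_apply hd (hgc _ _)
      (differentiableAt_const _), fderiv_bil_apply hd (differentiableAt_const _) (hgc _ _)]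
    · simp only [fderiv_bil_apply_const hg, fderiv_fun_const, Pi.zero_apply, zero_apply, map_zero,
        hh.compat hu]
      ring
    · exact (hd.clm_apply (hgc _ _)).clm_apply (differentiableAt_const _)
    · exact (hd.clm_apply (differentiableAt_const _)).clm_apply (hgc _ _)
  have k1 := key X Y
  have k2 := key Y X
  rw [hsymm] at k1
  simp only [riem, map_add, map_sub, add_apply, sub_apply]
  have s := (hh.inner u hu).symm
  rw [s Z, s Z] at k1 k2
  linarith

/-- The octahedron argument: four cyclic sums from `bianchi`, combined with skewness in the first
pair and in the last pair. -/
lemma riem_pair (hh : LocalMetric U h) (hu : u ∈ U) (X Y Z V : Euc n) :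
    h u (riem h u X Y Z) V = h u (riem h u Z V X) Y := by
  have b : ∀ X Y Z V, h u (riem h u X Y Z) V + h u (riem h u Y Z X) V
      + h u (riem h u Z X Y) V = 0 := by
    intro X Y Z V
    rw [← add_apply, ← add_apply, ← map_add, ← map_add, hh.bianchi hu]; simp
  have s : ∀ X Y Z V, h u (riem h u X Y Z) V = - h u (riem h u Y X Z) V := by
    intro X Y Z V
    rw [riem_swap]; simp
  have k := hh.riem_skew hu
  linarith [b X Y Z V, b Y Z V X, b Z V X Y, b V X Y Z, s X Y Z V, s Y Z X V, s Z X Y V,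
    s Y Z V X, s Z V Y X, s V Y Z X, s Z V X Y, s V X Z Y, s X Z V Y, s V X Y Z, s X Y V Z,
    s Y V X Z, k X Y Z V, k Y Z X V, k Z X Y V, k Y Z V X, k Z V Y X, k V Y Z X, k Z V X Y,
    k V X Z Y, k X Z V Y, k V X Y Z, k X Y V Z, k Y V X Z, s X Z Y V, s Y V Z X, k X Z Y V]

/-- Pair symmetry rewrites the integrand as h(R(Y, V)Z, X), whose metric trace is the endomorphism
trace that defines `ric`. This form of Ricci is the one produced by the commutation in
`euler_metric_part`. -/
lemma trc_riem (hh : LocalMetric U h) (hu : u ∈ U) (Z V : Euc n) :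
    trc (h u) (fun X Y => h u (riem h u Z X Y) V) = ric h u V Z := by
  have hA := hh.inner u hu
  have h1 : ∀ j, ∑ i, (mat (h u))⁻¹ i j * h u (bas i) (riem h u (bas j) V Z)
      = riem h u (bas j) V Z j := by
    intro j
    have := hA.trc_pair (riem h u (bas j) V Z)
      ((EuclideanSpace.proj j : Euc n →L[ℝ] ℝ) : Euc n →ₗ[ℝ] ℝ)
    simpa [trc, bas_apply] using this
  rw [ric, trc, Finset.sum_comm]
  refine Finset.sum_congr rfl fun j _ => ?_
  rw [← h1]
  refine Finset.sum_congr rfl fun i _ => ?_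
  rw [hh.riem_pair hu, smul_eq_mul, hA.symm]

end LocalMetric

end LocalMetric

end ConformalBiharmonic

namespace ConformalBiharmonic

/-! ### Derivatives of traces and of the volume density -/

section TraceDeriv

set_option synthInstance.maxHeartbeats 200000

open scoped Shortcuts

variable {n : ℕ}

lemma hasDerivAt_det_one_add {m : ℕ} (M : Matrix (Fin m) (Fin m) ℝ) :
    HasDerivAt (fun t : ℝ => (1 + t • M).det) M.trace 0 := by
  have h := (Matrix.det (1 + (Polynomial.X : Polynomial ℝ) • M.map Polynomial.C)).hasDerivAt 0
  rw [Matrix.derivative_det_one_add_X_smul] at h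
  refine h.congr_of_eventuallyEq (Filter.Eventually.of_forall fun t => ?_)
  change _ = Polynomial.eval t _
  rw [← Polynomial.coe_evalRingHom, RingHom.map_det]
  refine congrArg Matrix.det ?_
  ext i j
  simp [Matrix.one_apply, apply_ite]
  ring

/-- Jacobi's formula. Factoring out M reduces it to the derivative of det(1 + tN) at 0. -/
lemma hasDerivAt_det_add {m : ℕ} {M : Matrix (Fin m) (Fin m) ℝ} (hM : IsUnit M.det)
    (K : Matrix (Fin m) (Fin m) ℝ) :
    HasDerivAt (fun t : ℝ => (M + t • K).det) (M.det * (M⁻¹ * K).trace) 0 := by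
  have h := (hasDerivAt_det_one_add (M⁻¹ * K)).const_mul M.det
  refine h.congr_of_eventuallyEq (Filter.Eventually.of_forall fun t => ?_)
  change _ = M.det * _
  rw [← Matrix.det_mul, Matrix.mul_add, Matrix.mul_one, Matrix.mul_smul,
    Matrix.mul_nonsing_inv_cancel_left _ _ hM]

variable {W : Type*} [NormedAddCommGroup W] [NormedSpace ℝ W]

/-- The contracted Christoffel symbol `Γᵏ_{Z k}`. -/
noncomputable def gamTrace (h : Euc n → Bil n) (u Z : Euc n) : ℝ := ∑ k, gam h u Z (bas k) k

lemma IsInner.trc_apply_map {A : Bil n} (hA : IsInner A) (T : Euc n →L[ℝ] Euc n) :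
    trc A (fun X Y => A (T X) Y) = ∑ k, T (bas k) k := by
  rw [trc]
  refine Finset.sum_congr rfl fun i _ => ?_
  have h1 := hA.trc_pair (T (bas i)) ((EuclideanSpace.proj i : Euc n →L[ℝ] ℝ) : Euc n →ₗ[ℝ] ℝ)
  have h2 : ∑ j, (mat A)⁻¹ j i * A (bas j) (T (bas i)) = T (bas i) i := by
    simpa [trc, bas_apply] using h1
  rw [← h2]
  refine Finset.sum_congr rfl fun j _ => ?_
  rw [hA.inv_symm, hA.symm, smul_eq_mul]

lemma sum_comm_pairs (f : Fin n → Fin n → Fin n → Fin n → W) :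
    ∑ i, ∑ j, ∑ k, ∑ l, f i j k l = ∑ l, ∑ j, ∑ i, ∑ k, f i j k l := by
  calc _ = ∑ i, ∑ j, ∑ l, ∑ k, f i j k l :=
        Finset.sum_congr rfl fun i _ => Finset.sum_congr rfl fun j _ => Finset.sum_comm
    _ = ∑ i, ∑ l, ∑ j, ∑ k, f i j k l := Finset.sum_congr rfl fun i _ => Finset.sum_comm
    _ = ∑ l, ∑ i, ∑ j, ∑ k, f i j k l := Finset.sum_comm
    _ = _ := Finset.sum_congr rfl fun l _ => Finset.sum_comm

namespace LocalMetric

variable {U : Set (Euc n)} {h : Euc n → Bil n} {u : Euc n}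

lemma fderiv_mat (hh : LocalMetric U h) (hu : u ∈ U) (i j : Fin n) (Z : Euc n) :
    fderiv ℝ (fun w => mat (h w) i j) u Z
      = h u (gam h u Z (bas i)) (bas j) + h u (bas i) (gam h u Z (bas j)) := by
  rw [← hh.compat hu]
  exact fderiv_bil_apply_const (hh.differentiableAt hu) _ _ _

lemma differentiableAt_inv (hh : LocalMetric U h) (hu : u ∈ U) (i j : Fin n) :
    DifferentiableAt ℝ (fun w => (mat (h w))⁻¹ i j) u :=
  ((hh.contDiffOn_inv i j).contDiffAt (hh.isOpen.mem_nhds hu)).differentiableAt (by simp)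

lemma differentiableAt_mat (hh : LocalMetric U h) (hu : u ∈ U) (i j : Fin n) :
    DifferentiableAt ℝ (fun w => mat (h w) i j) u :=
  ((hh.contDiffOn_mat i j).contDiffAt (hh.isOpen.mem_nhds hu)).differentiableAt (by simp)

lemma fderiv_inv (hh : LocalMetric U h) (hu : u ∈ U) (i j : Fin n) (Z : Euc n) :
    fderiv ℝ (fun w => (mat (h w))⁻¹ i j) u Z
      = - ∑ k, ∑ l, (mat (h u))⁻¹ i k * fderiv ℝ (fun w => mat (h w) k l) u Z
          * (mat (h u))⁻¹ l j := by
  set N : Matrix (Fin n) (Fin n) ℝ := (mat (h u))⁻¹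
  set dN : Matrix (Fin n) (Fin n) ℝ :=
    Matrix.of fun i j => fderiv ℝ (fun w => (mat (h w))⁻¹ i j) u Z with hdN
  set dM : Matrix (Fin n) (Fin n) ℝ :=
    Matrix.of fun i j => fderiv ℝ (fun w => mat (h w) i j) u Z with hdM
  -- Differentiate A⁻¹A = 1 entry by entry.
  have h1 : dN * mat (h u) + N * dM = 0 := by
    ext a b
    have e : (fun w => ∑ k, (mat (h w))⁻¹ a k * mat (h w) k b) =ᶠ[nhds u]
        fun _ => (1 : Matrix (Fin n) (Fin n) ℝ) a b := by
      filter_upwards [hh.isOpen.mem_nhds hu] with w hw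
      rw [← Matrix.mul_apply, Matrix.nonsing_inv_mul _ (hh.inner w hw).isUnit_det]
    have e2 := congrArg (fun L : Euc n →L[ℝ] ℝ => L Z) e.fderiv_eq
    simp only [fderiv_fun_const, Pi.zero_apply, zero_apply] at e2
    rw [fderiv_fun_sum (fun k _ => (hh.differentiableAt_inv hu a k).fun_mul
      (hh.differentiableAt_mat hu k b))] at e2
    simp only [sum_apply] at e2
    rw [Matrix.add_apply, Matrix.mul_apply, Matrix.mul_apply, ← Finset.sum_add_distrib,
      Matrix.zero_apply, ← e2]
    refine Finset.sum_congr rfl fun k _ => ?_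
    rw [fderiv_fun_mul (hh.differentiableAt_inv hu a k) (hh.differentiableAt_mat hu k b)]
    simp only [add_apply, smul_apply, smul_eq_mul, hdN, hdM, Matrix.of_apply]
    simp only [N]
    ring
  have h2 : dN = - (N * dM * N) := by
    have h3 : mat (h u) * N = 1 := Matrix.mul_nonsing_inv _ (hh.inner u hu).isUnit_det
    calc dN = dN * mat (h u) * N := by rw [Matrix.mul_assoc, h3, Matrix.mul_one]
      _ = - (N * dM * N) := by rw [eq_neg_of_add_eq_zero_left h1, Matrix.neg_mul]
  have h4 := congrFun (congrFun h2 i) j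
  rw [hdN, Matrix.of_apply] at h4
  rw [h4, Matrix.neg_apply, Matrix.mul_apply, Finset.sum_comm]
  congr 1
  refine Finset.sum_congr rfl fun l _ => ?_
  rw [Matrix.mul_apply, Finset.sum_mul]
  rfl

/-- The trace commutes with the covariant derivative. -/
lemma fderiv_trc (hh : LocalMetric U h) (hu : u ∈ U) {B : Euc n → Euc n →L[ℝ] Euc n →L[ℝ] W}
    (hB : DifferentiableAt ℝ B u) (Z : Euc n) :
    fderiv ℝ (fun w => trc (h w) fun X Y => B w X Y) u Z
      = trc (h u) fun X Y => fderiv ℝ B u Z X Y - B u (gam h u Z X) Y - B u X (gam h u Z Y) := by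
  have hA := hh.inner u hu
  have hBd : ∀ i j, DifferentiableAt ℝ (fun w => B w (bas i) (bas j)) u := fun i j =>
    (hB.clm_apply (differentiableAt_const _)).clm_apply (differentiableAt_const _)
  have h1 : fderiv ℝ (fun w => trc (h w) fun X Y => B w X Y) u Z
      = (∑ i, ∑ j, (fderiv ℝ (fun w => (mat (h w))⁻¹ i j) u Z) • B u (bas i) (bas j))
        + trc (h u) fun X Y => fderiv ℝ B u Z X Y := by
    simp only [trc]
    rw [fderiv_fun_sum fun i _ => DifferentiableAt.fun_sum fun j _ =>
      (hh.differentiableAt_inv hu i j).fun_smul (hBd i j), sum_apply, ← Finset.sum_add_distrib]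
    refine Finset.sum_congr rfl fun i _ => ?_
    rw [fderiv_fun_sum fun j _ => (hh.differentiableAt_inv hu i j).fun_smul (hBd i j), sum_apply,
      ← Finset.sum_add_distrib]
    refine Finset.sum_congr rfl fun j _ => ?_
    rw [fderiv_fun_smul (hh.differentiableAt_inv hu i j) (hBd i j)]
    simp only [add_apply, smul_apply, ContinuousLinearMap.smulRight_apply,
      fderiv_bil_apply_const hB]
    abel
  -- The derivative of the inverse is −A⁻¹(dA)A⁻¹, and metric compatibility writes dA as two Γ
  -- terms. In each of them one of the inverse matrices is absorbed by `trc_pair`, which moves Γ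
  -- onto an argument of B.
  have h2 : ∑ i, ∑ j, (fderiv ℝ (fun w => (mat (h w))⁻¹ i j) u Z) • B u (bas i) (bas j)
      = - (trc (h u) (fun X Y => B u (gam h u Z X) Y) + trc (h u) fun X Y => B u X (gam h u Z Y)) := by
    have p1 : ∀ i k, ∑ l, ∑ j, (mat (h u))⁻¹ l j • (h u (bas l) (gam h u Z (bas k)) •
        B u (bas i) (bas j)) = B u (bas i) (gam h u Z (bas k)) := fun i k =>
      hA.trc_pair _ ((B u (bas i) : Euc n →L[ℝ] W) : Euc n →ₗ[ℝ] W)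
    have p2 : ∀ l j, ∑ i, ∑ k, (mat (h u))⁻¹ i k • (h u (bas k) (gam h u Z (bas l)) •
        B u (bas i) (bas j)) = B u (gam h u Z (bas l)) (bas j) := fun l j =>
      hA.trc_pair' _ (((B u).flip (bas j) : Euc n →L[ℝ] W) : Euc n →ₗ[ℝ] W)
    rw [add_comm (trc _ _)]
    simp only [trc, ← p1, ← p2, hh.fderiv_inv hu, hh.fderiv_mat hu, neg_smul, Finset.sum_neg_distrib,
      Finset.sum_smul, Finset.smul_sum, mul_add, add_mul, add_smul, Finset.sum_add_distrib, smul_smul]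
    congr 2
    · refine Finset.sum_congr rfl fun i _ => ?_
      rw [Finset.sum_comm]
      refine Finset.sum_congr rfl fun k _ => ?_
      rw [Finset.sum_comm]
      refine Finset.sum_congr rfl fun l _ => Finset.sum_congr rfl fun j _ => ?_
      congr 1
      rw [hA.symm]; ring
    · rw [sum_comm_pairs]
      refine Finset.sum_congr rfl fun l _ => Finset.sum_congr rfl fun j _ =>
        Finset.sum_congr rfl fun i _ => Finset.sum_congr rfl fun k _ => ?_
      congr 1
      ring
  rw [h1, h2, trc_sub, trc_sub]
  abel

lemma fderiv_pi_apply2 {m : ℕ} {M : Euc n → Fin m → Fin m → ℝ}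
    (hM : DifferentiableAt ℝ M u) (i j : Fin m) (Z : Euc n) :
    fderiv ℝ (fun w => M w i j) u Z = fderiv ℝ M u Z i j := by
  have h1 := hasFDerivAt_pi'.1 (hasFDerivAt_pi'.1 hM.hasFDerivAt i) j
  rw [h1.fderiv]
  rfl

/-- Jacobi's formula combined with compatibility. Both Γ terms of the derivative of the metric have
trace `gamTrace`; the resulting factor 2 is removed by the square root in `dens`. -/
lemma fderiv_detMat (hh : LocalMetric U h) (hu : u ∈ U) (Z : Euc n) :
    fderiv ℝ (fun w => (mat (h w)).det) u Z = 2 * (mat (h u)).det * gamTrace h u Z := by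
  have hA := hh.inner u hu
  let D : (Fin n → Fin n → ℝ) → ℝ := fun f => (Matrix.of f).det
  have hD : Differentiable ℝ D := by
    have : ContDiff ℝ 1 D := by
      simp only [D, Matrix.det_apply]
      exact ContDiff.sum fun σ _ => ContDiff.const_smul _ (contDiff_prod fun i _ =>
        contDiff_apply_apply ℝ ℝ _ _)
    exact this.differentiable (by simp)
  let M : Euc n → Fin n → Fin n → ℝ := fun w i j => mat (h w) i j
  have hM : DifferentiableAt ℝ M u :=
    differentiableAt_pi.2 fun i => differentiableAt_pi.2 fun j => hh.differentiableAt_mat hu i j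
  have hM' : ∀ i j, fderiv ℝ M u Z i j = fderiv ℝ (fun w => mat (h w) i j) u Z := by
    intro i j
    rw [show (fun w => mat (h w) i j) = fun w => M w i j from rfl, fderiv_pi_apply2 hM]
  have h1 : fderiv ℝ (fun w => (mat (h w)).det) u Z = fderiv ℝ D (M u) (fderiv ℝ M u Z) := by
    have : (fun w => (mat (h w)).det) = D ∘ M := rfl
    rw [this, fderiv_comp u (hD _) hM]
    rfl
  have h2 : fderiv ℝ D (M u) (fderiv ℝ M u Z)
      = (mat (h u)).det * ((mat (h u))⁻¹ * Matrix.of (fderiv ℝ M u Z)).trace := by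
    have e1 : HasDerivAt (fun t : ℝ => D (M u + t • fderiv ℝ M u Z))
        (fderiv ℝ D (M u) (fderiv ℝ M u Z)) 0 :=
      (hD (M u)).hasFDerivAt.hasLineDerivAt (fderiv ℝ M u Z)
    exact e1.unique (hasDerivAt_det_add hA.isUnit_det (Matrix.of (fderiv ℝ M u Z)))
  have h3 : ((mat (h u))⁻¹ * Matrix.of (fderiv ℝ M u Z)).trace
      = trc (h u) (fun X Y => h u (gam h u Z X) Y) + trc (h u) (fun X Y => h u (gam h u Z Y) X) := by
    rw [← trc_add, Matrix.trace, trc]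
    refine Finset.sum_congr rfl fun i _ => ?_
    rw [Matrix.diag_apply, Matrix.mul_apply]
    refine Finset.sum_congr rfl fun j _ => ?_
    rw [Matrix.of_apply, hM', hh.fderiv_mat hu, smul_eq_mul, hA.symm (bas j), add_comm]
  rw [h1, h2, h3, hA.trc_swap fun X Y => h u (gam h u Z X) Y, hA.trc_apply_map, gamTrace]
  ring

/-- The Riemannian volume density. -/
noncomputable def _root_.ConformalBiharmonic.dens (h : Euc n → Bil n) (u : Euc n) : ℝ :=
  Real.sqrt (mat (h u)).det

lemma dens_pos (hh : LocalMetric U h) (hu : u ∈ U) : 0 < dens h u :=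
  Real.sqrt_pos.2 (hh.inner u hu).det_pos

lemma contDiffOn_dens (hh : LocalMetric U h) : ContDiffOn ℝ ∞ (dens h) U :=
  hh.contDiffOn_detMat.sqrt fun u hu => (hh.inner u hu).det_pos.ne'

lemma differentiableAt_dens (hh : LocalMetric U h) (hu : u ∈ U) : DifferentiableAt ℝ (dens h) u :=
  (hh.contDiffOn_dens.contDiffAt (hh.isOpen.mem_nhds hu)).differentiableAt (by simp)

lemma fderiv_dens (hh : LocalMetric U h) (hu : u ∈ U) (Z : Euc n) :
    fderiv ℝ (dens h) u Z = dens h u * gamTrace h u Z := by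
  have hd : DifferentiableAt ℝ (fun w => (mat (h w)).det) u :=
    (hh.contDiffOn_detMat.contDiffAt (hh.isOpen.mem_nhds hu)).differentiableAt (by simp)
  have hp := (hh.inner u hu).det_pos
  unfold dens
  rw [(hd.hasFDerivAt.sqrt hp.ne').fderiv, smul_apply, hh.fderiv_detMat hu, smul_eq_mul]
  have h1 := Real.mul_self_sqrt hp.le
  have h2 := Real.sqrt_pos.2 hp
  field_simp
  rw [sq, h1]

end LocalMetric

end TraceDeriv

end ConformalBiharmonic

namespace ConformalBiharmonic

/-! ### The divergence of 1-forms -/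

section Divergence

set_option synthInstance.maxHeartbeats 200000

open scoped Shortcuts

variable {n : ℕ} {W : Type*} [NormedAddCommGroup W] [NormedSpace ℝ W]

/-- Local data carry information only on U. A field vanishing off a closed K ⊆ U is nevertheless
smooth everywhere, which permits integration over all of ℝⁿ. -/
lemma contDiff_of_eq_zero_off {U K : Set (Euc n)} (hU : IsOpen U) (hK : IsClosed K) (hKU : K ⊆ U)
    {f : Euc n → W} (hf : ContDiffOn ℝ ∞ f U) (h0 : ∀ u ∉ K, f u = 0) : ContDiff ℝ ∞ f := by
  rw [contDiff_iff_contDiffAt]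
  intro u
  by_cases hu : u ∈ U
  · exact hf.contDiffAt (hU.mem_nhds hu)
  · have : f =ᶠ[nhds u] fun _ => 0 := by
      filter_upwards [hK.isOpen_compl.mem_nhds fun h => hu (hKU h)] with w hw
      exact h0 w hw
    exact contDiffAt_const.congr_of_eventuallyEq this

lemma fderiv_eq_zero_off {K : Set (Euc n)} (hK : IsClosed K) {f : Euc n → W}
    (h0 : ∀ u ∉ K, f u = 0) {u : Euc n} (hu : u ∉ K) : fderiv ℝ f u = 0 := by
  have : f =ᶠ[nhds u] fun _ => 0 := by
    filter_upwards [hK.isOpen_compl.mem_nhds hu] with w hw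
    exact h0 w hw
  rw [this.fderiv_eq]
  simp

lemma hasCompactSupport_of_eq_zero_off {K : Set (Euc n)} (hK : IsCompact K) {f : Euc n → W}
    (h0 : ∀ u ∉ K, f u = 0) : HasCompactSupport f :=
  HasCompactSupport.intro hK fun u hu => h0 u hu

lemma integral_fderiv_eq_zero {K : Set (Euc n)} (hK : IsCompact K) {f : Euc n → ℝ}
    (hf : ContDiff ℝ ∞ f) (h0 : ∀ u ∉ K, f u = 0) (v : Euc n) : ∫ u, fderiv ℝ f u v = 0 := by
  have hd : Continuous fun u => fderiv ℝ f u v :=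
    (hf.continuous_fderiv (by simp)).clm_apply continuous_const
  -- Integration by parts against the constant function 1. Only its products with f and with the
  -- derivative of f need to be integrable.
  have h1 := integral_mul_fderiv_eq_neg_fderiv_mul_of_integrable
    (μ := MeasureTheory.volume) (f := fun _ : Euc n => (1 : ℝ)) (g := f) (v := v)
    (by simp) (by
      simp only [one_mul]
      exact hd.integrable_of_hasCompactSupport (hasCompactSupport_of_eq_zero_off hK fun u hu => by
        rw [fderiv_eq_zero_off hK.isClosed h0 hu]; rfl))
    (by
      simp only [one_mul]
      exact hf.continuous.integrable_of_hasCompactSupport (hasCompactSupport_of_eq_zero_off hK h0))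
    (fun x _ => differentiableAt_const _) (fun x _ => hf.differentiable (by simp) x)
  simpa using h1

/-- The divergence of a 1-form. -/
noncomputable def dvg (h : Euc n → Bil n) (θ : Euc n → Euc n →L[ℝ] ℝ) (u : Euc n) : ℝ :=
  trc (h u) fun X Y => fderiv ℝ θ u X Y - θ u (gam h u X Y)

lemma gamTrace_eq_sum (h : Euc n → Bil n) (u V : Euc n) :
    gamTrace h u V = ∑ i, V i * gamTrace h u (bas i) := by
  simp only [gamTrace, Finset.mul_sum]
  rw [Finset.sum_comm]
  refine Finset.sum_congr rfl fun k _ => ?_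
  have := map_eq_sum_bas (((EuclideanSpace.proj k : Euc n →L[ℝ] ℝ).comp
    ((gam h u).flip (bas k)) : Euc n →L[ℝ] ℝ) : Euc n →ₗ[ℝ] ℝ) V
  simpa using this

lemma dvg_smul (h : Euc n → Bil n) {u : Euc n} {f : Euc n → ℝ} {θ : Euc n → Euc n →L[ℝ] ℝ}
    (hf : DifferentiableAt ℝ f u) (hθ : DifferentiableAt ℝ θ u) :
    dvg h (fun w => f w • θ w) u
      = trc (h u) (fun X Y => fderiv ℝ f u X * θ u Y) + f u * dvg h θ u := by
  rw [dvg, dvg, ← trc_mul, ← trc_add]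
  congr 1
  funext X Y
  rw [fderiv_fun_smul hf hθ]
  simp
  ring

lemma dvg_add (h : Euc n → Bil n) {u : Euc n} {θ₁ θ₂ : Euc n → Euc n →L[ℝ] ℝ}
    (h₁ : DifferentiableAt ℝ θ₁ u) (h₂ : DifferentiableAt ℝ θ₂ u) :
    dvg h (fun w => θ₁ w + θ₂ w) u = dvg h θ₁ u + dvg h θ₂ u := by
  rw [dvg, dvg, dvg, ← trc_add]
  congr 1
  funext X Y
  rw [fderiv_fun_add h₁ h₂]
  simp
  ring

lemma dvg_sub (h : Euc n → Bil n) {u : Euc n} {θ₁ θ₂ : Euc n → Euc n →L[ℝ] ℝ}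
    (h₁ : DifferentiableAt ℝ θ₁ u) (h₂ : DifferentiableAt ℝ θ₂ u) :
    dvg h (fun w => θ₁ w - θ₂ w) u = dvg h θ₁ u - dvg h θ₂ u := by
  rw [dvg, dvg, dvg, ← trc_sub]
  congr 1
  funext X Y
  rw [fderiv_fun_sub h₁ h₂]
  simp
  ring

lemma dvg_congr (h : Euc n → Bil n) {u : Euc n} {θ₁ θ₂ : Euc n → Euc n →L[ℝ] ℝ}
    (he : θ₁ =ᶠ[nhds u] θ₂) : dvg h θ₁ u = dvg h θ₂ u := by
  rw [dvg, dvg, he.fderiv_eq, he.self_of_nhds]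

namespace LocalMetric

variable {U : Set (Euc n)} {h : Euc n → Bil n} {u : Euc n}

lemma contDiffOn_trc (hh : LocalMetric U h) {B : Euc n → Euc n →L[ℝ] Euc n →L[ℝ] W}
    (hB : ContDiffOn ℝ ∞ B U) : ContDiffOn ℝ ∞ (fun w => trc (h w) fun X Y => B w X Y) U := by
  unfold trc
  exact ContDiffOn.sum fun i _ => ContDiffOn.sum fun j _ => (hh.contDiffOn_inv i j).smul
    ((hB.clm_apply contDiffOn_const).clm_apply contDiffOn_const)

lemma contDiffOn_fderiv (hh : LocalMetric U h) {f : Euc n → W} (hf : ContDiffOn ℝ ∞ f U) :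
    ContDiffOn ℝ ∞ (fderiv ℝ f) U :=
  hf.fderiv_of_isOpen hh.isOpen (by simp)

lemma contDiffOn_differentiableAt (hh : LocalMetric U h) {f : Euc n → W} (hf : ContDiffOn ℝ ∞ f U)
    (hu : u ∈ U) : DifferentiableAt ℝ f u :=
  (hf.contDiffAt (hh.isOpen.mem_nhds hu)).differentiableAt (by simp)

lemma contDiffOn_dvg (hh : LocalMetric U h) {θ : Euc n → Euc n →L[ℝ] ℝ}
    (hθ : ContDiffOn ℝ ∞ θ U) : ContDiffOn ℝ ∞ (dvg h θ) U := by
  unfold dvg trc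
  refine ContDiffOn.sum fun i _ => ContDiffOn.sum fun j _ => (hh.contDiffOn_inv i j).smul ?_
  exact (((hh.contDiffOn_fderiv hθ).clm_apply contDiffOn_const).clm_apply contDiffOn_const).sub
    (hθ.clm_apply ((hh.contDiffOn_gam.clm_apply contDiffOn_const).clm_apply contDiffOn_const))

lemma contDiffOn_dualVec (hh : LocalMetric U h) {θ : Euc n → Euc n →L[ℝ] ℝ}
    (hθ : ContDiffOn ℝ ∞ θ U) : ContDiffOn ℝ ∞ (fun w => dualVec (h w) (θ w)) U := by
  unfold dualVec trc
  exact ContDiffOn.sum fun i _ => ContDiffOn.sum fun j _ => (hh.contDiffOn_inv i j).smul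
    ((hθ.clm_apply contDiffOn_const).smul contDiffOn_const)

lemma fderiv_dualVec (hh : LocalMetric U h) (hu : u ∈ U) {θ : Euc n → Euc n →L[ℝ] ℝ}
    (hθ : DifferentiableAt ℝ θ u) (Z : Euc n) :
    fderiv ℝ (fun w => dualVec (h w) (θ w)) u Z
      = trc (h u) fun X Y => fderiv ℝ θ u Z Y • X - θ u Y • gam h u Z X - θ u (gam h u Z Y) • X := by
  -- The bilinear map (X, Y) ↦ θ(Y)X has trace θ♯, so `fderiv_trc` differentiates the dual vector.
  let B : Euc n → Euc n →L[ℝ] Euc n →L[ℝ] Euc n := fun w =>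
    (ContinuousLinearMap.smulRightL ℝ (Euc n) (Euc n) (θ w))
  have hB : DifferentiableAt ℝ B u :=
    (ContinuousLinearMap.smulRightL ℝ (Euc n) (Euc n)).differentiableAt.comp u hθ
  have hB' : ∀ Z X Y, fderiv ℝ B u Z X Y = fderiv ℝ θ u Z Y • X := by
    intro Z X Y
    have : fderiv ℝ B u = (ContinuousLinearMap.smulRightL ℝ (Euc n) (Euc n)).comp
        (fderiv ℝ θ u) := by
      have := ((ContinuousLinearMap.smulRightL ℝ (Euc n) (Euc n)).hasFDerivAt.comp u
        hθ.hasFDerivAt)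
      exact this.fderiv
    rw [this]; rfl
  have h1 := hh.fderiv_trc hu hB Z
  simp only [hB'] at h1
  exact h1

/-- The classical formula div θ = (det h)^{-1/2} ∂ᵢ((det h)^{1/2} θⁱ). The contracted Christoffel
term from the derivative of the density cancels the one from the derivative of θ♯. The divergence
theorem is thereby reduced to coordinate derivatives. -/
lemma sum_fderiv_dens_smul_dualVec (hh : LocalMetric U h) (hu : u ∈ U)
    {θ : Euc n → Euc n →L[ℝ] ℝ} (hθ : ContDiffOn ℝ ∞ θ U) :
    ∑ i, fderiv ℝ (fun w => dens h w * dualVec (h w) (θ w) i) u (bas i)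
      = dens h u * dvg h θ u := by
  have hθd := hh.contDiffOn_differentiableAt hθ hu
  have hVd := hh.contDiffOn_differentiableAt (hh.contDiffOn_dualVec hθ) hu
  have hVi : ∀ i, HasFDerivAt (fun w => dualVec (h w) (θ w) i)
      ((EuclideanSpace.proj i : Euc n →L[ℝ] ℝ).comp
        (fderiv ℝ (fun w => dualVec (h w) (θ w)) u)) u := fun i =>
    (EuclideanSpace.proj i : Euc n →L[ℝ] ℝ).hasFDerivAt.comp u hVd.hasFDerivAt
  have h1 : ∀ i, fderiv ℝ (fun w => dens h w * dualVec (h w) (θ w) i) u (bas i)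
      = dens h u * (gamTrace h u (bas i) * dualVec (h u) (θ u) i)
        + dens h u * fderiv ℝ (fun w => dualVec (h w) (θ w)) u (bas i) i := by
    intro i
    rw [fderiv_fun_mul (hh.differentiableAt_dens hu) (hVi i).differentiableAt, (hVi i).fderiv]
    simp only [add_apply, smul_apply, smul_eq_mul, hh.fderiv_dens hu,
      ContinuousLinearMap.comp_apply, EuclideanSpace.coe_proj]
    ring
  have h2 : gamTrace h u (dualVec (h u) (θ u))
      = trc (h u) fun X Y => θ u Y * gamTrace h u X := by
    have : ∀ i, dualVec (h u) (θ u) i = trc (h u) fun X Y => θ u Y * X i := fun i =>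
      (trc_map (h u) ((EuclideanSpace.proj i : Euc n →L[ℝ] ℝ) : Euc n →ₗ[ℝ] ℝ) _).symm
    rw [gamTrace_eq_sum]
    simp only [this, trc, smul_eq_mul, Finset.sum_mul]
    rw [Finset.sum_comm]
    refine Finset.sum_congr rfl fun a _ => ?_
    rw [Finset.sum_comm]
    refine Finset.sum_congr rfl fun b _ => ?_
    rw [gamTrace_eq_sum, Finset.mul_sum, Finset.mul_sum]
    refine Finset.sum_congr rfl fun i _ => ?_
    ring
  have h3 : ∑ i, fderiv ℝ (fun w => dualVec (h w) (θ w)) u (bas i) i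
      = trc (h u) fun X Y => fderiv ℝ θ u X Y - θ u Y * gamTrace h u X - θ u (gam h u X Y) := by
    have e1 : ∀ i, fderiv ℝ (fun w => dualVec (h w) (θ w)) u (bas i) i
        = trc (h u) fun X Y => fderiv ℝ θ u (bas i) Y * X i - θ u Y * gam h u (bas i) X i
          - θ u (gam h u (bas i) Y) * X i := by
      intro i
      rw [hh.fderiv_dualVec hu hθd]
      exact (trc_map (h u) ((EuclideanSpace.proj i : Euc n →L[ℝ] ℝ) : Euc n →ₗ[ℝ] ℝ) _).symm
    simp only [e1, trc, smul_eq_mul]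
    rw [Finset.sum_comm]
    refine Finset.sum_congr rfl fun a _ => ?_
    rw [Finset.sum_comm]
    refine Finset.sum_congr rfl fun b _ => ?_
    rw [← Finset.mul_sum]
    congr 1
    rw [Finset.sum_sub_distrib, Finset.sum_sub_distrib, ← Finset.mul_sum, gamTrace]
    congr 1
    · congr 1
      · simp [bas_apply]
      · refine congrArg _ (Finset.sum_congr rfl fun i _ => ?_)
        rw [hh.gam_symm hu]
    · simp [bas_apply]
  simp only [h1]
  rw [Finset.sum_add_distrib, ← Finset.mul_sum, ← Finset.mul_sum, h3, ← mul_add, dvg]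
  congr 1
  have h4 : ∑ i, gamTrace h u (bas i) * dualVec (h u) (θ u) i
      = gamTrace h u (dualVec (h u) (θ u)) := by
    rw [gamTrace_eq_sum h u (dualVec (h u) (θ u))]
    exact Finset.sum_congr rfl fun i _ => mul_comm _ _
  rw [h4, h2, ← trc_add]
  congr 1
  funext X Y
  ring

/-- The divergence theorem. -/
lemma integral_dvg (hh : LocalMetric U h) {θ : Euc n → Euc n →L[ℝ] ℝ} (hθ : ContDiffOn ℝ ∞ θ U)
    {K : Set (Euc n)} (hK : IsCompact K) (hKU : K ⊆ U) (h0 : ∀ u ∉ K, θ u = 0) :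
    ∫ u, dens h u * dvg h θ u = 0 := by
  have hz : ∀ u ∉ K, dualVec (h u) (θ u) = 0 := by
    intro u hu
    simp [dualVec, trc, h0 u hu]
  have hc : ∀ i, ContDiff ℝ ∞ fun w => dens h w * dualVec (h w) (θ w) i := by
    intro i
    refine contDiff_of_eq_zero_off hh.isOpen hK.isClosed hKU ?_ fun u hu => by simp [hz u hu]
    exact hh.contDiffOn_dens.mul ((EuclideanSpace.proj i : Euc n →L[ℝ] ℝ).contDiff.comp_contDiffOn
      (hh.contDiffOn_dualVec hθ))
  have hzi : ∀ i, ∀ u ∉ K, dens h u * dualVec (h u) (θ u) i = 0 := fun i u hu => by simp [hz u hu]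
  have h1 : ∀ u, dens h u * dvg h θ u
      = ∑ i, fderiv ℝ (fun w => dens h w * dualVec (h w) (θ w) i) u (bas i) := by
    intro u
    by_cases hu : u ∈ U
    · exact (hh.sum_fderiv_dens_smul_dualVec hu hθ).symm
    · have hu' : u ∉ K := fun h => hu (hKU h)
      simp only [fderiv_eq_zero_off hK.isClosed (hzi _) hu']
      simp [dvg, fderiv_eq_zero_off hK.isClosed h0 hu', h0 u hu', trc]
  simp only [h1]
  rw [MeasureTheory.integral_finsetSum]
  · exact Finset.sum_eq_zero fun i _ => integral_fderiv_eq_zero hK (hc i) (hzi i) _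
  · intro i _
    have hd : Continuous fun u => fderiv ℝ (fun w => dens h w * dualVec (h w) (θ w) i) u (bas i) :=
      ((hc i).continuous_fderiv (by simp)).clm_apply continuous_const
    exact hd.integrable_of_hasCompactSupport (hasCompactSupport_of_eq_zero_off hK fun u hu => by
      rw [fderiv_eq_zero_off hK.isClosed (hzi i) hu]; rfl)

end LocalMetric

end Divergence

end ConformalBiharmonic

namespace ConformalBiharmonic

/-! ### The Euler-Lagrange expression of a conformal change -/

section ConformalChange

set_option synthInstance.maxHeartbeats 200000

open scoped Shortcuts

variable {n : ℕ}

/-- Only the symmetric part of a bilinear expression contributes to a metric trace, so equality of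
traces can be checked on symmetrised integrands. -/
lemma IsInner.trc_eq_of_symm {A : Bil n} (hA : IsInner A) {B C : Euc n → Euc n → ℝ}
    (h : ∀ X Y, B X Y + B Y X = C X Y + C Y X) : trc A B = trc A C := by
  have h1 : trc A (fun X Y => B X Y + B Y X) = trc A (fun X Y => C X Y + C Y X) := by
    congr 1
    funext X Y
    exact h X Y
  rw [trc_add, trc_add, hA.trc_swap (fun X Y => B X Y), hA.trc_swap (fun X Y => C X Y)] at h1
  linarith

/-- The difference of the Levi-Civita connections of `e^{2ρ} h` and `h`. -/
noncomputable def confDiff (A : Bil n) (η : Euc n →L[ℝ] ℝ) (X Y : Euc n) : Euc n :=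
  η X • Y + η Y • X - A X Y • dualVec A η

lemma IsInner.apply_confDiff {A : Bil n} (hA : IsInner A) (η : Euc n →L[ℝ] ℝ) (X Y Z : Euc n) :
    A (confDiff A η X Y) Z = η X * A Y Z + η Y * A X Z - A X Y * η Z := by
  simp [confDiff, hA.apply_dualVec]

/-- For η = dρ this trace is the tension field of the identity. The two terms linear in η give one
dual vector each, and the metric term subtracts n of them. -/
lemma IsInner.trc_confDiff {A : Bil n} (hA : IsInner A) (η : Euc n →L[ℝ] ℝ) :
    trc A (confDiff A η) = (2 - (n : ℝ)) • dualVec A η := by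
  have h1 := hA.trc_dual η (LinearMap.id : Euc n →ₗ[ℝ] Euc n)
  have h2 : trc A (fun X Y => η Y • X) = dualVec A η := rfl
  have h3 : trc A (fun X Y => A X Y • dualVec A η) = (n : ℝ) • dualVec A η := by
    have := trc_map A (LinearMap.toSpanSingleton ℝ (Euc n) (dualVec A η)) (fun X Y => A X Y)
    simpa [hA.trc_self] using this
  have h4 : confDiff A η = fun X Y => η X • Y + η Y • X - A X Y • dualVec A η := rfl
  simp only [LinearMap.id_apply] at h1
  rw [h4, trc_sub, trc_add, h1, h2, h3, sub_smul, two_smul]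

/-- The data of a conformal change `ht = e^{2ρ} h` on an open subset of `ℝⁿ`. -/
structure ConformalPair (U : Set (Euc n)) (h ht : Euc n → Bil n) (ρ : Euc n → ℝ) : Prop where
  metric : LocalMetric U h
  smooth : ContDiffOn ℝ ∞ ρ U
  eq : ∀ u ∈ U, ht u = Real.exp (2 * ρ u) • h u

namespace ConformalPair

variable {U : Set (Euc n)} {h ht : Euc n → Bil n} {ρ : Euc n → ℝ} {u : Euc n}

/-- The conformal factor. -/
noncomputable def fac (ρ : Euc n → ℝ) (w : Euc n) : ℝ := Real.exp (2 * ρ w)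

/-- The 1-form `e^{2ρ} dρ`. -/
noncomputable def bform (ρ : Euc n → ℝ) (w : Euc n) : Euc n →L[ℝ] ℝ := fac ρ w • fderiv ℝ ρ w

/-- The gradient of `ρ`. -/
noncomputable def grad (h : Euc n → Bil n) (ρ : Euc n → ℝ) (w : Euc n) : Euc n :=
  dualVec (h w) (fderiv ℝ ρ w)

lemma contDiffOn_fac (hc : ConformalPair U h ht ρ) : ContDiffOn ℝ ∞ (fac ρ) U :=
  (contDiffOn_const.mul hc.smooth).exp

lemma target (hc : ConformalPair U h ht ρ) : LocalMetric U ht where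
  isOpen := hc.metric.isOpen
  smooth := (hc.contDiffOn_fac.smul hc.metric.smooth).congr fun u hu => hc.eq u hu
  inner u hu := by
    have hA := hc.metric.inner u hu
    rw [hc.eq u hu]
    refine ⟨fun X Y => ?_, fun X hX => ?_⟩
    · simp [hA.symm X Y]
    · have := hA.pos X hX
      simp only [smul_apply, smul_eq_mul]
      positivity

lemma differentiableAt (hc : ConformalPair U h ht ρ) (hu : u ∈ U) : DifferentiableAt ℝ ρ u :=
  hc.metric.contDiffOn_differentiableAt hc.smooth hu

lemma contDiffOn_alpha (hc : ConformalPair U h ht ρ) : ContDiffOn ℝ ∞ (fderiv ℝ ρ) U :=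
  hc.metric.contDiffOn_fderiv hc.smooth

lemma contDiffOn_bform (hc : ConformalPair U h ht ρ) : ContDiffOn ℝ ∞ (bform ρ) U :=
  hc.contDiffOn_fac.smul hc.contDiffOn_alpha

lemma contDiffOn_grad (hc : ConformalPair U h ht ρ) : ContDiffOn ℝ ∞ (grad h ρ) U :=
  hc.metric.contDiffOn_dualVec hc.contDiffOn_alpha

lemma fderiv_fac (hc : ConformalPair U h ht ρ) (hu : u ∈ U) (X : Euc n) :
    fderiv ℝ (fac ρ) u X = 2 * fac ρ u * fderiv ℝ ρ u X := by
  have h1 : HasFDerivAt (fac ρ) (Real.exp (2 * ρ u) • ((2 : ℝ) • fderiv ℝ ρ u)) u :=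
    ((hc.differentiableAt hu).hasFDerivAt.const_mul 2).exp
  rw [h1.fderiv]
  simp [fac]
  ring

lemma fderiv_alpha_symm (hc : ConformalPair U h ht ρ) (hu : u ∈ U) (X Y : Euc n) :
    fderiv ℝ (fderiv ℝ ρ) u X Y = fderiv ℝ (fderiv ℝ ρ) u Y X :=
  ((hc.smooth.contDiffAt (hc.metric.isOpen.mem_nhds hu)).isSymmSndFDerivAt
      (by rw [minSmoothness_of_isRCLikeNormedField]; exact WithTop.coe_le_coe.2 le_top)).eq X Y

lemma fderiv_bform (hc : ConformalPair U h ht ρ) (hu : u ∈ U) (X Y : Euc n) :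
    fderiv ℝ (bform ρ) u X Y = fac ρ u * (2 * fderiv ℝ ρ u X * fderiv ℝ ρ u Y
      + fderiv ℝ (fderiv ℝ ρ) u X Y) := by
  unfold bform
  rw [fderiv_fun_smul (hc.metric.contDiffOn_differentiableAt hc.contDiffOn_fac hu)
    (hc.metric.contDiffOn_differentiableAt hc.contDiffOn_alpha hu)]
  simp [hc.fderiv_fac hu]
  ring

lemma fderiv_bform_symm (hc : ConformalPair U h ht ρ) (hu : u ∈ U) (X Y : Euc n) :
    fderiv ℝ (bform ρ) u X Y = fderiv ℝ (bform ρ) u Y X := by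
  rw [hc.fderiv_bform hu, hc.fderiv_bform hu, hc.fderiv_alpha_symm hu X Y]
  ring

lemma contDiffOn_dbform (hc : ConformalPair U h ht ρ) : ContDiffOn ℝ ∞ (fderiv ℝ (bform ρ)) U :=
  hc.metric.contDiffOn_fderiv hc.contDiffOn_bform

lemma fderiv2_bform_swap (hc : ConformalPair U h ht ρ) (hu : u ∈ U) (X Y Z : Euc n) :
    fderiv ℝ (fderiv ℝ (bform ρ)) u X Y Z = fderiv ℝ (fderiv ℝ (bform ρ)) u Y X Z := by
  rw [((hc.contDiffOn_bform.contDiffAt (hc.metric.isOpen.mem_nhds hu)).isSymmSndFDerivAt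
      (by rw [minSmoothness_of_isRCLikeNormedField]; exact WithTop.coe_le_coe.2 le_top)).eq X Y]

lemma fderiv2_bform_symm (hc : ConformalPair U h ht ρ) (hu : u ∈ U) (X Y Z : Euc n) :
    fderiv ℝ (fderiv ℝ (bform ρ)) u X Y Z = fderiv ℝ (fderiv ℝ (bform ρ)) u X Z Y := by
  have hd := hc.metric.contDiffOn_differentiableAt hc.contDiffOn_dbform hu
  rw [← fderiv_bil_apply_const hd, ← fderiv_bil_apply_const hd]
  congr 1
  refine Filter.EventuallyEq.fderiv_eq ?_
  filter_upwards [hc.metric.isOpen.mem_nhds hu] with w hw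
  exact hc.fderiv_bform_symm hw _ _

/-- The Levi-Civita connection of a conformal metric. -/
lemma gam_target (hc : ConformalPair U h ht ρ) (hu : u ∈ U) (X Y : Euc n) :
    gam ht u X Y = gam h u X Y + confDiff (h u) (fderiv ℝ ρ u) X Y := by
  have hA := hc.metric.inner u hu
  symm
  refine hc.target.eq_gam hu fun Z => ?_
  have e : ht =ᶠ[nhds u] fun w => fac ρ w • h w := by
    filter_upwards [hc.metric.isOpen.mem_nhds hu] with w hw
    exact hc.eq w hw
  have e1 : ∀ X Y Z, fderiv ℝ ht u X Y Z
      = fac ρ u * (2 * fderiv ℝ ρ u X * h u Y Z + fderiv ℝ h u X Y Z) := by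
    intro X Y Z
    rw [e.fderiv_eq, fderiv_fun_smul (hc.metric.contDiffOn_differentiableAt hc.contDiffOn_fac hu)
      (hc.metric.differentiableAt hu)]
    simp [hc.fderiv_fac hu]
    ring
  rw [e1, e1, e1, hc.eq u hu]
  simp only [smul_apply, map_add, add_apply, hA.apply_confDiff, smul_eq_mul]
  have k := hc.metric.koszul hu X Y Z
  simp only [fac]
  linear_combination Real.exp (2 * ρ u) * k

lemma trc_confDiff (hc : ConformalPair U h ht ρ) (hu : u ∈ U) :
    trc (h u) (fun X Y => gam ht u X Y - gam h u X Y) = (2 - (n : ℝ)) • grad h ρ u := by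
  rw [grad, ← (hc.metric.inner u hu).trc_confDiff]
  congr 1
  funext X Y
  rw [hc.gam_target hu]
  abel

/-- The squared norm of `dρ`. -/
noncomputable def nrm (h : Euc n → Bil n) (ρ : Euc n → ℝ) (w : Euc n) : ℝ :=
  fderiv ℝ ρ w (grad h ρ w)

lemma contDiffOn_nrm (hc : ConformalPair U h ht ρ) : ContDiffOn ℝ ∞ (nrm h ρ) U :=
  hc.contDiffOn_alpha.clm_apply hc.contDiffOn_grad

lemma apply_grad (hc : ConformalPair U h ht ρ) (hu : u ∈ U) (X : Euc n) :
    h u (grad h ρ u) X = fderiv ℝ ρ u X :=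
  (hc.metric.inner u hu).apply_dualVec _ _

lemma fderiv_nrm (hc : ConformalPair U h ht ρ) (hu : u ∈ U) (Z : Euc n) :
    fderiv ℝ (nrm h ρ) u Z = fderiv ℝ (fderiv ℝ ρ) u Z (grad h ρ u)
      + fderiv ℝ ρ u (fderiv ℝ (grad h ρ) u Z) := by
  have h1 := hc.metric.contDiffOn_differentiableAt hc.contDiffOn_alpha hu
  have h2 := hc.metric.contDiffOn_differentiableAt hc.contDiffOn_grad hu
  unfold nrm
  rw [fderiv_clm_apply h1 h2]
  simp
  ring

/-- Here |dρ|² is differentiated as h(grad ρ, grad ρ), whereas `fderiv_nrm` differentiates dρ(grad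
ρ). The two formulas together determine both second-order quantities D²ρ(Z, grad ρ) and dρ(D_Z grad
ρ) from d|dρ|² and dρ(Γ(Z, grad ρ)). -/
lemma fderiv_nrm' (hc : ConformalPair U h ht ρ) (hu : u ∈ U) (Z : Euc n) :
    fderiv ℝ (nrm h ρ) u Z = 2 * fderiv ℝ ρ u (gam h u Z (grad h ρ u))
      + 2 * fderiv ℝ ρ u (fderiv ℝ (grad h ρ) u Z) := by
  have h2 := hc.metric.contDiffOn_differentiableAt hc.contDiffOn_grad hu
  have e : nrm h ρ =ᶠ[nhds u] fun w => h w (grad h ρ w) (grad h ρ w) := by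
    filter_upwards [hc.metric.isOpen.mem_nhds hu] with w hw
    rw [hc.apply_grad hw]; rfl
  rw [e.fderiv_eq, fderiv_bil_apply (hc.metric.differentiableAt hu) h2 h2, hc.metric.compat hu]
  rw [(hc.metric.inner u hu).symm (gam h u Z (grad h ρ u)),
    (hc.metric.inner u hu).symm (fderiv ℝ (grad h ρ) u Z)]
  simp only [hc.apply_grad hu]
  ring

/-- `½ Δ e^{2ρ}`. -/
noncomputable def lapl (h : Euc n → Bil n) (ρ : Euc n → ℝ) (w : Euc n) : ℝ := dvg h (bform ρ) w

/-- The 1-form `X ↦ β(Γ̃(X, Z))`, where `β = e^{2ρ} dρ`. -/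
noncomputable def wform (ht : Euc n → Bil n) (ρ : Euc n → ℝ) (Z w : Euc n) : Euc n →L[ℝ] ℝ :=
  (bform ρ w).comp ((gam ht w).flip Z)

/-- The Euler-Lagrange expression of the bienergy of the identity. -/
noncomputable def euler (h ht : Euc n → Bil n) (ρ : Euc n → ℝ) (Z w : Euc n) : ℝ :=
  (2 - (n : ℝ)) * bform ρ w (gam ht w Z (grad h ρ w))
    + dvg h (fderiv ℝ fun w => bform ρ w Z) w
    + bform ρ w (trc (h w) fun X Y => fderiv ℝ (gam ht) w Z X Y)
    - 2 * dvg h (wform ht ρ Z) w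

lemma contDiffOn_wform (hc : ConformalPair U h ht ρ) (Z : Euc n) :
    ContDiffOn ℝ ∞ (wform ht ρ Z) U :=
  hc.contDiffOn_bform.clm_comp
    ((ContinuousLinearMap.flipₗᵢ ℝ (Euc n) (Euc n) (Euc n)).toContinuousLinearEquiv.contDiff.comp_contDiffOn
      hc.target.contDiffOn_gam |>.clm_apply contDiffOn_const)

end ConformalPair

end ConformalChange

end ConformalBiharmonic

namespace ConformalBiharmonic

/-! ### Evaluation of the Euler-Lagrange expression in invariant terms. -/

section EulerLagrange

set_option synthInstance.maxHeartbeats 200000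

open scoped Shortcuts

variable {n : ℕ}

namespace ConformalPair

variable {U : Set (Euc n)} {h ht : Euc n → Bil n} {ρ : Euc n → ℝ} {u : Euc n}

lemma fderiv_comp_flip {β : Euc n → Euc n →L[ℝ] ℝ} {G : Euc n → Euc n →L[ℝ] Euc n →L[ℝ] Euc n}
    (hβ : DifferentiableAt ℝ β u) (hG : DifferentiableAt ℝ G u) (X Y Z : Euc n)
    (hd : DifferentiableAt ℝ (fun w => (β w).comp ((G w).flip Z)) u) :
    fderiv ℝ (fun w => (β w).comp ((G w).flip Z)) u X Y
      = fderiv ℝ β u X (G u Y Z) + β u (fderiv ℝ G u X Y Z) := by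
  rw [← fderiv_clm_apply_const hd]
  change fderiv ℝ (fun w => β w (G w Y Z)) u X = _
  rw [fderiv_clm_apply hβ ((hG.clm_apply (differentiableAt_const _)).clm_apply
    (differentiableAt_const _))]
  simp [fderiv_bil_apply_const hG]
  ring

lemma contDiffOn_comp_gam_flip (hc : ConformalPair U h ht ρ) (Z : Euc n) :
    ContDiffOn ℝ ∞ (fun w => (bform ρ w).comp ((gam h w).flip Z)) U :=
  hc.contDiffOn_bform.clm_comp
    ((ContinuousLinearMap.flipₗᵢ ℝ (Euc n) (Euc n) (Euc n)).toContinuousLinearEquiv.contDiff.comp_contDiffOn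
      hc.metric.contDiffOn_gam |>.clm_apply contDiffOn_const)

lemma dvg_comp_gam_flip (hc : ConformalPair U h ht ρ) (hu : u ∈ U) (Z : Euc n) :
    dvg h (fun w => (bform ρ w).comp ((gam h w).flip Z)) u
      = trc (h u) fun X Y => fderiv ℝ (bform ρ) u X (gam h u Y Z)
        + bform ρ u (fderiv ℝ (gam h) u X Y Z) - bform ρ u (gam h u (gam h u X Y) Z) := by
  rw [dvg]
  congr 1
  funext X Y
  rw [fderiv_comp_flip (hc.metric.contDiffOn_differentiableAt hc.contDiffOn_bform hu)
    (hc.metric.differentiableAt_gam hu) X Y Z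
    (hc.metric.contDiffOn_differentiableAt (hc.contDiffOn_comp_gam_flip Z) hu)]
  rfl

lemma dvg_fderiv_bform (hc : ConformalPair U h ht ρ) (hu : u ∈ U) (Z : Euc n) :
    dvg h (fderiv ℝ fun w => bform ρ w Z) u
      = trc (h u) fun X Y => fderiv ℝ (fderiv ℝ (bform ρ)) u X Y Z
        - fderiv ℝ (bform ρ) u (gam h u X Y) Z := by
  have hβ := fun {w} (hw : w ∈ U) =>
    hc.metric.contDiffOn_differentiableAt hc.contDiffOn_bform hw
  have hZ : ContDiffOn ℝ ∞ (fun w => bform ρ w Z) U :=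
    hc.contDiffOn_bform.clm_apply contDiffOn_const
  have hd := hc.metric.contDiffOn_differentiableAt (hc.metric.contDiffOn_fderiv hZ) hu
  rw [dvg]
  congr 1
  funext X Y
  rw [← fderiv_clm_apply_const hd, fderiv_clm_apply_const (hβ hu)]
  congr 1
  rw [← fderiv_bil_apply_const (hc.metric.contDiffOn_differentiableAt hc.contDiffOn_dbform hu)]
  congr 1
  refine Filter.EventuallyEq.fderiv_eq ?_
  filter_upwards [hc.metric.isOpen.mem_nhds hu] with w hw
  rw [fderiv_clm_apply_const (hβ hw)]

lemma fderiv_lapl (hc : ConformalPair U h ht ρ) (hu : u ∈ U) (Z : Euc n) :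
    fderiv ℝ (lapl h ρ) u Z
      = trc (h u) fun X Y => fderiv ℝ (fderiv ℝ (bform ρ)) u Z X Y
        - fderiv ℝ (bform ρ) u Z (gam h u X Y) - bform ρ u (fderiv ℝ (gam h) u Z X Y)
        - (fderiv ℝ (bform ρ) u (gam h u Z X) Y - bform ρ u (gam h u (gam h u Z X) Y))
        - (fderiv ℝ (bform ρ) u X (gam h u Z Y) - bform ρ u (gam h u X (gam h u Z Y))) := by
  have hβ := hc.metric.contDiffOn_differentiableAt hc.contDiffOn_bform hu
  have hdβ := hc.metric.contDiffOn_differentiableAt hc.contDiffOn_dbform hu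
  have hG := hc.metric.differentiableAt_gam hu
  -- B is the covariant derivative of e^{2ρ}dρ. Its trace is `lapl`, so `fderiv_trc` gives the
  -- derivative.
  let B : Euc n → Bil n := fun w => fderiv ℝ (bform ρ) w
    - (ContinuousLinearMap.compL ℝ (Euc n) (Euc n) ℝ (bform ρ w)).comp (gam h w)
  have hB : DifferentiableAt ℝ B u :=
    hdβ.sub (((ContinuousLinearMap.compL ℝ (Euc n) (Euc n) ℝ).differentiableAt.comp u hβ).clm_comp hG)
  have h1 := hc.metric.fderiv_trc hu hB Z
  refine Eq.trans h1 ?_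
  congr 1
  funext X Y
  rw [← fderiv_bil_apply_const hB]
  have e : (fun w => B w X Y) = fun w => fderiv ℝ (bform ρ) w X Y - bform ρ w (gam h w X Y) := rfl
  have hGc : DifferentiableAt ℝ (fun w => gam h w X Y) u :=
    (hG.clm_apply (differentiableAt_const _)).clm_apply (differentiableAt_const _)
  rw [e, fderiv_fun_sub ((hdβ.clm_apply (differentiableAt_const _)).clm_apply
    (differentiableAt_const _)) (hβ.clm_apply hGc), sub_apply, fderiv_bil_apply_const hdβ,
    fderiv_clm_apply hβ hGc]
  simp only [add_apply, ContinuousLinearMap.comp_apply, ContinuousLinearMap.flip_apply,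
    fderiv_bil_apply_const hG]
  change _ - (fderiv ℝ (bform ρ) u (gam h u Z X) Y - bform ρ u (gam h u (gam h u Z X) Y))
    - (fderiv ℝ (bform ρ) u X (gam h u Z Y) - bform ρ u (gam h u X (gam h u Z Y))) = _
  ring

/-- The contribution of the connection of `h` to the Euler-Lagrange expression. -/
lemma euler_metric_part (hc : ConformalPair U h ht ρ) (hu : u ∈ U) (Z : Euc n) :
    dvg h (fderiv ℝ fun w => bform ρ w Z) u
        + bform ρ u (trc (h u) fun X Y => fderiv ℝ (gam h) u Z X Y)
        - 2 * dvg h (fun w => (bform ρ w).comp ((gam h w).flip Z)) u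
      = fderiv ℝ (lapl h ρ) u Z + 2 * (fac ρ u * ric h u (grad h ρ u) Z) := by
  have hA := hc.metric.inner u hu
  have h1 := trc_map (h u) ((bform ρ u : Euc n →L[ℝ] ℝ) : Euc n →ₗ[ℝ] ℝ)
    (fun X Y => fderiv ℝ (gam h) u Z X Y)
  simp only [ContinuousLinearMap.coe_coe] at h1
  rw [hc.dvg_fderiv_bform hu, hc.dvg_comp_gam_flip hu, hc.fderiv_lapl hu, ← h1,
    ← hc.metric.trc_riem hu, ← trc_mul, ← trc_mul, ← trc_mul, ← trc_add, ← trc_add, ← trc_sub]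
  -- A commutation of Bochner type. After symmetrisation the second derivatives of `bform ρ` match
  -- because they commute, and what is left of the Γ terms assembles into `riem`.
  refine hA.trc_eq_of_symm fun X Y => ?_
  have hr : ∀ V, fac ρ u * h u V (grad h ρ u) = bform ρ u V := by
    intro V
    rw [hA.symm, hc.apply_grad hu]; rfl
  simp only [hr]
  simp only [riem, map_add, map_sub]
  rw [hc.fderiv2_bform_swap hu Z X Y, hc.fderiv2_bform_swap hu Z Y X,
    hc.fderiv2_bform_symm hu X Z Y, hc.fderiv2_bform_symm hu Y Z X,
    hc.fderiv_bform_symm hu Z (gam h u X Y), hc.fderiv_bform_symm hu Z (gam h u Y X),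
    hc.fderiv_bform_symm hu (gam h u Z X) Y, hc.fderiv_bform_symm hu (gam h u Z Y) X,
    hc.metric.gam_symm hu Y Z, hc.metric.gam_symm hu X Z, hc.metric.gam_symm hu Y X,
    hc.metric.fderiv_gam_symm hu X Y Z, hc.metric.fderiv_gam_symm hu Y X Z,
    hc.metric.gam_symm hu (gam h u X Y) Z, hc.metric.gam_symm hu (gam h u Z X) Y,
    hc.metric.gam_symm hu (gam h u Z Y) X]
  ring

lemma bform_confDiff (h : Euc n → Bil n) (ρ : Euc n → ℝ) (u X Y : Euc n) :
    bform ρ u (confDiff (h u) (fderiv ℝ ρ u) X Y)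
      = 2 * fderiv ℝ ρ u X * bform ρ u Y - fac ρ u * nrm h ρ u * h u X Y := by
  simp [confDiff, bform, nrm, grad]
  ring

lemma trc_bform_left (hc : ConformalPair U h ht ρ) (hu : u ∈ U) (γ : Euc n →L[ℝ] ℝ) :
    trc (h u) (fun X Y => γ X * bform ρ u Y) = fac ρ u * γ (grad h ρ u) := by
  have h1 := (hc.metric.inner u hu).trc_dual (fderiv ℝ ρ u) (γ : Euc n →ₗ[ℝ] ℝ)
  rw [← (hc.metric.inner u hu).trc_swap, grad]
  simp only [ContinuousLinearMap.coe_coe, smul_eq_mul] at h1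
  rw [← h1, ← trc_mul]
  congr 1
  funext X Y
  simp [bform]
  ring

/-- The difference Γ̃ − Γ is never differentiated termwise. Its trace is already known to be (2 − n)
grad ρ; `fderiv_trc` compares the derivative of that trace with the trace of the derivative, and the
conformal formula evaluates the two correction terms. -/
lemma bform_trc_fderiv_diff (hc : ConformalPair U h ht ρ) (hu : u ∈ U) (Z : Euc n) :
    bform ρ u (trc (h u) fun X Y => fderiv ℝ (gam ht) u Z X Y)
      = bform ρ u (trc (h u) fun X Y => fderiv ℝ (gam h) u Z X Y)
        + (2 - (n : ℝ)) * bform ρ u (fderiv ℝ (grad h ρ) u Z)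
        + 2 * fac ρ u * (2 * fderiv ℝ ρ u (gam h u Z (grad h ρ u))
          - nrm h ρ u * gamTrace h u Z) := by
  have hA := hc.metric.inner u hu
  have hG := hc.metric.differentiableAt_gam hu
  have hGt := hc.target.differentiableAt_gam hu
  have hS : DifferentiableAt ℝ (fun w => gam ht w - gam h w) u := hGt.fun_sub hG
  have h1 := hc.metric.fderiv_trc hu hS Z
  have e : (fun w => trc (h w) fun X Y => (gam ht w - gam h w) X Y)
      =ᶠ[nhds u] fun w => (2 - (n : ℝ)) • grad h ρ w := by
    filter_upwards [hc.metric.isOpen.mem_nhds hu] with w hw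
    exact hc.trc_confDiff hw
  have hg := hc.metric.contDiffOn_differentiableAt hc.contDiffOn_grad hu
  rw [e.fderiv_eq, fderiv_fun_const_smul hg, fderiv_fun_sub hGt hG] at h1
  have h1' : (2 - (n : ℝ)) • fderiv ℝ (grad h ρ) u Z
      = (trc (h u) fun X Y => fderiv ℝ (gam ht) u Z X Y)
        - (trc (h u) fun X Y => fderiv ℝ (gam h) u Z X Y)
        - (trc (h u) fun X Y => gam ht u (gam h u Z X) Y - gam h u (gam h u Z X) Y)
        - (trc (h u) fun X Y => gam ht u X (gam h u Z Y) - gam h u X (gam h u Z Y)) := by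
    rw [← trc_sub, ← trc_sub, ← trc_sub]
    exact h1
  have h2 := congrArg (bform ρ u) h1'
  rw [map_sub, map_sub, map_sub, map_smul, smul_eq_mul] at h2
  have h3 : bform ρ u (trc (h u) fun X Y => gam ht u (gam h u Z X) Y - gam h u (gam h u Z X) Y)
      = fac ρ u * (2 * fderiv ℝ ρ u (gam h u Z (grad h ρ u)) - nrm h ρ u * gamTrace h u Z) := by
    have k1 := trc_map (h u) ((bform ρ u : Euc n →L[ℝ] ℝ) : Euc n →ₗ[ℝ] ℝ)
      (fun X Y => gam ht u (gam h u Z X) Y - gam h u (gam h u Z X) Y)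
    simp only [ContinuousLinearMap.coe_coe] at k1
    rw [← k1]
    have k2 : ∀ X Y, bform ρ u (gam ht u (gam h u Z X) Y - gam h u (gam h u Z X) Y)
        = 2 * (((fderiv ℝ ρ u).comp (gam h u Z)) X * bform ρ u Y)
          - fac ρ u * nrm h ρ u * h u (gam h u Z X) Y := by
      intro X Y
      rw [hc.gam_target hu, add_sub_cancel_left, bform_confDiff]
      simp only [ContinuousLinearMap.comp_apply]
      ring
    simp only [k2]
    rw [trc_sub, trc_mul, trc_mul, hc.trc_bform_left hu, hA.trc_apply_map]
    simp only [ContinuousLinearMap.comp_apply, gamTrace]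
    ring
  have h4 : bform ρ u (trc (h u) fun X Y => gam ht u X (gam h u Z Y) - gam h u X (gam h u Z Y))
      = fac ρ u * (2 * fderiv ℝ ρ u (gam h u Z (grad h ρ u)) - nrm h ρ u * gamTrace h u Z) := by
    rw [← h3, ← hA.trc_swap fun X Y => gam ht u (gam h u Z X) Y - gam h u (gam h u Z X) Y]
    congr 2
    funext X Y
    rw [hc.target.gam_symm hu, hc.metric.gam_symm hu X]
  linarith

lemma dvg_flip_metric (hc : ConformalPair U h ht ρ) (hu : u ∈ U) (Z : Euc n)
    (hd : DifferentiableAt ℝ (fun w => (h w).flip Z) u) :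
    dvg h (fun w => (h w).flip Z) u = gamTrace h u Z := by
  have hA := hc.metric.inner u hu
  rw [gamTrace, ← hA.trc_apply_map (gam h u Z), dvg]
  congr 1
  funext X Y
  rw [← fderiv_clm_apply_const hd]
  change fderiv ℝ (fun w => h w Y Z) u X - h u (gam h u X Y) Z = _
  rw [fderiv_bil_apply_const (hc.metric.differentiableAt hu), hc.metric.compat hu,
    hc.metric.gam_symm hu X Z, hA.symm Y]
  ring

lemma dvg_wform (hc : ConformalPair U h ht ρ) (hu : u ∈ U) (Z : Euc n) :
    dvg h (wform ht ρ Z) u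
      = dvg h (fun w => (bform ρ w).comp ((gam h w).flip Z)) u
        + 2 * (fac ρ u * fderiv ℝ (fderiv ℝ ρ) u Z (grad h ρ u) + fderiv ℝ ρ u Z * lapl h ρ u)
        - (2 * fac ρ u * fderiv ℝ ρ u Z * nrm h ρ u + fac ρ u * fderiv ℝ (nrm h ρ) u Z
          + fac ρ u * nrm h ρ u * gamTrace h u Z) := by
  have hA := hc.metric.inner u hu
  have D := fun {W : Type} [NormedAddCommGroup W] [NormedSpace ℝ W] {f : Euc n → W}
    (hf : ContDiffOn ℝ ∞ f U) => hc.metric.contDiffOn_differentiableAt hf hu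
  have hα := D hc.contDiffOn_alpha
  have hflip : ContDiffOn ℝ ∞ (fun w => (h w).flip Z) U :=
    (ContinuousLinearMap.flipₗᵢ ℝ (Euc n) (Euc n) ℝ).toContinuousLinearEquiv.contDiff.comp_contDiffOn
      hc.metric.smooth |>.clm_apply contDiffOn_const
  have haZ : ContDiffOn ℝ ∞ (fun w => 2 * fderiv ℝ ρ w Z) U :=
    contDiffOn_const.mul (hc.contDiffOn_alpha.clm_apply contDiffOn_const)
  have hFq : ContDiffOn ℝ ∞ (fun w => fac ρ w * nrm h ρ w) U :=
    hc.contDiffOn_fac.mul hc.contDiffOn_nrm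
  have hs1 : ContDiffOn ℝ ∞ (fun w => (2 * fderiv ℝ ρ w Z) • bform ρ w) U :=
    haZ.smul hc.contDiffOn_bform
  have hs2 : ContDiffOn ℝ ∞ (fun w => (fac ρ w * nrm h ρ w) • (h w).flip Z) U := hFq.smul hflip
  -- With β = e^{2ρ}dρ, the conformal change of Γ splits β(Γ̃(·, Z)) into β(Γ(·, Z)) + 2dρ(Z)β −
  -- e^{2ρ}|dρ|² h(·, Z). Each piece has an accessible divergence.
  have e : wform ht ρ Z =ᶠ[nhds u] fun w => (bform ρ w).comp ((gam h w).flip Z)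
      + ((2 * fderiv ℝ ρ w Z) • bform ρ w - (fac ρ w * nrm h ρ w) • (h w).flip Z) := by
    filter_upwards [hc.metric.isOpen.mem_nhds hu] with w hw
    ext X
    change bform ρ w (gam ht w X Z) = bform ρ w (gam h w X Z)
      + ((2 * fderiv ℝ ρ w Z) * bform ρ w X - (fac ρ w * nrm h ρ w) * h w X Z)
    rw [hc.gam_target hw, map_add, bform_confDiff]
    simp only [bform, smul_apply, smul_eq_mul]
    ring
  rw [dvg_congr h e, dvg_add h (D (hc.contDiffOn_comp_gam_flip Z)) ((D hs1).fun_sub (D hs2)),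
    dvg_sub h (D hs1) (D hs2), dvg_smul h (D haZ) (D hc.contDiffOn_bform),
    dvg_smul h (D hFq) (D hflip), hc.dvg_flip_metric hu Z (D hflip), hc.trc_bform_left hu]
  have k1 : trc (h u) (fun X Y => fderiv ℝ (fun w => fac ρ w * nrm h ρ w) u X * (h u).flip Z Y)
      = fderiv ℝ (fun w => fac ρ w * nrm h ρ w) u Z := by
    have := hA.trc_pair' Z
      ((fderiv ℝ (fun w => fac ρ w * nrm h ρ w) u : Euc n →L[ℝ] ℝ) : Euc n →ₗ[ℝ] ℝ)
    simp only [ContinuousLinearMap.coe_coe, smul_eq_mul] at this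
    rw [← this]
    congr 1
    funext X Y
    rw [ContinuousLinearMap.flip_apply, mul_comm]
  rw [k1, fderiv_fun_mul (D hc.contDiffOn_fac) (D hc.contDiffOn_nrm),
    fderiv_const_mul (D (hc.contDiffOn_alpha.clm_apply contDiffOn_const))]
  simp only [add_apply, smul_apply, smul_eq_mul, hc.fderiv_fac hu, fderiv_clm_apply_const hα,
    hc.fderiv_alpha_symm hu (grad h ρ u) Z, lapl]
  ring

/-- The coordinate-dependent terms dρ(Γ(Z, grad ρ)) and `gamTrace h u Z` cancel, so what remains is
a genuine 1-form in Z. The coefficient 6 − n is (2 − n) + 4, with 2 − n from the connection term and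
4 from the divergence of `wform`. -/
lemma euler_eq (hc : ConformalPair U h ht ρ) (hu : u ∈ U) (Z : Euc n) :
    euler h ht ρ Z u = fderiv ℝ (lapl h ρ) u Z + 2 * fac ρ u * ric h u (grad h ρ u) Z
      + (6 - (n : ℝ)) * fac ρ u * nrm h ρ u * fderiv ℝ ρ u Z
      + (1 - (n : ℝ) / 2) * fac ρ u * fderiv ℝ (nrm h ρ) u Z
      - 4 * lapl h ρ u * fderiv ℝ ρ u Z := by
  have hA := hc.metric.inner u hu
  have h1 := hc.euler_metric_part hu Z
  have h2 := hc.fderiv_nrm hu Z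
  have h3 := hc.fderiv_nrm' hu Z
  have h4 : bform ρ u (gam ht u Z (grad h ρ u))
      = fac ρ u * fderiv ℝ ρ u (gam h u Z (grad h ρ u)) + fac ρ u * nrm h ρ u * fderiv ℝ ρ u Z := by
    rw [hc.gam_target hu, map_add, bform_confDiff, hA.symm Z, hc.apply_grad hu]
    simp only [bform, smul_apply, smul_eq_mul, nrm]
    ring
  have h5 : bform ρ u (fderiv ℝ (grad h ρ) u Z)
      = fac ρ u * fderiv ℝ ρ u (fderiv ℝ (grad h ρ) u Z) := rfl
  rw [euler, hc.dvg_wform hu, hc.bform_trc_fderiv_diff hu, h4, h5]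
  have h6 : fderiv ℝ ρ u (fderiv ℝ (grad h ρ) u Z)
    = fderiv ℝ (nrm h ρ) u Z / 2 - fderiv ℝ ρ u (gam h u Z (grad h ρ u)) := by linarith
  have h7 : fderiv ℝ (fderiv ℝ ρ) u Z (grad h ρ u)
    = fderiv ℝ (nrm h ρ) u Z / 2 + fderiv ℝ ρ u (gam h u Z (grad h ρ u)) := by linarith
  rw [h6, h7]
  linear_combination h1

end ConformalPair

end EulerLagrange

end ConformalBiharmonic

namespace ConformalBiharmonic

/-! ### The first variation of the bienergy -/

section Variation

set_option synthInstance.maxHeartbeats 200000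

open scoped Shortcuts

open MeasureTheory

variable {n : ℕ}

lemma hasDerivAt_setIntegral_of_contDiffOn {O : Set (ℝ × Euc n)} (hO : IsOpen O)
    {g : ℝ × Euc n → ℝ} (hg : ContDiffOn ℝ ∞ g O) {K : Set (Euc n)} (hK : IsCompact K)
    (h0 : ∀ u ∈ K, ((0 : ℝ), u) ∈ O) :
    HasDerivAt (fun t => ∫ u in K, g (t, u)) (∫ u in K, fderiv ℝ g (0, u) (1, 0)) 0 := by
  have h1 : ∀ᶠ t in nhds (0 : ℝ), ∀ u ∈ K, (t, u) ∈ O :=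
    hK.eventually_forall_of_forall_eventually fun u hu => by
      exact hO.mem_nhds (h0 u hu)
  obtain ⟨δ, hδ, hb⟩ := Metric.eventually_nhds_iff.1 h1
  -- Half the radius keeps the closed interval inside the region given by compactness. On the
  -- compact set J × K the t-derivative has a constant bound, which serves as the dominating
  -- function.
  set J : Set ℝ := Metric.closedBall 0 (δ / 2)
  have hJO : ∀ t ∈ J, ∀ u ∈ K, (t, u) ∈ O := fun t ht u hu =>
    hb (lt_of_le_of_lt (Metric.mem_closedBall.1 ht) (by linarith)) u hu
  have hJK : IsCompact (J ×ˢ K) := (isCompact_closedBall _ _).prod hK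
  have hsub : J ×ˢ K ⊆ O := fun p hp => hJO p.1 hp.1 p.2 hp.2
  have hd : ContinuousOn (fun p => fderiv ℝ g p (1, 0)) (J ×ˢ K) :=
    (((hg.fderiv_of_isOpen hO (m := ∞) (by simp)).clm_apply contDiffOn_const).continuousOn).mono hsub
  obtain ⟨C, hC⟩ := hJK.exists_bound_of_continuousOn hd
  have h0J : (0 : ℝ) ∈ J := Metric.mem_closedBall_self (by linarith)
  have hcont : ∀ t ∈ J, ContinuousOn (fun u => g (t, u)) K := fun t ht =>
    hg.continuousOn.comp (by fun_prop) fun u hu => hJO t ht u hu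
  have hcont' : ContinuousOn (fun u => fderiv ℝ g (0, u) (1, 0)) K :=
    hd.comp (by fun_prop) fun u hu => ⟨h0J, hu⟩
  have hmem : Metric.ball (0 : ℝ) (δ / 2) ∈ nhds (0 : ℝ) := Metric.ball_mem_nhds _ (by linarith)
  refine (hasDerivAt_integral_of_dominated_loc_of_deriv_le (μ := volume.restrict K)
    (F := fun t u => g (t, u)) (F' := fun t u => fderiv ℝ g (t, u) (1, 0)) (bound := fun _ => C)
    hmem ?_ ?_ ?_ ?_ ?_ ?_).2
  · filter_upwards [hmem] with t ht
    exact (hcont t (Metric.ball_subset_closedBall ht)).aestronglyMeasurable hK.measurableSet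
  · exact (hcont 0 h0J).integrableOn_compact hK
  · exact hcont'.aestronglyMeasurable hK.measurableSet
  · filter_upwards [ae_restrict_mem hK.measurableSet] with u hu t ht
    exact hC (t, u) ⟨Metric.ball_subset_closedBall ht, hu⟩
  · exact integrableOn_const hK.measure_lt_top.ne
  · filter_upwards [ae_restrict_mem hK.measurableSet] with u hu t ht
    have hp := hJO t (Metric.ball_subset_closedBall ht) u hu
    have hgd : HasFDerivAt g (fderiv ℝ g (t, u)) (t, u) :=
      ((hg.contDiffAt (hO.mem_nhds hp)).differentiableAt (by simp)).hasFDerivAt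
    exact hgd.comp_hasDerivAt t ((hasDerivAt_id t).prodMk (hasDerivAt_const t u))

/-! ### The compactly supported variation of the identity in coordinates. -/

/-- The tension field of a map between open subsets of `ℝⁿ`. -/
noncomputable def tens (h ht : Euc n → Bil n) (f : Euc n → Euc n) (u : Euc n) : Euc n :=
  trc (h u) fun X Y => fderiv ℝ (fderiv ℝ f) u X Y - fderiv ℝ f u (gam h u X Y)
    + gam ht (f u) (fderiv ℝ f u X) (fderiv ℝ f u Y)

/-- The variation of the identity in the direction `η Z`. -/
noncomputable def vary (η : Euc n → ℝ) (Z : Euc n) (t : ℝ) (w : Euc n) : Euc n := w + (t * η w) • Z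

/-- The tension field of the variation `vary η Z`. -/
noncomputable def varyTens (h ht : Euc n → Bil n) (η : Euc n → ℝ) (Z : Euc n) (p : ℝ × Euc n) :
    Euc n :=
  (p.1 * dvg h (fderiv ℝ η) p.2) • Z - trc (h p.2) (fun X Y => gam h p.2 X Y)
    + trc (h p.2) fun X Y => gam ht (vary η Z p.1 p.2) (X + (p.1 * fderiv ℝ η p.2 X) • Z)
      (Y + (p.1 * fderiv ℝ η p.2 Y) • Z)

lemma fderiv_vary {η : Euc n → ℝ} (hη : ContDiff ℝ ∞ η) (Z : Euc n) (t : ℝ) (u X : Euc n) :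
    fderiv ℝ (vary η Z t) u X = X + (t * fderiv ℝ η u X) • Z := by
  have hd : DifferentiableAt ℝ η u := hη.differentiable (by simp) u
  have h1 : HasFDerivAt (vary η Z t)
      (ContinuousLinearMap.id ℝ (Euc n) + (t • fderiv ℝ η u).smulRight Z) u :=
    (hasFDerivAt_id u).add ((hd.hasFDerivAt.const_mul t).smul_const Z)
  rw [h1.fderiv]
  simp

lemma fderiv2_vary {η : Euc n → ℝ} (hη : ContDiff ℝ ∞ η) (Z : Euc n) (t : ℝ) (u X Y : Euc n) :
    fderiv ℝ (fderiv ℝ (vary η Z t)) u X Y = (t * fderiv ℝ (fderiv ℝ η) u X Y) • Z := by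
  have hd : DifferentiableAt ℝ (fderiv ℝ η) u :=
    (hη.fderiv_right (m := ∞) (by simp)).differentiable (by simp) u
  have hv : ContDiff ℝ ∞ (vary η Z t) :=
    contDiff_id.add ((contDiff_const.mul hη).smul contDiff_const)
  have hd2 : DifferentiableAt ℝ (fderiv ℝ (vary η Z t)) u :=
    (hv.fderiv_right (m := ∞) (by simp)).differentiable (by simp) u
  rw [← fderiv_clm_apply_const hd2]
  simp only [fderiv_vary hη]
  have h0 : HasFDerivAt (fun w => fderiv ℝ η w Y) (fderiv ℝ (fun w => fderiv ℝ η w Y) u) u :=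
    (hd.clm_apply (differentiableAt_const _)).hasFDerivAt
  have h1 := ((h0.const_mul t).smul_const Z).const_add Y
  rw [h1.fderiv]
  simp [fderiv_clm_apply_const hd]

/-- The variation has derivative X + t dη(X) Z and second derivative t D²η(X, Y) Z. The resulting
closed formula is visibly smooth in (t, u) jointly, as needed for differentiation under the
integral. -/
lemma tens_vary (h ht : Euc n → Bil n) {η : Euc n → ℝ} (hη : ContDiff ℝ ∞ η) (Z : Euc n) (t : ℝ)
    (u : Euc n) : tens h ht (vary η Z t) u = varyTens h ht η Z (t, u) := by
  have h1 : (t * dvg h (fderiv ℝ η) u) • Z = trc (h u) fun X Y =>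
      (t * (fderiv ℝ (fderiv ℝ η) u X Y - fderiv ℝ η u (gam h u X Y))) • Z := by
    have := trc_map (h u) (LinearMap.toSpanSingleton ℝ (Euc n) Z)
      (fun X Y => t * (fderiv ℝ (fderiv ℝ η) u X Y - fderiv ℝ η u (gam h u X Y)))
    simp only [LinearMap.toSpanSingleton_apply] at this
    rw [this, trc_mul]; rfl
  simp only [tens, varyTens]
  rw [h1, ← trc_sub, ← trc_add]
  congr 1
  funext X Y
  rw [fderiv2_vary hη]
  simp only [fderiv_vary hη]
  module

namespace ConformalPair

variable {U K : Set (Euc n)} {h ht : Euc n → Bil n} {ρ η : Euc n → ℝ} {u : Euc n}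

/-- The set on which the variation is defined. -/
def varySet (U : Set (Euc n)) (η : Euc n → ℝ) (Z : Euc n) : Set (ℝ × Euc n) :=
  {p | p.2 ∈ U ∧ vary η Z p.1 p.2 ∈ U}

lemma contDiff_vary (hη : ContDiff ℝ ∞ η) (Z : Euc n) :
    ContDiff ℝ ∞ fun p : ℝ × Euc n => vary η Z p.1 p.2 :=
  contDiff_snd.add ((contDiff_fst.mul (hη.comp contDiff_snd)).smul contDiff_const)

lemma isOpen_varySet (hc : ConformalPair U h ht ρ) (hη : ContDiff ℝ ∞ η) (Z : Euc n) :
    IsOpen (varySet U η Z) :=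
  (hc.metric.isOpen.preimage continuous_snd).inter
    (hc.metric.isOpen.preimage (contDiff_vary hη Z).continuous)

lemma contDiffOn_varyTens (hc : ConformalPair U h ht ρ) (hη : ContDiff ℝ ∞ η) (Z : Euc n) :
    ContDiffOn ℝ ∞ (varyTens h ht η Z) (varySet U η Z) := by
  have hm : Set.MapsTo (Prod.snd : ℝ × Euc n → Euc n) (varySet U η Z) U := fun p hp => hp.1
  have hm2 : Set.MapsTo (fun p : ℝ × Euc n => vary η Z p.1 p.2) (varySet U η Z) U :=
    fun p hp => hp.2
  have hdη : ContDiff ℝ ∞ (fderiv ℝ η) := hη.fderiv_right (by simp)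
  have hs : ContDiffOn ℝ ∞ (Prod.snd : ℝ × Euc n → Euc n) (varySet U η Z) := contDiffOn_snd
  have hX : ∀ X : Euc n, ContDiffOn ℝ ∞ (fun p : ℝ × Euc n => X + (p.1 * fderiv ℝ η p.2 X) • Z)
      (varySet U η Z) := fun X =>
    contDiffOn_const.add ((contDiffOn_fst.mul ((hdη.contDiffOn.comp hs
      (Set.mapsTo_univ _ _)).clm_apply contDiffOn_const)).smul contDiffOn_const)
  refine ContDiffOn.add (ContDiffOn.sub ?_ ?_) ?_
  · exact (contDiffOn_fst.mul ((hc.metric.contDiffOn_dvg hdη.contDiffOn).comp hs hm)).smul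
      contDiffOn_const
  · exact (hc.metric.contDiffOn_trc hc.metric.contDiffOn_gam).comp hs hm
  · unfold trc
    exact ContDiffOn.sum fun i _ => ContDiffOn.sum fun j _ =>
      ((hc.metric.contDiffOn_inv i j).comp hs hm).smul
        (((hc.target.contDiffOn_gam.comp (contDiff_vary hη Z).contDiffOn hm2).clm_apply
          (hX _)).clm_apply (hX _))

/-- The integrand of the bienergy of the variation. -/
noncomputable def varyEnergy (h ht : Euc n → Bil n) (η : Euc n → ℝ) (Z : Euc n) (p : ℝ × Euc n) :
    ℝ :=
  dens h p.2 * ht (vary η Z p.1 p.2) (varyTens h ht η Z p) (varyTens h ht η Z p)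

lemma contDiffOn_varyEnergy (hc : ConformalPair U h ht ρ) (hη : ContDiff ℝ ∞ η) (Z : Euc n) :
    ContDiffOn ℝ ∞ (varyEnergy h ht η Z) (varySet U η Z) := by
  have hm : Set.MapsTo (Prod.snd : ℝ × Euc n → Euc n) (varySet U η Z) U := fun p hp => hp.1
  have hm2 : Set.MapsTo (fun p : ℝ × Euc n => vary η Z p.1 p.2) (varySet U η Z) U :=
    fun p hp => hp.2
  exact (hc.metric.contDiffOn_dens.comp contDiffOn_snd hm).mul
    (((hc.target.smooth.comp (contDiff_vary hη Z).contDiffOn hm2).clm_apply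
      (hc.contDiffOn_varyTens hη Z)).clm_apply (hc.contDiffOn_varyTens hη Z))

lemma vary_zero (η : Euc n → ℝ) (Z u : Euc n) : vary η Z 0 u = u := by simp [vary]

lemma varyTens_zero (hc : ConformalPair U h ht ρ) (hu : u ∈ U) (Z : Euc n) :
    varyTens h ht η Z (0, u) = (2 - (n : ℝ)) • grad h ρ u := by
  rw [← hc.trc_confDiff hu, trc_sub]
  simp [varyTens, vary_zero]
  abel

lemma hasDerivAt_varyTens (hc : ConformalPair U h ht ρ) (hu : u ∈ U) (Z : Euc n) :
    HasDerivAt (fun t => varyTens h ht η Z (t, u))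
      (dvg h (fderiv ℝ η) u • Z + trc (h u) fun X Y => η u • fderiv ℝ (gam ht) u Z X Y
        + fderiv ℝ η u X • gam ht u Z Y + fderiv ℝ η u Y • gam ht u X Z) 0 := by
  have hv : HasDerivAt (fun t => vary η Z t u) (η u • Z) 0 := by
    have := (((hasDerivAt_id (0 : ℝ)).mul_const (η u)).smul_const Z).const_add u
    simpa [vary] using this
  have hG : HasDerivAt (fun t => gam ht (vary η Z t u)) (fderiv ℝ (gam ht) u (η u • Z)) 0 := by
    have h1 : HasFDerivAt (gam ht) (fderiv ℝ (gam ht) u) (vary η Z 0 u) := by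
      rw [vary_zero]
      exact (hc.target.differentiableAt_gam hu).hasFDerivAt
    exact h1.comp_hasDerivAt 0 hv
  have hX : ∀ X : Euc n, HasDerivAt (fun t : ℝ => X + (t * fderiv ℝ η u X) • Z)
      (fderiv ℝ η u X • Z) 0 := by
    intro X
    have := (((hasDerivAt_id (0 : ℝ)).mul_const (fderiv ℝ η u X)).smul_const Z).const_add X
    simpa using this
  have hs : HasDerivAt (fun t => trc (h u) fun X Y => gam ht (vary η Z t u)
        (X + (t * fderiv ℝ η u X) • Z) (Y + (t * fderiv ℝ η u Y) • Z))
      (trc (h u) fun X Y => η u • fderiv ℝ (gam ht) u Z X Y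
        + fderiv ℝ η u X • gam ht u Z Y + fderiv ℝ η u Y • gam ht u X Z) 0 := by
    unfold trc
    refine HasDerivAt.fun_sum fun i _ => HasDerivAt.fun_sum fun j _ => HasDerivAt.fun_const_smul _ ?_
    have := (hG.clm_apply (hX (bas i))).clm_apply (hX (bas j))
    simpa [vary_zero] using this
  have h0 : HasDerivAt (fun t : ℝ => (t * dvg h (fderiv ℝ η) u) • Z) (dvg h (fderiv ℝ η) u • Z) 0 := by
    simpa using ((hasDerivAt_id (0 : ℝ)).mul_const (dvg h (fderiv ℝ η) u)).smul_const Z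
  exact (h0.sub_const (trc (h u) fun X Y => gam h u X Y)).add hs

/-- The gradient is raised with h but the bienergy pairs it with e^{2ρ}h. This is why e^{2ρ}dρ,
rather than dρ, occurs in the Euler-Lagrange expression. -/
lemma target_grad (hc : ConformalPair U h ht ρ) (hu : u ∈ U) (X : Euc n) :
    ht u (grad h ρ u) X = bform ρ u X := by
  rw [hc.eq u hu]
  simp only [smul_apply, hc.apply_grad hu, bform, fac]

/-- The 1-form whose divergence is discarded in the first variation. -/
noncomputable def boundaryForm (ht : Euc n → Bil n) (ρ η : Euc n → ℝ) (Z w : Euc n) :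
    Euc n →L[ℝ] ℝ :=
  bform ρ w Z • fderiv ℝ η w - η w • fderiv ℝ (fun w => bform ρ w Z) w
    + (2 * η w) • wform ht ρ Z w

lemma contDiffOn_boundaryForm (hc : ConformalPair U h ht ρ) (hη : ContDiff ℝ ∞ η) (Z : Euc n) :
    ContDiffOn ℝ ∞ (boundaryForm ht ρ η Z) U := by
  have hβ : ContDiffOn ℝ ∞ (fun w => bform ρ w Z) U := hc.contDiffOn_bform.clm_apply contDiffOn_const
  exact ((hβ.smul (hη.fderiv_right (m := ∞) (by simp)).contDiffOn).sub
    (hη.contDiffOn.smul (hc.metric.contDiffOn_fderiv hβ))).add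
    ((contDiffOn_const.mul hη.contDiffOn).smul (hc.contDiffOn_wform Z))

/-- The first two summands form Green's second identity: their terms ⟨dη, d(β(Z))⟩, with β =
e^{2ρ}dρ, cancel because the trace is symmetric. The last summand removes the remaining first
derivative of η. -/
lemma dvg_boundaryForm (hc : ConformalPair U h ht ρ) (hη : ContDiff ℝ ∞ η) (hu : u ∈ U)
    (Z : Euc n) :
    dvg h (boundaryForm ht ρ η Z) u
      = bform ρ u Z * dvg h (fderiv ℝ η) u - η u * dvg h (fderiv ℝ fun w => bform ρ w Z) u
        + 2 * (trc (h u) fun X Y => fderiv ℝ η u X * wform ht ρ Z u Y)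
        + 2 * η u * dvg h (wform ht ρ Z) u := by
  have hβ : ContDiffOn ℝ ∞ (fun w => bform ρ w Z) U := hc.contDiffOn_bform.clm_apply contDiffOn_const
  have hdη : ContDiffOn ℝ ∞ (fderiv ℝ η) U := (hη.fderiv_right (m := ∞) (by simp)).contDiffOn
  have D := fun {W : Type} [NormedAddCommGroup W] [NormedSpace ℝ W] {f : Euc n → W}
    (hf : ContDiffOn ℝ ∞ f U) => hc.metric.contDiffOn_differentiableAt hf hu
  have hdβ := hc.metric.contDiffOn_fderiv hβ
  have h2η : ContDiffOn ℝ ∞ (fun w => 2 * η w) U := contDiffOn_const.mul hη.contDiffOn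
  have s1 : ContDiffOn ℝ ∞ (fun w => bform ρ w Z • fderiv ℝ η w) U := hβ.smul hdη
  have s2 : ContDiffOn ℝ ∞ (fun w => η w • fderiv ℝ (fun w => bform ρ w Z) w) U :=
    hη.contDiffOn.smul hdβ
  have s3 : ContDiffOn ℝ ∞ (fun w => (2 * η w) • wform ht ρ Z w) U := h2η.smul (hc.contDiffOn_wform Z)
  unfold boundaryForm
  rw [dvg_add h ((D s1).fun_sub (D s2)) (D s3), dvg_sub h (D s1) (D s2), dvg_smul h (D hβ) (D hdη),
    dvg_smul h (D hη.contDiffOn) (D hdβ), dvg_smul h (D h2η) (D (hc.contDiffOn_wform Z)),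
    fderiv_const_mul (D hη.contDiffOn),
    ← (hc.metric.inner u hu).trc_swap fun X Y =>
      fderiv ℝ η u X * fderiv ℝ (fun w => bform ρ w Z) u Y, ← trc_mul]
  simp only [smul_apply, smul_eq_mul, mul_comm (fderiv ℝ η u _) (fderiv ℝ (fun w => bform ρ w Z) u _),
    mul_assoc]
  ring

/-- At t = 0 the tension field is (2 − n) grad ρ, so pairing its derivative with it produces `bform`
and one factor 2 − n. Differentiating the metric contributes a further term quadratic in 2 − n, the
first summand of `euler`. The terms with derivatives of η differ from multiples of η by a
divergence. -/
lemma fderiv_varyEnergy (hc : ConformalPair U h ht ρ) (hη : ContDiff ℝ ∞ η) (hu : u ∈ U)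
    (Z : Euc n) :
    fderiv ℝ (varyEnergy h ht η Z) (0, u) (1, 0)
      = 2 * (2 - (n : ℝ)) * (dens h u * (η u * euler h ht ρ Z u)
        + dens h u * dvg h (boundaryForm ht ρ η Z) u) := by
  have hO := hc.isOpen_varySet hη Z
  have hp : ((0 : ℝ), u) ∈ varySet U η Z := ⟨hu, by simpa [vary_zero] using hu⟩
  have hd : HasFDerivAt (varyEnergy h ht η Z) (fderiv ℝ (varyEnergy h ht η Z) (0, u)) (0, u) :=
    (((hc.contDiffOn_varyEnergy hη Z).contDiffAt (hO.mem_nhds hp)).differentiableAt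
      (by simp)).hasFDerivAt
  have h1 := hd.comp_hasDerivAt (0 : ℝ) ((hasDerivAt_id (0 : ℝ)).prodMk (hasDerivAt_const 0 u))
  have hv : HasDerivAt (fun t => vary η Z t u) (η u • Z) 0 := by
    have := (((hasDerivAt_id (0 : ℝ)).mul_const (η u)).smul_const Z).const_add u
    simpa [vary] using this
  have hH : HasDerivAt (fun t => ht (vary η Z t u)) (fderiv ℝ ht u (η u • Z)) 0 := by
    have h1 : HasFDerivAt ht (fderiv ℝ ht u) (vary η Z 0 u) := by
      rw [vary_zero]
      exact (hc.target.differentiableAt hu).hasFDerivAt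
    exact h1.comp_hasDerivAt 0 hv
  have hT := hc.hasDerivAt_varyTens (η := η) hu Z
  have h2 := ((hH.clm_apply hT).clm_apply hT).const_mul (dens h u)
  rw [h1.unique h2]
  have hA := hc.target.inner u hu
  simp only [vary_zero, hc.varyTens_zero hu, add_apply, map_smul, smul_apply, smul_eq_mul,
    hc.target.compat hu]
  set T' := dvg h (fderiv ℝ η) u • Z + trc (h u) fun X Y => η u • fderiv ℝ (gam ht) u Z X Y
        + fderiv ℝ η u X • gam ht u Z Y + fderiv ℝ η u Y • gam ht u X Z with hT'
  rw [hA.symm T', hA.symm (gam ht u Z (grad h ρ u)), hc.target_grad hu, hc.target_grad hu]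
  have k1 : bform ρ u T' = bform ρ u Z * dvg h (fderiv ℝ η) u
      + η u * bform ρ u (trc (h u) fun X Y => fderiv ℝ (gam ht) u Z X Y)
      + 2 * trc (h u) fun X Y => fderiv ℝ η u X * wform ht ρ Z u Y := by
    have m : ∀ B : Euc n → Euc n → Euc n, trc (h u) (fun X Y => bform ρ u (B X Y))
        = bform ρ u (trc (h u) B) := fun B =>
      trc_map (h u) ((bform ρ u : Euc n →L[ℝ] ℝ) : Euc n →ₗ[ℝ] ℝ) B
    rw [hT', map_add, map_smul, ← m, ← m]
    simp only [map_add, map_smul, smul_eq_mul]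
    rw [trc_add, trc_add, trc_mul,
      ← (hc.metric.inner u hu).trc_swap fun X Y => fderiv ℝ η u Y * bform ρ u (gam ht u X Z)]
    have e1 : ∀ X Y : Euc n, fderiv ℝ η u X * bform ρ u (gam ht u Z Y)
      = fderiv ℝ η u X * wform ht ρ Z u Y := fun X Y => by
        rw [hc.target.gam_symm hu]; rfl
    have e2 : ∀ X Y : Euc n, fderiv ℝ η u X * bform ρ u (gam ht u Y Z)
      = fderiv ℝ η u X * wform ht ρ Z u Y := fun X Y => rfl
    simp only [e1, e2]
    ring
  rw [k1, hc.dvg_boundaryForm hη hu, euler]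
  ring

lemma contDiffOn_euler (hc : ConformalPair U h ht ρ) (Z : Euc n) :
    ContDiffOn ℝ ∞ (euler h ht ρ Z) U := by
  have hβ := hc.contDiffOn_bform
  have hdG : ContDiffOn ℝ ∞ (fun w => fderiv ℝ (gam ht) w Z) U :=
    (hc.metric.contDiffOn_fderiv hc.target.contDiffOn_gam).clm_apply contDiffOn_const
  exact (((contDiffOn_const.mul (hβ.clm_apply ((hc.target.contDiffOn_gam.clm_apply
    contDiffOn_const).clm_apply hc.contDiffOn_grad))).add
    (hc.metric.contDiffOn_dvg (hc.metric.contDiffOn_fderiv (hβ.clm_apply contDiffOn_const)))).add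
    (hβ.clm_apply (hc.metric.contDiffOn_trc hdG))).sub
    (contDiffOn_const.mul (hc.metric.contDiffOn_dvg (hc.contDiffOn_wform Z)))

/-- The first variation formula. -/
lemma hasDerivAt_integral_varyEnergy (hc : ConformalPair U h ht ρ) (hη : ContDiff ℝ ∞ η)
    (hK : IsCompact K) (hKU : K ⊆ U) (h0 : ∀ u ∉ K, η u = 0) (Z : Euc n) :
    HasDerivAt (fun t => ∫ u in K, varyEnergy h ht η Z (t, u))
      (2 * (2 - (n : ℝ)) * ∫ u in K, dens h u * (η u * euler h ht ρ Z u)) 0 := by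
  have h1 := hasDerivAt_setIntegral_of_contDiffOn (hc.isOpen_varySet hη Z)
    (hc.contDiffOn_varyEnergy hη Z) hK fun u hu => ⟨hKU hu, by simpa [vary_zero] using hKU hu⟩
  convert! h1 using 1
  have hθ := hc.contDiffOn_boundaryForm hη Z
  have hz : ∀ u ∉ K, boundaryForm ht ρ η Z u = 0 := by
    intro u hu
    simp [boundaryForm, h0 u hu, fderiv_eq_zero_off hK.isClosed h0 hu]
  -- The form vanishes off K together with η, so the divergence theorem applies without a boundary
  -- term.
  have hi : ∫ u in K, dens h u * dvg h (boundaryForm ht ρ η Z) u = 0 := by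
    rw [setIntegral_eq_integral_of_forall_compl_eq_zero, hc.metric.integral_dvg hθ hK hKU hz]
    intro u hu
    simp [dvg, trc, hz u hu, fderiv_eq_zero_off hK.isClosed hz hu]
  have e : ∫ u in K, fderiv ℝ (varyEnergy h ht η Z) (0, u) (1, 0)
      = ∫ u in K, 2 * (2 - (n : ℝ)) * (dens h u * (η u * euler h ht ρ Z u)
        + dens h u * dvg h (boundaryForm ht ρ η Z) u) :=
    setIntegral_congr_fun hK.measurableSet fun u hu => hc.fderiv_varyEnergy hη (hKU hu) Z
  rw [e, integral_const_mul, integral_add, hi, add_zero]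
  · exact ((hc.metric.contDiffOn_dens.mul (hη.contDiffOn.mul
      (hc.contDiffOn_euler Z))).continuousOn.mono hKU).integrableOn_compact hK
  · exact ((hc.metric.contDiffOn_dens.mul
      (hc.metric.contDiffOn_dvg hθ)).continuousOn.mono hKU).integrableOn_compact hK

/-- The fundamental lemma of the calculus of variations: vanishing almost everywhere, then
everywhere by continuity, and finally division by the positive density. -/
lemma euler_eq_zero (hc : ConformalPair U h ht ρ) (Z : Euc n)
    (hE : ∀ (η : Euc n → ℝ) (K : Set (Euc n)), ContDiff ℝ ∞ η → IsCompact K → K ⊆ U →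
      (∀ u ∉ K, η u = 0) → ∫ u in K, dens h u * (η u * euler h ht ρ Z u) = 0) (hu : u ∈ U) :
    euler h ht ρ Z u = 0 := by
  have hf : ContinuousOn (fun u => dens h u * euler h ht ρ Z u) U :=
    (hc.metric.contDiffOn_dens.mul (hc.contDiffOn_euler Z)).continuousOn
  have h1 := hc.metric.isOpen.ae_eq_zero_of_integral_contDiff_smul_eq_zero (μ := volume)
    (hf.locallyIntegrableOn hc.metric.isOpen.measurableSet) fun η hη hs hU => by
      have h0 : ∀ u ∉ tsupport η, η u = 0 := fun u hu => image_eq_zero_of_notMem_tsupport hu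
      rw [← hE η (tsupport η) hη hs hU h0,
        setIntegral_eq_integral_of_forall_compl_eq_zero fun u hu => by rw [h0 u hu]; ring]
      refine integral_congr_ae (Filter.Eventually.of_forall fun u => ?_)
      simp only [smul_eq_mul]
      ring
  have h2 : Set.EqOn (fun u => dens h u * euler h ht ρ Z u) (fun _ => 0) U :=
    Measure.eqOn_open_of_ae_eq ((ae_restrict_iff' hc.metric.isOpen.measurableSet).2 h1)
      hc.metric.isOpen hf continuousOn_const
  have h3 := h2 hu
  exact (mul_eq_zero.1 h3).resolve_left (hc.metric.dens_pos hu).ne'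

end ConformalPair

end Variation

end ConformalBiharmonic

namespace ConformalBiharmonic

/-! ### Changes of coordinates -/

section CoordChange

set_option synthInstance.maxHeartbeats 200000

open scoped Shortcuts

variable {n : ℕ} {W : Type*} [NormedAddCommGroup W] [NormedSpace ℝ W]

lemma one_le_infty : (1 : WithTop ℕ∞) ≤ ∞ := WithTop.coe_le_coe.2 le_top

/-- The metric `h'` near `p` is the pull-back of `h` by the local diffeomorphism `θ`. -/
structure CoordChange (U' U : Set (Euc n)) (h' h : Euc n → Bil n) (θ : Euc n → Euc n) (p : Euc n) :
    Prop where
  metric' : LocalMetric U' h'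
  metric : LocalMetric U h
  mem' : p ∈ U'
  mem : θ p ∈ U
  smooth : ContDiffAt ℝ ∞ θ p
  det_ne : (fderiv ℝ θ p).det ≠ 0
  pull : ∀ᶠ w in nhds p, h' w = pullBil (h (θ w)) (fderiv ℝ θ w)

/-- The covariant derivative of a vector-valued 1-form. -/
noncomputable def covD (h : Euc n → Bil n) (η : Euc n → Euc n →L[ℝ] W) (u : Euc n) :
    Euc n →L[ℝ] Euc n →L[ℝ] W :=
  fderiv ℝ η u - (ContinuousLinearMap.compL ℝ (Euc n) (Euc n) W (η u)).comp (gam h u)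

lemma covD_apply (h : Euc n → Bil n) (η : Euc n → Euc n →L[ℝ] W) (u X Y : Euc n) :
    covD h η u X Y = fderiv ℝ η u X Y - η u (gam h u X Y) := rfl

lemma trc_pullBil_clm (A : Bil n) {J : Euc n →L[ℝ] Euc n} (hJ : J.det ≠ 0)
    (B : Euc n →L[ℝ] Euc n →L[ℝ] W) :
    trc (pullBil A J) (fun X Y => B (J X) (J Y)) = trc A (fun X Y => B X Y) :=
  trc_pullBil A hJ (LinearMap.mk₂ ℝ (fun X Y => B X Y) (by simp) (by simp) (by simp) (by simp))

namespace CoordChange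

variable {U' U : Set (Euc n)} {h' h : Euc n → Bil n} {θ : Euc n → Euc n} {p : Euc n}

lemma differentiableAt (hc : CoordChange U' U h' h θ p) : DifferentiableAt ℝ θ p :=
  hc.smooth.differentiableAt (by simp)

lemma differentiableAt_fderiv (hc : CoordChange U' U h' h θ p) :
    DifferentiableAt ℝ (fderiv ℝ θ) p :=
  (hc.smooth.fderiv_right (m := ∞) (by simp)).differentiableAt (by simp)

lemma fderiv2_symm (hc : CoordChange U' U h' h θ p) (X Y : Euc n) :
    fderiv ℝ (fderiv ℝ θ) p X Y = fderiv ℝ (fderiv ℝ θ) p Y X :=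
  (hc.smooth.isSymmSndFDerivAt
      (by rw [minSmoothness_of_isRCLikeNormedField]; exact WithTop.coe_le_coe.2 le_top)).eq X Y

lemma pull_self (hc : CoordChange U' U h' h θ p) (X Y : Euc n) :
    h' p X Y = h (θ p) (fderiv ℝ θ p X) (fderiv ℝ θ p Y) := by
  rw [hc.pull.self_of_nhds, pullBil_apply]

lemma fderiv_metric (hc : CoordChange U' U h' h θ p) (X Y Z : Euc n) :
    fderiv ℝ h' p X Y Z = fderiv ℝ h (θ p) (fderiv ℝ θ p X) (fderiv ℝ θ p Y) (fderiv ℝ θ p Z)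
      + h (θ p) (fderiv ℝ (fderiv ℝ θ) p X Y) (fderiv ℝ θ p Z)
      + h (θ p) (fderiv ℝ θ p Y) (fderiv ℝ (fderiv ℝ θ) p X Z) := by
  have hh := hc.metric.differentiableAt hc.mem
  have hd := hc.differentiableAt
  have hd2 := hc.differentiableAt_fderiv
  rw [← fderiv_bil_apply_const (hc.metric'.differentiableAt hc.mem')]
  have e : (fun w => h' w Y Z) =ᶠ[nhds p]
      fun w => (h ∘ θ) w (fderiv ℝ θ w Y) (fderiv ℝ θ w Z) := by
    filter_upwards [hc.pull] with w hw
    rw [hw]; rfl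
  rw [e.fderiv_eq, fderiv_bil_apply (hh.comp p hd) (hd2.clm_apply (differentiableAt_const _))
    (hd2.clm_apply (differentiableAt_const _)), fderiv_comp p hh hd, fderiv_clm_apply_const hd2,
    fderiv_clm_apply_const hd2]
  rfl

lemma surjective_of_det_ne {J : Euc n →L[ℝ] Euc n} (hJ : J.det ≠ 0) : Function.Surjective J := by
  intro Z
  exact ⟨(J.toContinuousLinearEquivOfDetNeZero hJ).symm Z,
    (J.toContinuousLinearEquivOfDetNeZero hJ).apply_symm_apply Z⟩

/-- The transformation law of the Christoffel symbols. -/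
lemma gam_eq (hc : CoordChange U' U h' h θ p) (X Y : Euc n) :
    fderiv ℝ θ p (gam h' p X Y)
      = gam h (θ p) (fderiv ℝ θ p X) (fderiv ℝ θ p Y) + fderiv ℝ (fderiv ℝ θ) p X Y := by
  have hA := hc.metric.inner _ hc.mem
  refine hA.eq_of_forall fun Z => ?_
  -- Every test vector lies in the image of the differential of θ, so the Koszul formulas of the two
  -- metrics can be compared.
  obtain ⟨Z, rfl⟩ := surjective_of_det_ne hc.det_ne Z
  have k1 := hc.metric'.koszul hc.mem' X Y Z
  have k2 := hc.metric.koszul hc.mem (fderiv ℝ θ p X) (fderiv ℝ θ p Y) (fderiv ℝ θ p Z)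
  rw [hc.pull_self, hc.fderiv_metric, hc.fderiv_metric, hc.fderiv_metric] at k1
  rw [map_add, add_apply]
  rw [hc.fderiv2_symm Y X, hc.fderiv2_symm Z X, hc.fderiv2_symm Z Y] at k1
  have s1 := hA.symm (fderiv ℝ θ p Y) (fderiv ℝ (fderiv ℝ θ) p X Z)
  linarith

/-- Covariant differentiation commutes with changes of coordinates. -/
lemma covD_eq (hc : CoordChange U' U h' h θ p) {η η' : Euc n → Euc n →L[ℝ] W}
    (hη : DifferentiableAt ℝ η (θ p))
    (he : η' =ᶠ[nhds p] fun w => (η (θ w)).comp (fderiv ℝ θ w)) (X Y : Euc n) :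
    covD h' η' p X Y = covD h η (θ p) (fderiv ℝ θ p X) (fderiv ℝ θ p Y) := by
  have hd := hc.differentiableAt
  have hd2 := hc.differentiableAt_fderiv
  have hηθ : DifferentiableAt ℝ (fun w => η (θ w)) p := hη.comp p hd
  rw [covD_apply, covD_apply, he.fderiv_eq, he.self_of_nhds,
    ← fderiv_clm_apply_const (hηθ.clm_comp hd2)]
  simp only [ContinuousLinearMap.comp_apply]
  rw [fderiv_clm_apply hηθ (hd2.clm_apply (differentiableAt_const _)), hc.gam_eq]
  have e1 : fderiv ℝ (fun w => η (θ w)) p = (fderiv ℝ η (θ p)).comp (fderiv ℝ θ p) :=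
    fderiv_comp p hη hd
  rw [e1]
  simp only [add_apply, ContinuousLinearMap.comp_apply, ContinuousLinearMap.flip_apply,
    fderiv_clm_apply_const hd2, map_add]
  abel

lemma trc_covD (hc : CoordChange U' U h' h θ p) {η η' : Euc n → Euc n →L[ℝ] W}
    (hη : DifferentiableAt ℝ η (θ p))
    (he : η' =ᶠ[nhds p] fun w => (η (θ w)).comp (fderiv ℝ θ w)) :
    trc (h' p) (fun X Y => covD h' η' p X Y) = trc (h (θ p)) fun X Y => covD h η (θ p) X Y := by
  rw [← trc_pullBil_clm (h (θ p)) hc.det_ne, ← hc.pull.self_of_nhds]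
  congr 1
  funext X Y
  exact hc.covD_eq hη he X Y

lemma dvg_eq (hc : CoordChange U' U h' h θ p) {η η' : Euc n → Euc n →L[ℝ] ℝ}
    (hη : DifferentiableAt ℝ η (θ p))
    (he : η' =ᶠ[nhds p] fun w => (η (θ w)).comp (fderiv ℝ θ w)) :
    dvg h' η' p = dvg h η (θ p) :=
  hc.trc_covD hη he

end CoordChange

/-! ### Invariance of the tension field under coordinate changes on either side. -/

/-- The second fundamental form of a map between open subsets of `ℝⁿ`. -/
noncomputable def sff (h ht : Euc n → Bil n) (f : Euc n → Euc n) (u : Euc n) :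
    Euc n →L[ℝ] Euc n →L[ℝ] Euc n :=
  covD h (fderiv ℝ f) u + (gam ht (f u)).bilinearComp (fderiv ℝ f u) (fderiv ℝ f u)

lemma tens_eq_trc_sff (h ht : Euc n → Bil n) (f : Euc n → Euc n) (u : Euc n) :
    tens h ht f u = trc (h u) fun X Y => sff h ht f u X Y := rfl

lemma tens_congr (h ht : Euc n → Bil n) {f g : Euc n → Euc n} {u : Euc n} (e : f =ᶠ[nhds u] g) :
    tens h ht f u = tens h ht g u := by
  simp only [tens, e.fderiv_eq, e.fderiv.fderiv_eq, e.self_of_nhds]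

namespace CoordChange

variable {U' U V' V : Set (Euc n)} {h' h kt' kt : Euc n → Bil n} {θ ζ : Euc n → Euc n} {p : Euc n}

/-- The tension field under a change of coordinates on the domain. -/
lemma tens_domain (hc : CoordChange U' U h' h θ p) {f : Euc n → Euc n}
    (hf : ContDiffAt ℝ ∞ f (θ p)) : tens h' kt (f ∘ θ) p = tens h kt f (θ p) := by
  have hfd : ∀ᶠ w in nhds (θ p), DifferentiableAt ℝ f w := by
    filter_upwards [(hf.of_le one_le_infty).eventually (by simp)] with w hw
    exact hw.differentiableAt (by simp)
  have hθd : ∀ᶠ w in nhds p, DifferentiableAt ℝ θ w := by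
    filter_upwards [(hc.smooth.of_le one_le_infty).eventually (by simp)] with w hw
    exact hw.differentiableAt (by simp)
  have he : fderiv ℝ (f ∘ θ) =ᶠ[nhds p] fun w => (fderiv ℝ f (θ w)).comp (fderiv ℝ θ w) := by
    filter_upwards [hθd, hc.smooth.continuousAt.eventually hfd] with w h1 h2
    exact fderiv_comp w h2 h1
  have hd2 : DifferentiableAt ℝ (fderiv ℝ f) (θ p) :=
    (hf.fderiv_right (m := ∞) (by simp)).differentiableAt (by simp)
  rw [tens_eq_trc_sff, tens_eq_trc_sff, ← trc_pullBil_clm (h (θ p)) hc.det_ne, ← hc.pull.self_of_nhds]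
  congr 1
  funext X Y
  simp only [sff, add_apply, hc.covD_eq hd2 he]
  rw [ContinuousLinearMap.bilinearComp_apply, ContinuousLinearMap.bilinearComp_apply,
    he.self_of_nhds]
  rfl

/-- The tension field under a change of coordinates on the target. -/
lemma tens_target {u : Euc n} {f : Euc n → Euc n} (hf : ContDiffAt ℝ ∞ f u)
    (hc : CoordChange V' V kt' kt ζ (f u)) :
    tens h kt (ζ ∘ f) u = fderiv ℝ ζ (f u) (tens h kt' f u) := by
  have hfd : ∀ᶠ w in nhds u, DifferentiableAt ℝ f w := by
    filter_upwards [(hf.of_le one_le_infty).eventually (by simp)] with w hw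
    exact hw.differentiableAt (by simp)
  have hζd : ∀ᶠ w in nhds (f u), DifferentiableAt ℝ ζ w := by
    filter_upwards [(hc.smooth.of_le one_le_infty).eventually (by simp)] with w hw
    exact hw.differentiableAt (by simp)
  have he : fderiv ℝ (ζ ∘ f) =ᶠ[nhds u] fun w => (fderiv ℝ ζ (f w)).comp (fderiv ℝ f w) := by
    filter_upwards [hfd, hf.continuousAt.eventually hζd] with w h1 h2
    exact fderiv_comp w h2 h1
  have hd := hf.differentiableAt (n := ∞) (by simp)
  have hd2 : DifferentiableAt ℝ (fderiv ℝ f) u :=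
    (hf.fderiv_right (m := ∞) (by simp)).differentiableAt (by simp)
  have hζ2 : DifferentiableAt ℝ (fun w => fderiv ℝ ζ (f w)) u := hc.differentiableAt_fderiv.comp u hd
  have h2 : ∀ X Y, fderiv ℝ (fderiv ℝ (ζ ∘ f)) u X Y
      = fderiv ℝ (fderiv ℝ ζ) (f u) (fderiv ℝ f u X) (fderiv ℝ f u Y)
        + fderiv ℝ ζ (f u) (fderiv ℝ (fderiv ℝ f) u X Y) := by
    intro X Y
    rw [he.fderiv_eq, ← fderiv_clm_apply_const (hζ2.clm_comp hd2)]
    simp only [ContinuousLinearMap.comp_apply]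
    rw [fderiv_clm_apply hζ2 (hd2.clm_apply (differentiableAt_const _))]
    have e1 : fderiv ℝ (fun w => fderiv ℝ ζ (f w)) u
        = (fderiv ℝ (fderiv ℝ ζ) (f u)).comp (fderiv ℝ f u) :=
      fderiv_comp u hc.differentiableAt_fderiv hd
    rw [e1]
    simp only [add_apply, ContinuousLinearMap.comp_apply, ContinuousLinearMap.flip_apply,
      fderiv_clm_apply_const hd2]
    abel
  have m := trc_map (h u) ((fderiv ℝ ζ (f u) : Euc n →L[ℝ] Euc n) : Euc n →ₗ[ℝ] Euc n)
    (fun X Y => fderiv ℝ (fderiv ℝ f) u X Y - fderiv ℝ f u (gam h u X Y)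
    + gam kt' (f u) (fderiv ℝ f u X) (fderiv ℝ f u Y))
  simp only [ContinuousLinearMap.coe_coe] at m
  rw [tens, tens, ← m]
  congr 1
  funext X Y
  rw [h2, he.self_of_nhds]
  -- The second derivative of ζ produced by the chain rule is exactly the inhomogeneous term in the
  -- transformation law of Γ.
  simp only [ContinuousLinearMap.comp_apply, map_add, map_sub, hc.gam_eq, Function.comp_apply]
  abel

end CoordChange

end CoordChange

end ConformalBiharmonic

namespace ConformalBiharmonic

/-! ### A Riemannian metric in the charts of a manifold -/

section Charts

set_option synthInstance.maxHeartbeats 400000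

open scoped Shortcuts

variable {n : ℕ} {M : Type*} [TopologicalSpace M] [ChartedSpace (Euc n) M]

/-- The inverse of the chart at `x₀`. -/
noncomputable def par (x₀ : M) : Euc n → M := (extChartAt (𝓡 n) x₀).symm

/-- The range of the chart at `x₀`. -/
def dom (x₀ : M) : Set (Euc n) := (extChartAt (𝓡 n) x₀).target

lemma isOpen_dom (x₀ : M) : IsOpen (dom (n := n) x₀) := isOpen_extChartAt_target x₀

/-- The derivative of the inverse of the chart at `x₀`. -/
noncomputable def dpar (x₀ : M) (u : Euc n) : Euc n →L[ℝ] Euc n :=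
  mfderiv 𝓘(ℝ, Euc n) (𝓡 n) (par x₀) u

variable [IsManifold (𝓡 n) ∞ M]

/-- The metric at a point, as a bilinear form on the model space. -/
noncomputable def innerAt (g : RMetric n M) (x : M) : Bil n := g.inner x

lemma isInner_innerAt (g : RMetric n M) (x : M) : IsInner (innerAt g x) where
  symm X Y := g.symm x X Y
  pos X hX := g.pos x X hX

/-- The metric in the chart at `x₀`. -/
noncomputable def locMet (g : RMetric n M) (x₀ : M) (u : Euc n) : Bil n :=
  pullBil (innerAt g (par x₀ u)) (dpar x₀ u)

lemma locMet_apply (g : RMetric n M) (x₀ : M) (u X Y : Euc n) :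
    locMet g x₀ u X Y = innerAt g (par x₀ u) (dpar x₀ u X) (dpar x₀ u Y) := rfl

lemma gram_eq (g : RMetric n M) (x₀ : M) (u : Euc n) : gram g x₀ u = mat (locMet g x₀ u) := rfl

lemma contMDiffOn_par (x₀ : M) : ContMDiffOn 𝓘(ℝ, Euc n) (𝓡 n) ∞ (par x₀) (dom (n := n) x₀) :=
  contMDiffOn_extChartAt_symm x₀

lemma mdifferentiableAt_par (x₀ : M) {u : Euc n} (hu : u ∈ dom x₀) :
    MDifferentiableAt 𝓘(ℝ, Euc n) (𝓡 n) (par x₀) u :=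
  ((contMDiffOn_par x₀).contMDiffAt ((isOpen_dom x₀).mem_nhds hu)).mdifferentiableAt (by simp)

lemma contMDiffOn_dpar (x₀ : M) (X : Euc n) :
    ContMDiffOn 𝓘(ℝ, Euc n) (𝓡 n).tangent ∞
      (fun u => (⟨par x₀ u, (dpar x₀ u X : Euc n)⟩ : TangentBundle (𝓡 n) M)) (dom x₀) := by
  have h1 := (contMDiffOn_par (n := n) x₀).contMDiffOn_tangentMapWithin (m := ∞) (by simp)
    (isOpen_dom x₀).uniqueMDiffOn
  have h2 : ContMDiff 𝓘(ℝ, Euc n) 𝓘(ℝ, Euc n).tangent ∞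
      (fun u : Euc n => (⟨u, X⟩ : TangentBundle 𝓘(ℝ, Euc n) (Euc n))) := by
    have := (contMDiff_vectorSpace_iff_contDiff (𝕜 := ℝ) (E := Euc n) (n := ∞)
      (V := fun _ : Euc n => (X : Euc n))).2 contDiff_const
    exact this
  refine (h1.comp h2.contMDiffOn fun u hu => hu).congr fun u hu => ?_
  simp only [Function.comp_apply, tangentMapWithin, dpar]
  rw [mfderivWithin_of_isOpen (isOpen_dom x₀) hu]
  rfl

lemma contDiffOn_locMet (g : RMetric n M) (x₀ : M) : ContDiffOn ℝ ∞ (locMet g x₀) (dom x₀) := by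
  rw [contDiffOn_clm_apply]
  intro X
  rw [contDiffOn_clm_apply]
  intro Y
  rw [← contMDiffOn_iff_contDiffOn]
  have hg : ContMDiffOn 𝓘(ℝ, Euc n) ((𝓡 n).prod 𝓘(ℝ, Euc n →L[ℝ] Euc n →L[ℝ] ℝ)) ∞
      (fun u => Bundle.TotalSpace.mk' (Euc n →L[ℝ] Euc n →L[ℝ] ℝ)
        (E := fun x : M => TangentSpace (𝓡 n) x →L[ℝ] TangentSpace (𝓡 n) x →L[ℝ] ℝ)
        (par x₀ u) (g.inner (par x₀ u))) (dom x₀) :=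
    g.contMDiff.comp_contMDiffOn (contMDiffOn_par x₀)
  have h1 := ContMDiffOn.clm_bundle_apply₂ (F₁ := Euc n) (F₂ := Euc n) (F₃ := ℝ)
    (E₃ := Bundle.Trivial M ℝ) hg (contMDiffOn_dpar x₀ X) (contMDiffOn_dpar x₀ Y)
  intro u hu
  have h2 := h1 u hu
  rw [Bundle.contMDiffWithinAt_totalSpace] at h2
  exact h2.2

end Charts

end ConformalBiharmonic

namespace ConformalBiharmonic

/-! ### Transition maps between charts -/

section Transition

set_option synthInstance.maxHeartbeats 400000

open scoped Shortcuts

variable {n : ℕ} {M : Type*} [TopologicalSpace M] [ChartedSpace (Euc n) M]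

/-- The chart at `x₀`. -/
noncomputable def cht (x₀ : M) : M → Euc n := extChartAt (𝓡 n) x₀

/-- The domain of the chart at `x₀`. -/
def src (x₀ : M) : Set M := (extChartAt (𝓡 n) x₀).source

lemma isOpen_src (x₀ : M) : IsOpen (src (n := n) x₀) := isOpen_extChartAt_source x₀

lemma mem_src (x₀ : M) : x₀ ∈ src (n := n) x₀ := mem_extChartAt_source x₀

lemma cht_mem {x₀ y : M} (hy : y ∈ src (n := n) x₀) : cht (n := n) x₀ y ∈ dom (n := n) x₀ :=
  (extChartAt (𝓡 n) x₀).map_source hy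

lemma par_mem {x₀ : M} {u : Euc n} (hu : u ∈ dom x₀) : par x₀ u ∈ src (n := n) x₀ :=
  (extChartAt (𝓡 n) x₀).map_target hu

lemma par_cht {x₀ y : M} (hy : y ∈ src (n := n) x₀) : par x₀ (cht (n := n) x₀ y) = y :=
  (extChartAt (𝓡 n) x₀).left_inv hy

lemma cht_par {x₀ : M} {u : Euc n} (hu : u ∈ dom x₀) : cht x₀ (par x₀ u) = u :=
  (extChartAt (𝓡 n) x₀).right_inv hu

lemma continuousOn_par (x₀ : M) : ContinuousOn (par x₀) (dom (n := n) x₀) :=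
  continuousOn_extChartAt_symm x₀

lemma continuousOn_cht (x₀ : M) : ContinuousOn (cht (n := n) x₀) (src (n := n) x₀) :=
  continuousOn_extChartAt x₀

/-- The transition map from the chart at `y` to the chart at `x₀`. -/
noncomputable def trans (x₀ y : M) : Euc n → Euc n := fun w => cht x₀ (par y w)

/-- The domain of the transition map. -/
def transDom (x₀ y : M) : Set (Euc n) := dom y ∩ par y ⁻¹' src (n := n) x₀

lemma isOpen_transDom (x₀ y : M) : IsOpen (transDom (n := n) x₀ y) :=
  (continuousOn_par y).isOpen_inter_preimage (isOpen_dom y) (isOpen_src x₀)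

lemma trans_mem {x₀ y : M} {p : Euc n} (hp : p ∈ transDom x₀ y) : trans x₀ y p ∈ dom (n := n) x₀ :=
  cht_mem hp.2

lemma par_trans {x₀ y : M} {p : Euc n} (hp : p ∈ transDom x₀ y) :
    par x₀ (trans x₀ y p) = par (n := n) y p := par_cht hp.2

variable [IsManifold (𝓡 n) ∞ M]

lemma contMDiffOn_cht (x₀ : M) : ContMDiffOn (𝓡 n) 𝓘(ℝ, Euc n) ∞ (cht (n := n) x₀) (src (n := n) x₀) := by
  have := contMDiffOn_extChartAt (I := 𝓡 n) (n := ∞) (x := x₀)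
  rwa [← extChartAt_source (𝓡 n)] at this

lemma injective_dpar (x₀ : M) {u : Euc n} (hu : u ∈ dom x₀) :
    Function.Injective (dpar x₀ u) := by
  have h := isInvertible_mfderivWithin_extChartAt_symm (I := 𝓡 n) (x := x₀) (y := u) hu
  rw [ModelWithCorners.range_eq_univ, mfderivWithin_univ] at h
  exact h.injective

/-- The tangent space at x₀ is identified with ℝⁿ through the chart at x₀ itself. This makes
pointwise definitions agree with their coordinate versions at that one point. -/
lemma dpar_cht_self (x₀ : M) : dpar x₀ (cht x₀ x₀) = ContinuousLinearMap.id ℝ (Euc n) := by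
  have h := mfderivWithin_range_extChartAt_symm (I := 𝓡 n) (x := x₀)
  rw [ModelWithCorners.range_eq_univ, mfderivWithin_univ] at h
  exact h

lemma locMet_cht_self (g : RMetric n M) (x₀ : M) : locMet g x₀ (cht x₀ x₀) = innerAt g x₀ := by
  have : par x₀ (cht (n := n) x₀ x₀) = x₀ := par_cht (mem_src x₀)
  ext X Y
  rw [locMet_apply, dpar_cht_self, this]
  rfl

lemma localMetric_locMet (g : RMetric n M) (x₀ : M) : LocalMetric (dom x₀) (locMet g x₀) where
  isOpen := isOpen_dom x₀
  smooth := contDiffOn_locMet g x₀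
  inner u hu := by
    refine ⟨fun X Y => (isInner_innerAt g _).symm _ _, fun X hX => (isInner_innerAt g _).pos _ ?_⟩
    intro h0
    exact hX (injective_dpar x₀ hu (Eq.trans h0 (map_zero _).symm))

lemma contDiffOn_trans (x₀ y : M) : ContDiffOn ℝ ∞ (trans x₀ y) (transDom (n := n) x₀ y) := by
  rw [← contMDiffOn_iff_contDiffOn]
  exact (contMDiffOn_cht x₀).comp ((contMDiffOn_par y).mono Set.inter_subset_left) fun w hw => hw.2

lemma dpar_trans {x₀ y : M} {p : Euc n} (hp : p ∈ transDom x₀ y) :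
    dpar y p = (dpar x₀ (trans x₀ y p)).comp (fderiv ℝ (trans x₀ y) p) := by
  have hO := (isOpen_transDom x₀ y).mem_nhds hp
  have hd : DifferentiableAt ℝ (trans x₀ y) p :=
    ((contDiffOn_trans x₀ y).contDiffAt hO).differentiableAt (by simp)
  have e : par y =ᶠ[nhds p] par x₀ ∘ trans x₀ y := by
    filter_upwards [hO] with w hw
    exact (par_trans hw).symm
  have h1 := e.mfderiv_eq (I := 𝓘(ℝ, Euc n)) (I' := 𝓡 n)
  have h2 := mfderiv_comp p (mdifferentiableAt_par x₀ (trans_mem hp)) hd.mdifferentiableAt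
  rw [mfderiv_eq_fderiv] at h2
  exact h1.trans h2

lemma locMet_trans (g : RMetric n M) {x₀ y : M} {p : Euc n} (hp : p ∈ transDom x₀ y) :
    locMet g y p = pullBil (locMet g x₀ (trans x₀ y p)) (fderiv ℝ (trans x₀ y) p) := by
  ext X Y
  rw [pullBil_apply, locMet_apply, locMet_apply, dpar_trans hp, par_trans hp]
  rfl

lemma det_fderiv_trans {x₀ y : M} {p : Euc n} (hp : p ∈ transDom x₀ y) :
    (fderiv ℝ (trans x₀ y) p).det ≠ 0 := by
  have h := injective_dpar y hp.1
  rw [dpar_trans hp] at h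
  have h2 : Function.Injective (fderiv ℝ (trans x₀ y) p) := Function.Injective.of_comp h
  intro h0
  obtain ⟨v, hv, hv0⟩ := Submodule.exists_mem_ne_zero_of_ne_bot (LinearMap.bot_lt_ker_of_det_eq_zero h0).ne'
  exact hv0 (h2 (by rw [map_zero]; exact hv))

lemma coordChange_trans (g : RMetric n M) {x₀ y : M} {p : Euc n} (hp : p ∈ transDom x₀ y) :
    CoordChange (dom y) (dom x₀) (locMet g y) (locMet g x₀) (trans x₀ y) p where
  metric' := localMetric_locMet g y
  metric := localMetric_locMet g x₀
  mem' := hp.1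
  mem := trans_mem hp
  smooth := (contDiffOn_trans x₀ y).contDiffAt ((isOpen_transDom x₀ y).mem_nhds hp)
  det_ne := det_fderiv_trans hp
  pull := by
    filter_upwards [(isOpen_transDom x₀ y).mem_nhds hp] with w hw
    exact locMet_trans g hw

end Transition

end ConformalBiharmonic

namespace ConformalBiharmonic

/-! ### Geometric quantities in a chart -/

section Components

set_option synthInstance.maxHeartbeats 400000

open scoped Shortcuts

variable {n : ℕ}

lemma fderiv_component {f : Euc n → Euc n}
    {u : Euc n} (hf : DifferentiableAt ℝ f u) (X : Euc n) (k : Fin n) :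
    fderiv ℝ (fun w => f w k) u X = fderiv ℝ f u X k := by
  have := ((EuclideanSpace.proj k : Euc n →L[ℝ] ℝ).hasFDerivAt.comp u hf.hasFDerivAt).fderiv
  exact congrArg (fun L : Euc n →L[ℝ] ℝ => L X) this

lemma pd_apply (i : Fin n) (f : Euc n → ℝ) (u : Euc n) : pd i f u = fderiv ℝ f u (bas i) := rfl

lemma dualVec_component (A : Bil n) (η : Euc n →L[ℝ] ℝ) (l : Fin n) :
    dualVec A η l = ∑ j, (mat A)⁻¹ l j * η (bas j) := by
  simp only [dualVec, trc, WithLp.ofLp_sum, Finset.sum_apply, PiLp.smul_apply, bas_apply,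
    smul_eq_mul, mul_ite, mul_one, mul_zero]
  rw [Finset.sum_eq_single l (fun b _ hb => by simp [hb.symm]) (by simp)]
  simp

/-- The Ricci tensor with one argument fixed, as a covector. -/
noncomputable def ricCov (h : Euc n → Bil n) (u Y : Euc n) : Euc n →L[ℝ] ℝ :=
  LinearMap.toContinuousLinearMap
    { toFun := fun Z => ric h u Y Z
      map_add' := fun Z Z' => by
        simp only [ric, riem, map_add, ← Finset.sum_add_distrib]
        refine Finset.sum_congr rfl fun i _ => ?_
        simp only [PiLp.add_apply, PiLp.sub_apply]
        ring
      map_smul' := fun c Z => by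
        simp only [ric, riem, map_smul, RingHom.id_apply, smul_eq_mul, Finset.mul_sum]
        refine Finset.sum_congr rfl fun i _ => ?_
        simp only [PiLp.add_apply, PiLp.sub_apply, PiLp.smul_apply, smul_eq_mul]
        ring }

lemma ricCov_apply (h : Euc n → Bil n) (u Y Z : Euc n) : ricCov h u Y Z = ric h u Y Z := rfl

lemma ric_eq_sum (h : Euc n → Bil n) (u Y Z : Euc n) :
    ric h u Y Z = ∑ j, Y j * ric h u (bas j) Z := by
  have hadd : ∀ Y Y', ric h u (Y + Y') Z = ric h u Y Z + ric h u Y' Z := fun Y Y' => by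
    simp only [ric, riem, map_add, add_apply, ← Finset.sum_add_distrib]
    refine Finset.sum_congr rfl fun i _ => ?_
    simp only [PiLp.add_apply, PiLp.sub_apply]
    ring
  have hsmul : ∀ (c : ℝ) Y, ric h u (c • Y) Z = c * ric h u Y Z := fun c Y => by
    simp only [ric, riem, map_smul, smul_apply, Finset.mul_sum]
    refine Finset.sum_congr rfl fun i _ => ?_
    simp only [PiLp.add_apply, PiLp.sub_apply, PiLp.smul_apply, smul_eq_mul]
    ring
  let L : Euc n →ₗ[ℝ] ℝ :=
    { toFun := fun Y => ric h u Y Z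
      map_add' := hadd
      map_smul' := hsmul }
  exact map_eq_sum_bas L Y

variable {M : Type*} [TopologicalSpace M] [ChartedSpace (Euc n) M] [IsManifold (𝓡 n) ∞ M]

lemma christoffel_eq (g : RMetric n M) (x₀ : M) (k i j : Fin n) :
    christoffel g x₀ k i j = chr (locMet g x₀) k i j := rfl

lemma riemann_eq (g : RMetric n M) (x₀ : M) {u : Euc n} (hu : u ∈ dom x₀) (l i j k : Fin n) :
    riemann g x₀ l i j k u = riem (locMet g x₀) u (bas i) (bas j) (bas k) l := by
  have hm := localMetric_locMet g x₀
  have hg := hm.differentiableAt_gam hu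
  have h1 : ∀ i j k, pd i (chr (locMet g x₀) l j k) u
      = fderiv ℝ (gam (locMet g x₀)) u (bas i) (bas j) (bas k) l := by
    intro i j k
    rw [pd_apply, ← fderiv_bil_apply_const hg, ← fderiv_component
      ((hg.clm_apply (differentiableAt_const _)).clm_apply (differentiableAt_const _))]
    simp only [gam_bas_apply]
  have h2 : ∀ i X, gam (locMet g x₀) u (bas i) X l
      = ∑ m, X m * chr (locMet g x₀) l i m u := by
    intro i X
    conv_lhs => rw [← sum_bas X]
    simp only [map_sum, map_smul, WithLp.ofLp_sum, Finset.sum_apply, PiLp.smul_apply,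
      gam_bas_apply, smul_eq_mul]
  simp only [riemann, riem, PiLp.add_apply, PiLp.sub_apply, h1, h2, gam_bas_apply, christoffel_eq,
    Finset.sum_sub_distrib]
  ring

lemma ricciTensor_eq (g : RMetric n M) (x₀ : M) {u : Euc n} (hu : u ∈ dom x₀) (j k : Fin n) :
    ricciTensor g x₀ j k u = ric (locMet g x₀) u (bas j) (bas k) :=
  Finset.sum_congr rfl fun i _ => riemann_eq g x₀ hu i i j k

lemma sharp_eq (g : RMetric n M) (x : M) (η : Euc n →L[ℝ] ℝ) :
    sharp g x η = dualVec (innerAt g x) η := by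
  have h : gram g x (cht x x) = mat (innerAt g x) := by rw [gram_eq, locMet_cht_self]
  refine PiLp.ext fun l => ?_
  have h2 : WithLp.ofLp (p := 2) (V := Fin n → ℝ) (sharp g x η) l
      = ∑ j, (gram g x (cht x x))⁻¹ l j * η (bas j) := rfl
  rw [dualVec_component, ← h, h2]

lemma normSq_eq (g : RMetric n M) (x : M) (η : Euc n →L[ℝ] ℝ) :
    normSq g x η = η (dualVec (innerAt g x) η) := by
  have h : normSq g x η = innerAt g x (sharp g x η) (sharp g x η) := rfl
  rw [h, sharp_eq, (isInner_innerAt g x).apply_dualVec]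

lemma ricciOp_eq (g : RMetric n M) (x : M) (v : Euc n) :
    ricciOp g x v = dualVec (innerAt g x) (ricCov (locMet g x) (cht x x) v) := by
  have h : gram g x (cht x x) = mat (innerAt g x) := by rw [gram_eq, locMet_cht_self]
  refine PiLp.ext fun l => ?_
  rw [dualVec_component, ← h]
  have h2 : WithLp.ofLp (p := 2) (V := Fin n → ℝ) (ricciOp g x v) l = ∑ j, ∑ k, (gram g x (cht x x))⁻¹ l k *
    ricciTensor g x j k (cht x x) * v j := rfl
  rw [h2, Finset.sum_comm]
  refine Finset.sum_congr rfl fun k _ => ?_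
  rw [ricCov_apply, ric_eq_sum, Finset.mul_sum]
  refine Finset.sum_congr rfl fun j _ => ?_
  rw [ricciTensor_eq g x (cht_mem (mem_src x))]
  ring

lemma flat_ricciOp (g : RMetric n M) (x : M) (v : Euc n) :
    flat g x (ricciOp g x v) = ricCov (locMet g x) (cht x x) v := by
  have h : flat g x (ricciOp g x v) = innerAt g x (ricciOp g x v) := rfl
  rw [h, ricciOp_eq]
  ext Z
  exact (isInner_innerAt g x).apply_dualVec _ _

/-- A map in the charts at `x` and `y`. -/
noncomputable def inCharts (x y : M) (φ : M → M) (w : Euc n) : Euc n := cht y (φ (par x w))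

lemma contDiffAt_inCharts {x y : M} {φ : M → M} {u : Euc n} (hu : u ∈ dom x)
    (hφ : ContMDiffAt (𝓡 n) (𝓡 n) ∞ φ (par x u)) (hy : φ (par x u) ∈ src (n := n) y) :
    ContDiffAt ℝ ∞ (inCharts x y φ) u := by
  rw [← contMDiffAt_iff_contDiffAt]
  have h1 := (contMDiffOn_cht y).contMDiffAt ((isOpen_src y).mem_nhds hy)
  have h2 := (contMDiffOn_par x).contMDiffAt ((isOpen_dom x).mem_nhds hu)
  exact h1.comp u (hφ.comp u h2)

lemma tension_eq (g h : RMetric n M) {φ : M → M} {x : M}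
    (hφ : ContMDiffAt (𝓡 n) (𝓡 n) ∞ φ x) :
    tension g h φ x
      = tens (locMet g x) (locMet h (φ x)) (inCharts x (φ x) φ) (cht x x) := by
  have hx : par x (cht (n := n) x x) = x := par_cht (mem_src x)
  have hf : ContDiffAt ℝ ∞ (inCharts x (φ x) φ) (cht (n := n) x x) :=
    contDiffAt_inCharts (cht_mem (mem_src x)) (by rwa [hx]) (by rw [hx]; exact mem_src _)
  set f := inCharts (n := n) x (φ x) φ with hf_def
  set u := cht (n := n) x x with hu_def
  have hfu : f u = cht (φ x) (φ x) := by rw [hf_def, inCharts, hx]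
  have hfd : ∀ᶠ w in nhds u, DifferentiableAt ℝ f w := by
    filter_upwards [(hf.of_le one_le_infty).eventually (by simp)] with w hw
    exact hw.differentiableAt (by simp)
  have hd2 : DifferentiableAt ℝ (fderiv ℝ f) u :=
    (hf.fderiv_right (m := ∞) (by simp)).differentiableAt (by simp)
  have h1 : ∀ c j, pd j (fun w => f w c) =ᶠ[nhds u] fun w => fderiv ℝ f w (bas j) c := by
    intro c j
    filter_upwards [hfd] with w hw
    exact fderiv_component hw _ _
  have h2 : ∀ c i j, pd i (pd j fun w => f w c) u = fderiv ℝ (fderiv ℝ f) u (bas i) (bas j) c := by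
    intro c i j
    rw [pd_apply, (h1 c j).fderiv_eq,
      fderiv_component (hd2.clm_apply (differentiableAt_const _)),
      fderiv_clm_apply_const hd2]
  have h3 : ∀ c i j, secondFundamentalForm g h φ x c i j
      = (fderiv ℝ (fderiv ℝ f) u (bas i) (bas j) - fderiv ℝ f u (gam (locMet g x) u (bas i) (bas j))
        + gam (locMet h (φ x)) (f u) (fderiv ℝ f u (bas i)) (fderiv ℝ f u (bas j))) c := by
    intro c i j
    have e : secondFundamentalForm g h φ x c i j
      = pd i (pd j fun w => f w c) u - ∑ k, chr (locMet g x) k i j u * pd k (fun w => f w c) u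
        + ∑ a, ∑ b, chr (locMet h (φ x)) c a b (f u) *
          pd i (fun w => f w a) u * pd j (fun w => f w b) u := by
      rw [hfu]; rfl
    rw [e, h2]
    simp only [fun c j => (h1 c j).self_of_nhds, PiLp.add_apply, PiLp.sub_apply]
    congr 1
    · congr 1
      rw [gam_bas]
      simp
    · conv_rhs => rw [← sum_bas (fderiv ℝ f u (bas i)), ← sum_bas (fderiv ℝ f u (bas j))]
      simp only [map_sum, map_smul, sum_apply, smul_apply, WithLp.ofLp_sum,
        Finset.sum_apply, PiLp.smul_apply, gam_bas_apply, smul_eq_mul, Finset.mul_sum]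
      rw [Finset.sum_comm]
      refine Finset.sum_congr rfl fun a _ => Finset.sum_congr rfl fun b _ => ?_
      ring
  refine PiLp.ext fun c => ?_
  have h4 : WithLp.ofLp (p := 2) (V := Fin n → ℝ) (tension g h φ x) c = ∑ i, ∑ j, (mat (locMet g x u))⁻¹ i j *
    secondFundamentalForm g h φ x c i j := rfl
  rw [h4, tens, trc]
  simp only [WithLp.ofLp_sum, Finset.sum_apply, PiLp.smul_apply, smul_eq_mul, h3]

/-- The squared norm of the tension field, in any chart. -/
lemma inner_tension (g h : RMetric n M) {φ : M → M} {x₀ y : M} (hy : y ∈ src (n := n) x₀)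
    (hφy : φ y ∈ src (n := n) x₀) (hφ : ContMDiff (𝓡 n) (𝓡 n) ∞ φ) :
    h.inner (φ y) (tension g h φ y) (tension g h φ y)
      = locMet h x₀ (inCharts x₀ x₀ φ (cht x₀ y))
        (tens (locMet g x₀) (locMet h x₀) (inCharts x₀ x₀ φ) (cht x₀ y))
        (tens (locMet g x₀) (locMet h x₀) (inCharts x₀ x₀ φ) (cht x₀ y)) := by
  have hyy : par y (cht (n := n) y y) = y := par_cht (mem_src y)
  have hyx : par x₀ (cht (n := n) x₀ y) = y := par_cht hy
  set p := cht (n := n) y y with hp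
  set f := inCharts (n := n) y (φ y) φ with hf_def
  set F := inCharts (n := n) x₀ x₀ φ with hF_def
  have hfp : f p = cht (φ y) (φ y) := by rw [hf_def, inCharts, hyy]
  have hpt : p ∈ transDom x₀ y := ⟨cht_mem (mem_src y), by rw [Set.mem_preimage, hyy]; exact hy⟩
  have hft : f p ∈ transDom x₀ (φ y) := by
    rw [hfp]
    exact ⟨cht_mem (mem_src _), by rw [Set.mem_preimage, par_cht (mem_src _)]; exact hφy⟩
  have htp : trans x₀ y p = cht x₀ y := by rw [trans, hyy]
  have hf : ContDiffAt ℝ ∞ f p :=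
    contDiffAt_inCharts hpt.1 hφ.contMDiffAt (by rw [hyy]; exact mem_src _)
  have hF : ContDiffAt ℝ ∞ F (trans x₀ y p) := by
    rw [htp]
    exact contDiffAt_inCharts (cht_mem hy) hφ.contMDiffAt (by rw [hyx]; exact hφy)
  have e : trans x₀ (φ y) ∘ f =ᶠ[nhds p] F ∘ trans x₀ y := by
    have h1 : ∀ᶠ w in nhds p, φ (par y w) ∈ src (n := n) (φ y) :=
      ((hφ.continuous.continuousAt).comp ((continuousOn_par y).continuousAt
        ((isOpen_dom y).mem_nhds hpt.1))).eventually_mem ((isOpen_src _).mem_nhds (by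
          rw [Function.comp_apply, hyy]; exact mem_src _))
    filter_upwards [(isOpen_transDom x₀ y).mem_nhds hpt, h1] with w hw hw1
    rw [Function.comp_apply, Function.comp_apply, hF_def, inCharts, par_trans hw, trans, hf_def,
      inCharts, par_cht hw1]
  -- The tension field at y is defined with the charts at y and at φ y. `k1` moves the domain and
  -- `k2` the target to the chart at x₀; by `e` the two composites are the same map near p.
  have k1 := (coordChange_trans g hpt).tens_domain (kt := locMet h x₀) hF
  have k2 := (coordChange_trans h hft).tens_target (h := locMet g y) hf
  rw [tens_congr _ _ e, k1, htp] at k2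
  have hFu : F (cht x₀ y) = trans x₀ (φ y) (f p) := by rw [← htp]; exact e.self_of_nhds.symm
  rw [k2, hFu, ← (coordChange_trans h hft).pull_self, hfp, locMet_cht_self, ← tension_eq g h
    hφ.contMDiffAt]
  rfl

end Components

end ConformalBiharmonic

namespace ConformalBiharmonic

/-! ### The Riemannian measure in a chart -/

section Volume

set_option synthInstance.maxHeartbeats 400000

open scoped Shortcuts

open MeasureTheory

variable {n : ℕ} {M : Type*} [TopologicalSpace M] [ChartedSpace (Euc n) M]

lemma ofReal_dens_trans [IsManifold (𝓡 n) ∞ M] (g : RMetric n M) {x₀ y : M} {p : Euc n} (hp : p ∈ transDom x₀ y) :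
    ENNReal.ofReal (dens (locMet g y) p) = ENNReal.ofReal |(fderiv ℝ (trans x₀ y) p).det|
      * ENNReal.ofReal (dens (locMet g x₀) (trans x₀ y p)) := by
  rw [← ENNReal.ofReal_mul (abs_nonneg _), dens, dens, locMet_trans g hp, det_mat_pullBil,
    Real.sqrt_mul (sq_nonneg _), Real.sqrt_sq_eq_abs]

variable [MeasurableSpace M]

/-- The Riemannian density in a chart, as a measure on `ℝⁿ`. -/
noncomputable def densMeasure [IsManifold (𝓡 n) ∞ M] (g : RMetric n M) (x₀ : M) :
    Measure (Euc n) :=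
  (volume.restrict (dom x₀)).withDensity fun u => ENNReal.ofReal (dens (locMet g x₀) u)

lemma chartVolume_eq_map [IsManifold (𝓡 n) ∞ M] (g : RMetric n M) (x₀ : M) :
    chartVolume g x₀ = (densMeasure g x₀).map (par x₀) := rfl

variable [BorelSpace M]

lemma measurableSet_dom_inter_par (x₀ : M) {A : Set M} (hA : MeasurableSet A) :
    MeasurableSet (dom (n := n) x₀ ∩ par x₀ ⁻¹' A) := by
  have h1 : Measurable ((dom (n := n) x₀).domRestrict (par x₀)) :=
    (continuousOn_iff_continuous_domRestrict.1 (continuousOn_par x₀)).measurable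
  have h2 := (isOpen_dom (n := n) x₀).measurableSet.subtype_image (h1 hA)
  convert! h2 using 1
  ext u
  simp [and_comm, Set.domRestrict]

variable [IsManifold (𝓡 n) ∞ M]

lemma aemeasurable_par (g : RMetric n M) (x₀ : M) : AEMeasurable (par x₀) (densMeasure g x₀) :=
  ((continuousOn_par x₀).aemeasurable (isOpen_dom x₀).measurableSet).mono_ac
    (withDensity_absolutelyContinuous _ _)

lemma chartVolume_apply (g : RMetric n M) (x₀ : M) {A : Set M} (hA : MeasurableSet A) :
    chartVolume g x₀ A
      = ∫⁻ u in dom x₀ ∩ par x₀ ⁻¹' A, ENNReal.ofReal (dens (locMet g x₀) u) := by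
  rw [chartVolume_eq_map, Measure.map_apply_of_aemeasurable (aemeasurable_par g x₀) hA, densMeasure,
    withDensity_apply', Measure.restrict_restrict' (isOpen_dom x₀).measurableSet, Set.inter_comm]

/-- Change of variables along the transition map; the density absorbs the Jacobian. Only an
inequality holds, since A may leave the domain of the chart at y. -/
lemma chartVolume_le (g : RMetric n M) (x₀ y : M) {A : Set M} (hA : MeasurableSet A)
    (hAx : A ⊆ src (n := n) x₀) : chartVolume g y A ≤ chartVolume g x₀ A := by
  rw [chartVolume_apply g y hA, chartVolume_apply g x₀ hA]
  set B := dom (n := n) y ∩ par y ⁻¹' A with hB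
  have hBt : ∀ p ∈ B, p ∈ transDom x₀ y := fun p hp => ⟨hp.1, hAx hp.2⟩
  have hinj : Set.InjOn (trans x₀ y) B := by
    intro p hp q hq hpq
    have h1 : par (n := n) y p = par y q := by
      rw [← par_trans (hBt p hp), ← par_trans (hBt q hq), hpq]
    rw [← cht_par hp.1, ← cht_par hq.1, h1]
  have hd : ∀ p ∈ B, HasFDerivWithinAt (trans x₀ y) (fderiv ℝ (trans x₀ y) p) B p := fun p hp =>
    (((contDiffOn_trans x₀ y).contDiffAt
      ((isOpen_transDom x₀ y).mem_nhds (hBt p hp))).differentiableAt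
        (by simp)).hasFDerivAt.hasFDerivWithinAt
  have hm : MeasurableSet B := measurableSet_dom_inter_par y hA
  calc ∫⁻ u in B, ENNReal.ofReal (dens (locMet g y) u)
      = ∫⁻ u in B, ENNReal.ofReal |(fderiv ℝ (trans x₀ y) u).det|
          * ENNReal.ofReal (dens (locMet g x₀) (trans x₀ y u)) :=
        setLIntegral_congr_fun hm fun p hp => ofReal_dens_trans g (hBt p hp)
    _ = ∫⁻ u in trans x₀ y '' B, ENNReal.ofReal (dens (locMet g x₀) u) :=
        (lintegral_image_eq_lintegral_abs_det_fderiv_mul volume hm hd hinj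
          fun u => ENNReal.ofReal (dens (locMet g x₀) u)).symm
    _ ≤ _ := by
        refine lintegral_mono_set ?_
        rintro _ ⟨p, hp, rfl⟩
        refine ⟨trans_mem (hBt p hp), ?_⟩
        rw [Set.mem_preimage, par_trans (hBt p hp)]
        exact hp.2

lemma riemannianVolume_restrict (g : RMetric n M) (x₀ : M) {A : Set M} (hA : MeasurableSet A)
    (hAx : A ⊆ src (n := n) x₀) :
    (riemannianVolume g).restrict A = (chartVolume g x₀).restrict A := by
  refine le_antisymm ?_ (Measure.restrict_mono le_rfl (le_iSup (chartVolume g) x₀))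
  have hs : MeasurableSet (src (n := n) x₀) := (isOpen_src x₀).measurableSet
  -- A supremum of measures is not computed set by set, so one measure bounding every `chartVolume g
  -- y` is needed: `chartVolume g x₀`, plus the full measure off the chart domain.
  have h1 : riemannianVolume g
      ≤ chartVolume g x₀ + (riemannianVolume g).restrict (src (n := n) x₀)ᶜ := by
    refine iSup_le fun y => Measure.le_iff.2 fun B hB => ?_
    rw [← measure_inter_add_sdiff B hs, Measure.add_apply, Measure.restrict_apply hB]
    refine add_le_add ?_ ?_
    · exact (chartVolume_le g x₀ y (hB.inter hs) Set.inter_subset_right).trans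
        (measure_mono Set.inter_subset_left)
    · exact le_iSup (chartVolume g) y _
  refine Measure.le_iff.2 fun B hB => ?_
  rw [Measure.restrict_apply hB, Measure.restrict_apply hB]
  refine (h1 _).trans ?_
  rw [Measure.add_apply, Measure.restrict_apply (hB.inter hA)]
  have h2 : B ∩ A ∩ (src (n := n) x₀)ᶜ = ∅ := by
    ext z
    simp only [Set.mem_inter_iff, Set.mem_compl_iff, Set.mem_empty_iff_false, iff_false]
    exact fun hz => hz.2 (hAx hz.1.2)
  rw [h2, measure_empty, add_zero]

/-- Integration against the Riemannian measure in a chart. -/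
lemma integral_riemannianVolume [T2Space M] (g : RMetric n M) (x₀ : M) {K : Set (Euc n)}
    (hK : IsCompact K) (hKU : K ⊆ dom x₀) {F : M → ℝ} (hF : ContinuousOn F (par x₀ '' K)) :
    ∫ x in par x₀ '' K, F x ∂(riemannianVolume g)
      = ∫ u in K, dens (locMet g x₀) u * F (par x₀ u) := by
  have hKM : MeasurableSet (par x₀ '' K) :=
    (hK.image_of_continuousOn ((continuousOn_par x₀).mono hKU)).isClosed.measurableSet
  have hsub : par x₀ '' K ⊆ src (n := n) x₀ := by
    rintro _ ⟨u, hu, rfl⟩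
    exact par_mem (hKU hu)
  have hU : MeasurableSet (dom (n := n) x₀) := (isOpen_dom x₀).measurableSet
  rw [riemannianVolume_restrict g x₀ hKM hsub, ← integral_indicator hKM, chartVolume_eq_map,
    integral_map (aemeasurable_par g x₀)
      ((aestronglyMeasurable_indicator_iff hKM).2 (hF.aestronglyMeasurable hKM)), densMeasure,
    integral_withDensity_eq_integral_toReal_smul₀
      (((localMetric_locMet g x₀).contDiffOn_dens.continuousOn.aemeasurable hU).ennreal_ofReal)
      (Filter.Eventually.of_forall fun _ => ENNReal.ofReal_lt_top)]
  have h1 : ∀ u ∈ dom (n := n) x₀, (ENNReal.ofReal (dens (locMet g x₀) u)).toReal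
        • (par x₀ '' K).indicator F (par x₀ u)
      = K.indicator (fun u => dens (locMet g x₀) u * F (par x₀ u)) u := by
    intro u hu
    have h2 : par x₀ u ∈ par x₀ '' K ↔ u ∈ K := by
      refine ⟨?_, fun h => Set.mem_image_of_mem _ h⟩
      rintro ⟨v, hv, hvu⟩
      rwa [← cht_par hu, ← hvu, cht_par (hKU hv)]
    rw [ENNReal.toReal_ofReal ((localMetric_locMet g x₀).dens_pos hu).le]
    by_cases hk : u ∈ K
    · rw [Set.indicator_of_mem hk, Set.indicator_of_mem (h2.2 hk), smul_eq_mul]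
    · rw [Set.indicator_of_notMem hk, Set.indicator_of_notMem (fun h => hk (h2.1 h)), smul_zero]
  rw [setIntegral_congr_fun hU h1, setIntegral_indicator hK.measurableSet,
    Set.inter_eq_self_of_subset_right hKU]

end Volume

end ConformalBiharmonic

namespace ConformalBiharmonic

/-! ### Variations of the identity supported in a chart -/

section ChartVariation

set_option synthInstance.maxHeartbeats 400000

open scoped Shortcuts

open MeasureTheory ConformalPair

variable {n : ℕ} {M : Type*} [TopologicalSpace M] [ChartedSpace (Euc n) M]

open Classical in
/-- The variation of the identity which in the chart at `x₀` moves in the direction `η Z`. -/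
noncomputable def chartVary (x₀ : M) (η : Euc n → ℝ) (Z : Euc n) (t : ℝ) (y : M) : M :=
  if y ∈ src (n := n) x₀ then par x₀ (vary η Z t (cht x₀ y)) else y

variable {x₀ : M} {η : Euc n → ℝ} {K : Set (Euc n)} {Z : Euc n} {t : ℝ}

lemma chartVary_of_mem {y : M} (hy : y ∈ src (n := n) x₀) :
    chartVary x₀ η Z t y = par x₀ (vary η Z t (cht x₀ y)) := if_pos hy

lemma chartVary_of_notMem (h0 : ∀ u ∉ K, η u = 0) {y : M} (hy : y ∉ par x₀ '' K) :
    chartVary x₀ η Z t y = y := by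
  by_cases hs : y ∈ src (n := n) x₀
  · have h1 : cht (n := n) x₀ y ∉ K := fun h => hy ⟨_, h, par_cht hs⟩
    rw [chartVary_of_mem hs, vary, h0 _ h1, mul_zero, zero_smul, add_zero, par_cht hs]
  · exact if_neg hs

lemma chartVary_zero : chartVary x₀ η Z 0 = id := by
  funext y
  by_cases hs : y ∈ src (n := n) x₀
  · rw [chartVary_of_mem hs, vary_zero, par_cht hs]; rfl
  · exact if_neg hs

/-- The variation moves only points of the compact K, and the tube lemma gives a uniform time during
which they stay in U. -/
lemma exists_vary_mem {U : Set (Euc n)} (hU : IsOpen U) (hη : ContDiff ℝ ∞ η) (hK : IsCompact K)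
    (hKU : K ⊆ U) (h0 : ∀ u ∉ K, η u = 0) (Z : Euc n) :
    ∃ ε > 0, ∀ t ∈ Set.Ioo (-ε) ε, ∀ u ∈ U, vary η Z t u ∈ U := by
  have ho : IsOpen ((fun p : ℝ × Euc n => vary η Z p.1 p.2) ⁻¹' U) :=
    hU.preimage (by unfold vary; have := hη.continuous; fun_prop)
  obtain ⟨V, W, hV, -, h0V, hKW, hVW⟩ := generalized_tube_lemma (isCompact_singleton (x := (0 : ℝ)))
    hK ho fun p hp => by
      have h1 : p.1 = 0 := hp.1
      rw [Set.mem_preimage, h1, vary_zero]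
      exact hKU hp.2
  obtain ⟨ε, hε, hεV⟩ := Metric.isOpen_iff.1 hV 0 (h0V rfl)
  refine ⟨ε, hε, fun t ht u hu => ?_⟩
  by_cases hk : u ∈ K
  · refine hVW (⟨hεV ?_, hKW hk⟩ : (t, u) ∈ V ×ˢ W)
    rw [Metric.mem_ball, dist_zero_right, Real.norm_eq_abs, abs_lt]
    exact ht
  · rwa [vary, h0 u hk, mul_zero, zero_smul, add_zero]

variable [IsManifold (𝓡 n) ∞ M]

/-- Two open sets cover the manifold: the chart domain, where the map is smooth in coordinates, and
the complement of the image of K, where it is the identity. That image is closed because it is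
compact in a Hausdorff space. -/
lemma contMDiffOn_chartVary [T2Space M] (hη : ContDiff ℝ ∞ η) (hK : IsCompact K)
    (hKU : K ⊆ dom x₀) (h0 : ∀ u ∉ K, η u = 0) {ε : ℝ}
    (hε : ∀ t ∈ Set.Ioo (-ε) ε, ∀ u ∈ dom (n := n) x₀, vary η Z t u ∈ dom x₀) :
    ContMDiffOn (𝓘(ℝ, ℝ).prod (𝓡 n)) (𝓡 n) ∞ (fun p : ℝ × M => chartVary x₀ η Z p.1 p.2)
      (Set.Ioo (-ε) ε ×ˢ Set.univ) := by
  intro p hp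
  refine ContMDiffAt.contMDiffWithinAt ?_
  by_cases hs : p.2 ∈ src (n := n) x₀
  · have e : (fun p : ℝ × M => chartVary x₀ η Z p.1 p.2)
        =ᶠ[nhds p] fun p => par x₀ (vary η Z p.1 (cht x₀ p.2)) := by
      filter_upwards [(isOpen_src (n := n) x₀).preimage continuous_snd |>.mem_nhds hs] with q hq
      exact chartVary_of_mem hq
    refine ContMDiffAt.congr_of_eventuallyEq ?_ e
    have h1 := (contMDiffOn_cht (n := n) x₀).contMDiffAt ((isOpen_src x₀).mem_nhds hs)
    have h2 : ContMDiffAt (𝓘(ℝ, ℝ).prod (𝓡 n)) 𝓘(ℝ, ℝ × Euc n) ∞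
        (fun q : ℝ × M => (q.1, cht (n := n) x₀ q.2)) p :=
      contMDiffAt_fst.prodMk_space (h1.comp p contMDiffAt_snd)
    have h3 := (contDiff_vary hη Z).contMDiff.contMDiffAt.comp p h2
    have h4 := (contMDiffOn_par (n := n) x₀).contMDiffAt
      ((isOpen_dom x₀).mem_nhds (hε p.1 hp.1 _ (cht_mem hs)))
    exact h4.comp p h3
  · have hcl : IsClosed (par x₀ '' K) :=
      (hK.image_of_continuousOn ((continuousOn_par x₀).mono hKU)).isClosed
    have hn : p.2 ∉ par x₀ '' K := by
      rintro ⟨u, hu, h⟩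
      exact hs (h ▸ par_mem (hKU hu))
    have e : (fun p : ℝ × M => chartVary x₀ η Z p.1 p.2) =ᶠ[nhds p] Prod.snd := by
      filter_upwards [hcl.isOpen_compl.preimage continuous_snd |>.mem_nhds hn] with q hq
      exact chartVary_of_notMem h0 hq
    exact contMDiffAt_snd.congr_of_eventuallyEq e

lemma contMDiff_chartVary [T2Space M] (hη : ContDiff ℝ ∞ η) (hK : IsCompact K)
    (hKU : K ⊆ dom x₀) (h0 : ∀ u ∉ K, η u = 0) {ε : ℝ}
    (hε : ∀ t ∈ Set.Ioo (-ε) ε, ∀ u ∈ dom (n := n) x₀, vary η Z t u ∈ dom x₀)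
    (ht : t ∈ Set.Ioo (-ε) ε) : ContMDiff (𝓡 n) (𝓡 n) ∞ (chartVary x₀ η Z t) := by
  rw [← contMDiffOn_univ]
  exact (contMDiffOn_chartVary hη hK hKU h0 hε).comp
    (contMDiffOn_const.prodMk contMDiffOn_id) fun y _ => ⟨ht, Set.mem_univ _⟩

lemma conformalPair_locMet (h : RMetric n M) {ρ : M → ℝ} (hρ : ContMDiff (𝓡 n) 𝓘(ℝ, ℝ) ∞ ρ)
    (x₀ : M) : ConformalPair (dom x₀) (locMet h x₀) (locMet (conformal h ρ hρ) x₀)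
      (fun u => ρ (par x₀ u)) where
  metric := localMetric_locMet h x₀
  smooth := by
    rw [← contMDiffOn_iff_contDiffOn]
    exact hρ.comp_contMDiffOn (contMDiffOn_par x₀)
  eq _ _ := rfl

variable {h : RMetric n M} {ρ : M → ℝ} {hρ : ContMDiff (𝓡 n) 𝓘(ℝ, ℝ) ∞ ρ}

lemma inner_tension_chartVary [T2Space M] (hη : ContDiff ℝ ∞ η) (hK : IsCompact K)
    (hKU : K ⊆ dom x₀) (h0 : ∀ u ∉ K, η u = 0) {ε : ℝ}
    (hε : ∀ t ∈ Set.Ioo (-ε) ε, ∀ u ∈ dom (n := n) x₀, vary η Z t u ∈ dom x₀)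
    (ht : t ∈ Set.Ioo (-ε) ε) (k : RMetric n M) {u : Euc n} (hu : u ∈ dom x₀) :
    dens (locMet h x₀) u * k.inner (chartVary x₀ η Z t (par x₀ u))
        (tension h k (chartVary x₀ η Z t) (par x₀ u)) (tension h k (chartVary x₀ η Z t) (par x₀ u))
      = varyEnergy (locMet h x₀) (locMet k x₀) η Z (t, u) := by
  have hF : ∀ w ∈ dom (n := n) x₀, inCharts x₀ x₀ (chartVary x₀ η Z t) w = vary η Z t w := by
    intro w hw
    rw [inCharts, chartVary_of_mem (par_mem hw), cht_par hw, cht_par (hε t ht w hw)]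
  have e : inCharts x₀ x₀ (chartVary x₀ η Z t) =ᶠ[nhds u] vary η Z t := by
    filter_upwards [(isOpen_dom x₀).mem_nhds hu] with w hw
    exact hF w hw
  rw [inner_tension h k (par_mem hu)
    (by rw [chartVary_of_mem (par_mem hu), cht_par hu]; exact par_mem (hε t ht u hu))
    (contMDiff_chartVary hη hK hKU h0 hε ht), cht_par hu, tens_congr _ _ e, hF u hu,
    tens_vary _ _ hη]
  rfl

lemma bienergy_chartVary [T2Space M] [MeasurableSpace M] [BorelSpace M] (hη : ContDiff ℝ ∞ η)
    (hK : IsCompact K) (hKU : K ⊆ dom x₀) (h0 : ∀ u ∉ K, η u = 0) {ε : ℝ}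
    (hε : ∀ t ∈ Set.Ioo (-ε) ε, ∀ u ∈ dom (n := n) x₀, vary η Z t u ∈ dom x₀)
    (ht : t ∈ Set.Ioo (-ε) ε) :
    bienergy h (conformal h ρ hρ) (par x₀ '' K) (chartVary x₀ η Z t)
      = (1 / 2) * ∫ u in K, varyEnergy (locMet h x₀) (locMet (conformal h ρ hρ) x₀) η Z (t, u) := by
  have hm := localMetric_locMet h x₀
  have hi := fun u (hu : u ∈ dom (n := n) x₀) =>
    inner_tension_chartVary (h := h) hη hK hKU h0 hε ht (conformal h ρ hρ) hu
  rw [bienergy, integral_riemannianVolume h x₀ hK hKU]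
  · congr 1
    exact setIntegral_congr_fun hK.measurableSet fun u hu => hi u (hKU hu)
  -- The integrand on the manifold is continuous because in the chart it is the smooth `varyEnergy`
  -- divided by the positive density.
  · have hcE : ContinuousOn (fun u => (dens (locMet h x₀) u)⁻¹ *
        varyEnergy (locMet h x₀) (locMet (conformal h ρ hρ) x₀) η Z (t, u)) (dom x₀) :=
      (hm.contDiffOn_dens.continuousOn.inv₀ fun u hu => (hm.dens_pos hu).ne').mul
        (((conformalPair_locMet h hρ x₀).contDiffOn_varyEnergy hη Z).continuousOn.comp
          (by fun_prop) fun u hu => ⟨hu, hε t ht u hu⟩)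
    have hsub : par x₀ '' K ⊆ src (n := n) x₀ := by
      rintro _ ⟨u, hu, rfl⟩
      exact par_mem (hKU hu)
    refine (hcE.comp ((continuousOn_cht x₀).mono hsub) fun y hy => cht_mem (hsub hy)).congr
      fun y hy => ?_
    have hy' := cht_mem (hsub hy)
    rw [Function.comp_apply, ← hi _ hy', par_cht (hsub hy), ← mul_assoc,
      inv_mul_cancel₀ (hm.dens_pos hy').ne', one_mul]

/-- The Euler-Lagrange equation of the bienergy of the identity, in a chart. -/
lemma euler_eq_zero_of_isBiharmonic [T2Space M] [MeasurableSpace M] [BorelSpace M] (hn : 2 < n)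
    (hbi : IsBiharmonic h (conformal h ρ hρ) (id : M → M)) (Z : Euc n) {u : Euc n}
    (hu : u ∈ dom x₀) : euler (locMet h x₀) (locMet (conformal h ρ hρ) x₀)
      (fun u => ρ (par x₀ u)) Z u = 0 := by
  have hc := conformalPair_locMet h hρ x₀
  refine hc.euler_eq_zero Z (fun η K hη hK hKU h0 => ?_) hu
  obtain ⟨ε, hε0, hε⟩ := exists_vary_mem (isOpen_dom x₀) hη hK hKU h0 Z
  have h1 := hbi.2 (par x₀ '' K) (hK.image_of_continuousOn ((continuousOn_par x₀).mono hKU)) ε hε0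
    (chartVary x₀ η Z) (contMDiffOn_chartVary hη hK hKU h0 hε) chartVary_zero
    fun t _ y hy => chartVary_of_notMem h0 hy
  have h2 := (hc.hasDerivAt_integral_varyEnergy hη hK hKU h0 Z).const_mul (1 / 2)
  have e : (fun t => bienergy h (conformal h ρ hρ) (par x₀ '' K) (chartVary x₀ η Z t))
      =ᶠ[nhds 0] fun t => (1 / 2) *
        ∫ u in K, varyEnergy (locMet h x₀) (locMet (conformal h ρ hρ) x₀) η Z (t, u) := by
    filter_upwards [Ioo_mem_nhds (neg_lt_zero.2 hε0) hε0] with t ht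
    exact bienergy_chartVary hη hK hKU h0 hε ht
  have h3 := (h1.congr_of_eventuallyEq e.symm).unique h2
  -- This is where the dimension matters: for n = 2 the identity is harmonic and the first variation
  -- vanishes for every ρ.
  have hn' : (2 - (n : ℝ)) ≠ 0 := by
    have : (2 : ℝ) < n := by exact_mod_cast hn
    linarith
  rw [← mul_assoc, ← mul_assoc] at h3
  exact (mul_eq_zero.1 h3.symm).resolve_left (mul_ne_zero (by norm_num) hn')

end ChartVariation

end ConformalBiharmonic

namespace ConformalBiharmonic

/-! ### The equation for the Ricci curvature -/

section RicciForm

set_option synthInstance.maxHeartbeats 400000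

open scoped Shortcuts

open ConformalPair

variable {n : ℕ}

/-- Naturality of ♯, needed to compare |dρ|² at a point with its expression in a chart centred
elsewhere. -/
lemma dualVec_pullBil {A : Bil n} (hA : IsInner A) (η : Euc n →L[ℝ] ℝ) {J : Euc n →L[ℝ] Euc n}
    (hJ : Function.Injective J) :
    J (dualVec (pullBil A J) (η.comp J)) = dualVec A η := by
  have hp : IsInner (pullBil A J) :=
    ⟨fun X Y => hA.symm _ _, fun X hX => hA.pos _ fun h => hX (hJ (h.trans (map_zero J).symm))⟩
  refine hA.eq_of_forall fun Z => ?_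
  obtain ⟨Z, rfl⟩ := (LinearMap.injective_iff_surjective (f := (J : Euc n →ₗ[ℝ] Euc n))).1 hJ Z
  rw [hA.apply_dualVec]
  exact hp.apply_dualVec (η.comp J) Z

/-- `d(a db) = da ∧ db`. -/
lemma fderiv_smul_fderiv_sub {a b : Euc n → ℝ} {u : Euc n} (ha : ContDiffAt ℝ ∞ a u)
    (hb : ContDiffAt ℝ ∞ b u) (X Y : Euc n) :
    fderiv ℝ (fun w => a w • fderiv ℝ b w) u X Y - fderiv ℝ (fun w => a w • fderiv ℝ b w) u Y X
      = fderiv ℝ a u X * fderiv ℝ b u Y - fderiv ℝ a u Y * fderiv ℝ b u X := by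
  have hd2 : DifferentiableAt ℝ (fderiv ℝ b) u :=
    (hb.fderiv_right (m := ∞) (by simp)).differentiableAt (by simp)
  have hs : fderiv ℝ (fderiv ℝ b) u X Y = fderiv ℝ (fderiv ℝ b) u Y X :=
    (hb.isSymmSndFDerivAt
      (by rw [minSmoothness_of_isRCLikeNormedField]; exact WithTop.coe_le_coe.2 le_top)).eq X Y
  rw [fderiv_fun_smul (ha.differentiableAt (by simp)) hd2]
  simp only [add_apply, smul_apply, ContinuousLinearMap.smulRight_apply, smul_eq_mul, hs]
  ring

variable {M : Type*} [TopologicalSpace M] [ChartedSpace (Euc n) M] [IsManifold (𝓡 n) ∞ M]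

/-- The differential of a function, as a covector on the model space. -/
noncomputable def covAt (f : M → ℝ) (y : M) : Euc n →L[ℝ] ℝ := extDeriv₀ (n := n) f y

lemma covAt_comp_dpar {f : M → ℝ} {x : M} {u : Euc n} (hu : u ∈ dom x)
    (hf : MDifferentiableAt (𝓡 n) 𝓘(ℝ, ℝ) f (par x u)) :
    (covAt f (par x u)).comp (dpar x u) = fderiv ℝ (fun w => f (par x w)) u := by
  have h := mfderiv_comp u hf (mdifferentiableAt_par x hu)
  rw [mfderiv_eq_fderiv] at h
  exact h.symm

/-- Serves for functions such as `laplAt` and `nrmAt`, whose value at each point is computed in that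
point's own chart: agreement with one smooth coordinate function over a whole chart makes them
differentiable. -/
lemma mdifferentiableAt_of_par {f : M → ℝ} {x : M} {F : Euc n → ℝ} (hF : ContDiffOn ℝ ∞ F (dom x))
    (hf : ∀ u ∈ dom (n := n) x, f (par x u) = F u) {y : M} (hy : y ∈ src (n := n) x) :
    MDifferentiableAt (𝓡 n) 𝓘(ℝ, ℝ) f y := by
  have h1 := (contMDiffOn_cht (n := n) x).contMDiffAt ((isOpen_src x).mem_nhds hy)
  have h2 := (hF.contDiffAt ((isOpen_dom x).mem_nhds (cht_mem hy))).contMDiffAt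
  have h3 : ContMDiffAt (𝓡 n) 𝓘(ℝ, ℝ) ∞ (F ∘ cht (n := n) x) y := h2.comp y h1
  refine (h3.congr_of_eventuallyEq ?_).mdifferentiableAt (by simp)
  filter_upwards [(isOpen_src (n := n) x).mem_nhds hy] with z hz
  rw [Function.comp_apply, ← hf _ (cht_mem hz), par_cht hz]

variable (h : RMetric n M) {ρ : M → ℝ}

/-- A function in the chart at `x`. -/
noncomputable def inChart (x : M) (ρ : M → ℝ) (u : Euc n) : ℝ := ρ (par x u)

/-- The function `div (e^{2ρ} dρ)`. -/
noncomputable def laplAt (ρ : M → ℝ) (y : M) : ℝ := lapl (locMet h y) (inChart y ρ) (cht y y)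

/-- The function `|dρ|²`. -/
noncomputable def nrmAt (ρ : M → ℝ) (y : M) : ℝ := normSq h y (extDeriv₀ ρ y)

lemma nrmAt_par (hρ : ContMDiff (𝓡 n) 𝓘(ℝ, ℝ) ∞ ρ) {x : M} {u : Euc n} (hu : u ∈ dom x) :
    nrmAt h ρ (par x u) = nrm (locMet h x) (inChart x ρ) u := by
  have h1 := covAt_comp_dpar hu (hρ.contMDiffAt (x := par x u) |>.mdifferentiableAt (by simp))
  have h2 : fderiv ℝ (inChart x ρ) u = (covAt ρ (par x u)).comp (dpar x u) := h1.symm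
  have h3 : nrmAt h ρ (par x u)
      = covAt ρ (par x u) (dualVec (innerAt h (par x u)) (covAt ρ (par x u))) :=
    normSq_eq h (par x u) (covAt ρ (par x u))
  rw [h3, nrm, grad, h2, ← dualVec_pullBil (isInner_innerAt h _) _ (injective_dpar x hu)]
  rfl

/-- The divergence is invariant under transition maps, and e^{2ρ}dρ pulls back to itself by the
chain rule. -/
lemma laplAt_par (hρ : ContMDiff (𝓡 n) 𝓘(ℝ, ℝ) ∞ ρ) {x : M} {u : Euc n} (hu : u ∈ dom x) :
    laplAt h ρ (par x u) = lapl (locMet h x) (inChart x ρ) u := by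
  have hy : par (par x u) (cht (n := n) (par x u) (par x u)) = par x u := par_cht (mem_src _)
  have hp : cht (n := n) (par x u) (par x u) ∈ transDom x (par x u) :=
    ⟨cht_mem (mem_src _), by rw [Set.mem_preimage, hy]; exact par_mem hu⟩
  have ht : trans x (par x u) (cht (n := n) (par x u) (par x u)) = u := by
    rw [trans, hy, cht_par hu]
  have hc := conformalPair_locMet h hρ x
  have hb := hc.metric.contDiffOn_differentiableAt hc.contDiffOn_bform (trans_mem hp)
  have e := (coordChange_trans h hp).dvg_eq hb (η' := bform (inChart (par x u) ρ)) (by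
    filter_upwards [(isOpen_transDom x (par x u)).mem_nhds hp] with w hw
    have hw' := (isOpen_transDom x (par x u)).mem_nhds hw
    have e1 : inChart (par x u) ρ =ᶠ[nhds w] inChart x ρ ∘ trans x (par x u) := by
      filter_upwards [hw'] with v hv
      rw [Function.comp_apply, inChart, inChart, par_trans hv]
    have e2 : fderiv ℝ (inChart (par x u) ρ) w
        = (fderiv ℝ (inChart x ρ) (trans x (par x u) w)).comp (fderiv ℝ (trans x (par x u)) w) := by
      rw [e1.fderiv_eq]
      exact fderiv_comp w (hc.metric.contDiffOn_differentiableAt hc.smooth (trans_mem hw))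
        (((contDiffOn_trans x (par x u)).contDiffAt hw').differentiableAt (by simp))
    rw [bform, bform, e2, fac, fac, e1.self_of_nhds]
    rfl)
  rw [ht] at e
  exact e

lemma contDiffOn_lapl (hρ : ContMDiff (𝓡 n) 𝓘(ℝ, ℝ) ∞ ρ) (x : M) :
    ContDiffOn ℝ ∞ (lapl (locMet h x) (inChart x ρ)) (dom x) :=
  have hc := conformalPair_locMet h hρ x
  hc.metric.contDiffOn_dvg hc.contDiffOn_bform

lemma contDiffOn_nrm_inChart (hρ : ContMDiff (𝓡 n) 𝓘(ℝ, ℝ) ∞ ρ) (x : M) :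
    ContDiffOn ℝ ∞ (nrm (locMet h x) (inChart x ρ)) (dom x) :=
  (conformalPair_locMet h hρ x).contDiffOn_nrm

lemma mdifferentiableAt_laplAt (hρ : ContMDiff (𝓡 n) 𝓘(ℝ, ℝ) ∞ ρ) (y : M) : MDifferentiableAt (𝓡 n) 𝓘(ℝ, ℝ) (laplAt h ρ) y :=
  mdifferentiableAt_of_par (contDiffOn_lapl h hρ y) (fun _ hu => laplAt_par h hρ hu) (mem_src y)

lemma mdifferentiableAt_nrmAt (hρ : ContMDiff (𝓡 n) 𝓘(ℝ, ℝ) ∞ ρ) (y : M) : MDifferentiableAt (𝓡 n) 𝓘(ℝ, ℝ) (nrmAt h ρ) y :=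
  mdifferentiableAt_of_par (contDiffOn_nrm_inChart h hρ y) (fun _ hu => nrmAt_par h hρ hu)
    (mem_src y)

lemma covAt_laplAt_comp (hρ : ContMDiff (𝓡 n) 𝓘(ℝ, ℝ) ∞ ρ) {x : M} {u : Euc n} (hu : u ∈ dom x) :
    (covAt (laplAt h ρ) (par x u)).comp (dpar x u)
      = fderiv ℝ (lapl (locMet h x) (inChart x ρ)) u := by
  rw [covAt_comp_dpar hu (mdifferentiableAt_laplAt h hρ _)]
  refine Filter.EventuallyEq.fderiv_eq ?_
  filter_upwards [(isOpen_dom x).mem_nhds hu] with w hw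
  exact laplAt_par h hρ hw

lemma covAt_nrmAt_comp (hρ : ContMDiff (𝓡 n) 𝓘(ℝ, ℝ) ∞ ρ) {x : M} {u : Euc n} (hu : u ∈ dom x) :
    (covAt (nrmAt h ρ) (par x u)).comp (dpar x u)
      = fderiv ℝ (nrm (locMet h x) (inChart x ρ)) u := by
  rw [covAt_comp_dpar hu (mdifferentiableAt_nrmAt h hρ _)]
  refine Filter.EventuallyEq.fderiv_eq ?_
  filter_upwards [(isOpen_dom x).mem_nhds hu] with w hw
  exact nrmAt_par h hρ hw

lemma covAt_comp (hρ : ContMDiff (𝓡 n) 𝓘(ℝ, ℝ) ∞ ρ) {x : M} {u : Euc n} (hu : u ∈ dom x) :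
    (covAt ρ (par x u)).comp (dpar x u) = fderiv ℝ (inChart x ρ) u :=
  covAt_comp_dpar hu (hρ.contMDiffAt.mdifferentiableAt (by simp))

/-- The 1-form `(Ricci (dρ)♯)♭`, with values in the dual of the model space. -/
noncomputable def ricForm (ρ : M → ℝ) (y : M) : Euc n →L[ℝ] ℝ :=
  flat h y (ricciOp h y (sharp h y (extDeriv₀ ρ y)))

variable [T2Space M] [MeasurableSpace M] [BorelSpace M]

/-- The Euler-Lagrange equation solved for the Ricci term, that is, divided by −2e^{2ρ}. The
right-hand side involves only functions and differentials on the manifold, so it can be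
differentiated in any chart. -/
lemma ricForm_eq (hn : 2 < n) (hρ : ContMDiff (𝓡 n) 𝓘(ℝ, ℝ) ∞ ρ)
    (hbi : IsBiharmonic h (conformal h ρ hρ) (id : M → M)) (y : M) :
    ricForm h ρ y = (-(1 / 2) : ℝ) • (Real.exp (-(2 * ρ y)) • covAt (n := n) (laplAt h ρ) y
      + ((6 - (n : ℝ)) * nrmAt h ρ y - 4 * (Real.exp (-(2 * ρ y)) * laplAt h ρ y)) • covAt (n := n) ρ y
      + (1 - (n : ℝ) / 2) • covAt (n := n) (nrmAt h ρ) y) := by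
  have hy : par y (cht (n := n) y y) = y := par_cht (mem_src y)
  have hu : cht (n := n) y y ∈ dom y := cht_mem (mem_src y)
  have hc := conformalPair_locMet h hρ y
  have k1 : fderiv ℝ (inChart y ρ) (cht y y) = covAt (n := n) ρ y := by
    rw [← covAt_comp hρ hu, dpar_cht_self, hy]; rfl
  have k2 : fderiv ℝ (lapl (locMet h y) (inChart y ρ)) (cht y y) = covAt (n := n) (laplAt h ρ) y := by
    rw [← covAt_laplAt_comp h hρ hu, dpar_cht_self, hy]; rfl
  have k3 : fderiv ℝ (nrm (locMet h y) (inChart y ρ)) (cht y y) = covAt (n := n) (nrmAt h ρ) y := by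
    rw [← covAt_nrmAt_comp h hρ hu, dpar_cht_self, hy]; rfl
  have k4 : ricForm h ρ y = ricCov (locMet h y) (cht y y)
      (grad (locMet h y) (inChart y ρ) (cht y y)) := by
    have e1 : ricForm h ρ y = ricCov (locMet h y) (cht y y) (sharp h y (extDeriv₀ ρ y)) :=
      flat_ricciOp h y _
    have e2 : grad (locMet h y) (inChart y ρ) (cht y y) = sharp h y (extDeriv₀ ρ y) := by
      rw [grad, k1, locMet_cht_self]
      exact (sharp_eq h y _).symm
    rw [e1, e2]
  ext Z
  have k5 : euler (locMet h y) (locMet (conformal h ρ hρ) y) (inChart y ρ) Z (cht y y) = 0 :=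
    euler_eq_zero_of_isBiharmonic hn hbi Z hu
  have k6 : fac (inChart y ρ) (cht (n := n) y y) = Real.exp (2 * ρ y) := by rw [fac, inChart, hy]
  have k7 : lapl (locMet h y) (inChart y ρ) (cht y y) = laplAt h ρ y := rfl
  have k8 : nrm (locMet h y) (inChart y ρ) (cht y y) = nrmAt h ρ y := by
    rw [← nrmAt_par h hρ hu, hy]
  have k9 := hc.euler_eq hu Z
  have k10 := k9.symm.trans k5
  have k11 : Real.exp (-(2 * ρ y)) * Real.exp (2 * ρ y) = 1 := by
    rw [← Real.exp_add, neg_add_cancel, Real.exp_zero]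
  rw [k4, ricCov_apply]
  change fderiv ℝ (lapl (locMet h y) (inChart y ρ)) (cht y y) Z
    + 2 * fac (inChart y ρ) (cht y y) * ric (locMet h y) (cht y y)
      (grad (locMet h y) (inChart y ρ) (cht y y)) Z
    + (6 - (n : ℝ)) * fac (inChart y ρ) (cht y y) * nrm (locMet h y) (inChart y ρ) (cht y y)
      * fderiv ℝ (inChart y ρ) (cht y y) Z
    + (1 - (n : ℝ) / 2) * fac (inChart y ρ) (cht y y)
      * fderiv ℝ (nrm (locMet h y) (inChart y ρ)) (cht y y) Z
    - 4 * lapl (locMet h y) (inChart y ρ) (cht y y) * fderiv ℝ (inChart y ρ) (cht y y) Z = 0 at k10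
  rw [k1, k2, k3, k6, k7, k8] at k10
  simp only [add_apply, smul_apply, smul_eq_mul]
  linear_combination (1 / 2) * Real.exp (-(2 * ρ y)) * k10
    - (ric (locMet h y) (cht y y) (grad (locMet h y) (inChart y ρ) (cht y y)) Z
      + (1 / 2) * (6 - (n : ℝ)) * nrmAt h ρ y * covAt (n := n) ρ y Z
      + (1 / 2) * (1 - (n : ℝ) / 2) * covAt (n := n) (nrmAt h ρ) y Z) * k11

end RicciForm

end ConformalBiharmonic

namespace ConformalBiharmonic

/-! ### The exterior derivative of the Ricci form and the final cancellation. -/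

section ExteriorDerivative

set_option synthInstance.maxHeartbeats 400000

open scoped Shortcuts

open ConformalPair

variable {n : ℕ} {M : Type*} [TopologicalSpace M] [ChartedSpace (Euc n) M] [IsManifold (𝓡 n) ∞ M]
  [T2Space M] [MeasurableSpace M] [BorelSpace M] (h : RMetric n M) {ρ : M → ℝ}

/-- The function `e^{-2ρ}`. -/
noncomputable def invFac (ρ : Euc n → ℝ) (u : Euc n) : ℝ := Real.exp (-(2 * ρ u))

lemma fderiv_invFac {ρ : Euc n → ℝ} {u : Euc n} (hρ : DifferentiableAt ℝ ρ u) (X : Euc n) :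
    fderiv ℝ (invFac ρ) u X = -2 * invFac ρ u * fderiv ℝ ρ u X := by
  have h1 : HasFDerivAt (invFac ρ) (invFac ρ u • -((2 : ℝ) • fderiv ℝ ρ u)) u :=
    ((hρ.hasFDerivAt.const_mul 2).neg).exp
  rw [h1.fderiv]
  simp only [neg_apply, smul_apply, smul_eq_mul]
  ring

/-- Each summand of `ricForm_eq` has the form a db. With s = e^{-2ρ} and ds = −2s dρ, the term s dP
contributes 2s dP∧dρ, while −4sP dρ contributes −4s dP∧dρ because ds∧dρ = 0. The constant multiple
of d|dρ|² is closed, and the overall factor −½ gives the stated coefficients. -/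
lemma fderiv_ricForm (hn : 2 < n) (hρ : ContMDiff (𝓡 n) 𝓘(ℝ, ℝ) ∞ ρ)
    (hbi : IsBiharmonic h (conformal h ρ hρ) (id : M → M)) (x : M) (X Y : Euc n) :
    let u : Euc n := cht x x
    fderiv ℝ (fun w => (ricForm h ρ (par x w)).comp (dpar x w)) u X Y
        - fderiv ℝ (fun w => (ricForm h ρ (par x w)).comp (dpar x w)) u Y X
      = Real.exp (-(2 * ρ x)) * (covAt (laplAt h ρ) x X * covAt ρ x Y
          - covAt (laplAt h ρ) x Y * covAt ρ x X)
        - (6 - (n : ℝ)) / 2 * (covAt (nrmAt h ρ) x X * covAt ρ x Y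
          - covAt (nrmAt h ρ) x Y * covAt ρ x X) := by
  intro u
  have hx : par x u = x := par_cht (mem_src x)
  have hu : u ∈ dom x := cht_mem (mem_src x)
  have hU := (isOpen_dom x).mem_nhds hu
  have hc := conformalPair_locMet h hρ x
  set r := inChart (n := n) x ρ with hr
  set P := lapl (locMet h x) r with hP
  set q := nrm (locMet h x) r with hq
  set s := invFac r with hs
  have sr : ContDiffAt ℝ ∞ r u := hc.smooth.contDiffAt hU
  have sP : ContDiffAt ℝ ∞ P u := (contDiffOn_lapl h hρ x).contDiffAt hU
  have sq : ContDiffAt ℝ ∞ q u := (contDiffOn_nrm_inChart h hρ x).contDiffAt hU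
  have ss : ContDiffAt ℝ ∞ s u := (contDiffAt_const.mul sr).neg.exp
  have sc : ContDiffAt ℝ ∞ (fun w => (6 - (n : ℝ)) * q w - 4 * (s w * P w)) u :=
    (contDiffAt_const.mul sq).sub (contDiffAt_const.mul (ss.mul sP))
  have s1 : ContDiffAt ℝ ∞ (fun _ : Euc n => 1 - (n : ℝ) / 2) u := contDiffAt_const
  have k1 : fderiv ℝ r u = covAt ρ x := by
    rw [← covAt_comp hρ hu, dpar_cht_self, hx]; rfl
  have k2 : fderiv ℝ P u = covAt (laplAt h ρ) x := by
    rw [← covAt_laplAt_comp h hρ hu, dpar_cht_self, hx]; rfl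
  have k3 : fderiv ℝ q u = covAt (nrmAt h ρ) x := by
    rw [← covAt_nrmAt_comp h hρ hu, dpar_cht_self, hx]; rfl
  have k4 : s u = Real.exp (-(2 * ρ x)) := by rw [hs, invFac, hr, inChart, hx]
  -- The equation is needed on a neighbourhood of x, not only at x, since it is about to be
  -- differentiated.
  have e : (fun w => (ricForm h ρ (par x w)).comp (dpar x w)) =ᶠ[nhds u]
      fun w => (-(1 / 2) : ℝ) • (s w • fderiv ℝ P w
        + ((6 - (n : ℝ)) * q w - 4 * (s w * P w)) • fderiv ℝ r w
        + (1 - (n : ℝ) / 2) • fderiv ℝ q w) := by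
    filter_upwards [hU] with w hw
    have a1 : fderiv ℝ P w = _ := (covAt_laplAt_comp h hρ hw).symm
    have a2 : fderiv ℝ r w = _ := (covAt_comp hρ hw).symm
    have a3 : fderiv ℝ q w = _ := (covAt_nrmAt_comp h hρ hw).symm
    have a4 : P w = _ := (laplAt_par h hρ hw).symm
    have a5 : q w = _ := (nrmAt_par h hρ hw).symm
    rw [ricForm_eq h hn hρ hbi, a1, a2, a3, a4, a5]
    rfl
  have D2 : ∀ {f : Euc n → ℝ}, ContDiffAt ℝ ∞ f u → DifferentiableAt ℝ (fderiv ℝ f) u := fun hf =>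
    (hf.fderiv_right (m := ∞) (by simp)).differentiableAt (by simp)
  have D1 : ∀ {f : Euc n → ℝ}, ContDiffAt ℝ ∞ f u → DifferentiableAt ℝ f u := fun hf =>
    hf.differentiableAt (by simp)
  have d1 := (D1 ss).fun_smul (D2 sP)
  have d2 := (D1 sc).fun_smul (D2 sr)
  have d3 := (D1 s1).fun_smul (D2 sq)
  have w1 := fderiv_smul_fderiv_sub ss sP X Y
  have w2 := fderiv_smul_fderiv_sub sc sr X Y
  have w3 := fderiv_smul_fderiv_sub s1 sq X Y
  have c1 : ∀ V, fderiv ℝ (fun w => (6 - (n : ℝ)) * q w - 4 * (s w * P w)) u V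
      = (6 - (n : ℝ)) * fderiv ℝ q u V
        - 4 * (s u * fderiv ℝ P u V + P u * fderiv ℝ s u V) := by
    intro V
    rw [fderiv_fun_sub ((D1 sq).const_mul _) (((D1 ss).fun_mul (D1 sP)).const_mul _),
      fderiv_const_mul (D1 sq), fderiv_const_mul ((D1 ss).fun_mul (D1 sP)),
      fderiv_fun_mul (D1 ss) (D1 sP)]
    simp only [sub_apply, smul_apply, add_apply, smul_eq_mul]
  rw [c1, c1] at w2
  rw [hasFDerivAt_const _ _ |>.fderiv] at w3
  rw [fderiv_invFac (D1 sr), fderiv_invFac (D1 sr)] at w1 w2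
  rw [e.fderiv_eq, fderiv_fun_const_smul ((d1.fun_add d2).fun_add d3), fderiv_fun_add (d1.fun_add d2) d3,
    fderiv_fun_add d1 d2, ← k1, ← k2, ← k3, ← k4]
  simp only [add_apply, smul_apply, smul_eq_mul, zero_apply] at w3 ⊢
  linear_combination (-(1 / 2) : ℝ) * (w1 + w2 + w3)

/-- The terms e^{-2ρ} dP∧dρ of 2ω∧dρ and dω are opposite. The coefficient of d|dρ|²∧dρ is (4 − n) −
(1 − n/2) − (6 − n)/2 = 0. -/
lemma ricForm_identity (hn : 2 < n) (hρ : ContMDiff (𝓡 n) 𝓘(ℝ, ℝ) ∞ ρ)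
    (hbi : IsBiharmonic h (conformal h ρ hρ) (id : M → M)) (x : M) (X Y : Euc n) :
    let u : Euc n := cht x x
    (4 - (n : ℝ)) * (covAt (nrmAt h ρ) x X * covAt ρ x Y - covAt (nrmAt h ρ) x Y * covAt ρ x X)
      + 2 * (ricForm h ρ x X * covAt ρ x Y - ricForm h ρ x Y * covAt ρ x X)
      + (fderiv ℝ (fun w => (ricForm h ρ (par x w)).comp (dpar x w)) u X Y
        - fderiv ℝ (fun w => (ricForm h ρ (par x w)).comp (dpar x w)) u Y X) = 0 := by
  intro u
  rw [fderiv_ricForm h hn hρ hbi x X Y, ricForm_eq h hn hρ hbi x]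
  simp only [add_apply, smul_apply, smul_eq_mul]
  ring

end ExteriorDerivative

end ConformalBiharmonic
open ConformalBiharmonic in
theorem mainTheorem7 (n : ℕ) (hn : 2 < n) {N : Type*} [TopologicalSpace N] [T2Space N]
    [ChartedSpace (EuclideanSpace ℝ (Fin n)) N] [IsManifold (𝓡 n) ∞ N]
    [MeasurableSpace N] [BorelSpace N]
    (h : RMetric n N) (ρ : N → ℝ) (hρ : ContMDiff (𝓡 n) 𝓘(ℝ, ℝ) ∞ ρ)
    (α : (x : N) → TangentSpace (𝓡 n) x →L[ℝ] ℝ) (hα : α = extDeriv₀ ρ)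
    (hbi : IsBiharmonic h (conformal h ρ hρ) (id : N → N)) :
    ∀ (x : N) (X Y : TangentSpace (𝓡 n) x),
      (4 - (n : ℝ)) * wedge (extDeriv₀ (fun y => normSq h y (α y)) x) (α x) X Y
        + 2 * wedge (flat h x (ricciOp h x (sharp h x (α x)))) (α x) X Y
        + extDeriv₁ (fun y => flat h y (ricciOp h y (sharp h y (α y)))) x X Y = 0 := by
  subst hα
  intro x X Y
  -- `wedge`, `extDeriv₁` and `chartForm` unfold to the coordinate expressions of
  -- `ricForm_identity`, so no further argument is needed.
  exact ricForm_identity h hn hρ hbi x X Y
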